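/- Conventions. Let $V=\mathbb R\otimes\Lambda$ be the finite-dimensional real vector space of a lattice $\Lambda$. A weighted polyhedral complex $\mathcal X$ in $V$ is a finite, pure-dimensional complex of rational polyhedra (finite intersections of half-spaces $\{x: a(x)\ge b\}$ with $a\in\Lambda^\vee$, $b\in\mathbb R$) with an integer weight $\omega_{\mathcal X}(\sigma)$ on each maximal cell $\sigma$. For a cell $\sigma$ let $V_\sigma$ be the linear span of the differences of points of $\sigma$ and $\Lambda_\sigma=V_\sigma\cap\Lambda$. For a codimension one face $\tau<\sigma$ let $u_{\sigma/\tau}\in\Lambda_\sigma$ be a representative of the primitive normal vector, i.e. of the generator of $\Lambda_\sigma/\Lambda_\tau\cong\mathbb Z$ that points from $\tau$ into $\sigma$. A tropical cycle $X$ in $V$ is the class, modulo refinement, of a weighted polyhedral complex $\mathcal X$ that is balanced: $\sum_{\sigma>\tau}\omega_{\mathcal X}(\sigma)\,u_{\sigma/\tau}\in V_\tau$ for every cell $\tau$ of codimension one. The representatives are called the polyhedral structures of $X$, and $|X|$ is the union of the maximal cells of nonzero weight. $X$ is a tropical variety if all its nonzero weights are positive. The star $\mathrm{Star}_X(p)$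 at $p\in|X|$ is the cycle supported on the vectors $v$ with $p+\varepsilon v\in|X|$ for all small $\varepsilon>0$, with the weights induced by $X$. A morphism $f:X\to Y$ of tropical cycles (in $V=\mathbb R\otimes\Lambda$ and $W=\mathbb R\otimes\Lambda'$) is a map $|X|\to|Y|$ that is locally integer affine linear, i.e. locally on $|X|$ the sum of (the restriction of) a linear map $V\to W$ mapping $\Lambda$ into $\Lambda'$ and a translation by a vector of $W$. It is an isomorphism if it has an inverse which is a morphism and if, for suitable polyhedral structures of $X$ and $Y$, it maps maximal cells (of nonzero weight) to maximal cells of the same weight. For a loopfree matroid $M$ on $[n]$, the matroid variety $\mathrm{trop}(M)\subseteq\mathbb R^n$ is the cycle given by the cones $\{\sum_{i=1}^{p}\lambda_iV_{F_i}:\lambda_1,\dots,\lambda_{p-1}\ge0,\ \lambda_p\in\mathbb R\}$ for the chains $\emptyset\subsetneq F_1\subsetneq\dots\subsetneq F_p=[n]$ of flats of $M$, where $V_F=-\sum_{i\in F}e_i$, with all weights $1$ and lattice $\mathbb Z^n$. A tropical variety $X$ is smooth if for every $p\in|X|$ the star $\mathrm{Star}_X(p)$ is isomorphic to a matroid variety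 modulo lineality space, i.e. to $\mathrm{trop}(M)/L$ in $\mathbb R^n/L$ for some such $M$ and some rational linear subspace $L$ of the lineality space of $\mathrm{trop}(M)$. A map $f:|X|\to|Y|$ is a pseudo-morphism $X\to Y$ if there is a polyhedral structure $\mathcal X$ of $X$ such that 1. on each cell $\sigma\subseteq|X|$ of $\mathcal X$ the map $f$ is integer affine linear; let $\lambda_{f|\sigma}$ be its linear part on $V_\sigma$; 2. for each codimension one cell $\tau\subseteq|X|$ of $\mathcal X$, $$\sum_{\sigma>\tau}\omega_{\mathcal X}(\sigma)\,\lambda_{f|\sigma}(u_{\sigma/\tau})=\lambda_{f|\tau}\Big(\sum_{\sigma>\tau}\omega_{\mathcal X}(\sigma)\,u_{\sigma/\tau}\Big),$$ where cells $\sigma$ of weight zero contribute nothing (the condition does not depend on the choice of the representatives $u_{\sigma/\tau}$). Proposition. Let $X$ be a smooth tropical variety, $Y$ any tropical cycle and $f:X\to Y$ a pseudo-morphism. Then $f$ is a morphism. -/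

import Mathlib

open scoped Topology

/-- The data of a weighted polyhedral complex in `V`: a finite set of cells and an integer weight
for each maximal cell (the values of `weight` at other sets are irrelevant). -/
structure WeightedComplex (V : Type*) where
  cells : Finset (Set V)
  weight : Set V → ℤ

section Polyhedra

variable {V : Type*} [AddCommGroup V] [Module ℝ V]

/-- A finite intersection of half spaces `{x | b ≤ a x}` where `a` is an integer linear form
(integral on the lattice `Λ`) and `b` is a real number. -/
def IsRationalPolyhedron (Λ : Submodule ℤ V) (σ : Set V) : Prop :=
  ∃ s : Finset ((V →ₗ[ℝ] ℝ) × ℝ),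
    (∀ a ∈ s, ∀ v ∈ Λ, ∃ k : ℤ, a.1 v = k) ∧ σ = {x | ∀ a ∈ s, a.2 ≤ a.1 x}

/-- The dimension of `σ`, i.e. the dimension of the linear space `V_σ` generated by differences of
elements of `σ`. -/
noncomputable def cellDim (σ : Set V) : ℕ := Module.finrank ℝ (vectorSpan ℝ σ)

/-- `u` represents the primitive normal vector `u_{σ/τ}` of `σ` relative to its codimension one
face `τ`: it is a lattice vector in `V_σ` whose class generates `Λ_σ / Λ_τ` and which points from
`τ` into `σ`. -/
def IsNormalVector (Λ : Submodule ℤ V) (τ σ : Set V) (u : V) : Prop :=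
  u ∈ Λ ∧ u ∈ vectorSpan ℝ σ ∧
    (∀ w ∈ Λ, w ∈ vectorSpan ℝ σ → ∃ k : ℤ, w - k • u ∈ vectorSpan ℝ τ) ∧
    ∃ p ∈ τ, ∃ t : ℝ, 0 < t ∧ p + t • u ∈ σ

/-- The cone of all vectors `v` such that `p + ε v ∈ σ` for small positive `ε` (for convex `σ`
containing `p`, one positive `ε` suffices). -/
def localCone (p : V) (σ : Set V) : Set V := {v | ∃ ε : ℝ, 0 < ε ∧ p + ε • v ∈ σ}

end Polyhedra

namespace WeightedComplex

section Basic

variable {V : Type*}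

/-- The inclusion-maximal cells. -/
def IsMaxCell (X : WeightedComplex V) (σ : Set V) : Prop := Maximal (· ∈ X.cells) σ

/-- The support: the union of the maximal cells of nonzero weight. -/
def support (X : WeightedComplex V) : Set V := {x | ∃ σ, X.IsMaxCell σ ∧ X.weight σ ≠ 0 ∧ x ∈ σ}

open Classical in
/-- The cells `σ > τ`. -/
noncomputable def above (X : WeightedComplex V) (τ : Set V) : Finset (Set V) :=
  X.cells.filter (fun σ => τ ⊂ σ)

/-- `X'` is a refinement of `X`. -/
def Refines (X' X : WeightedComplex V) : Prop :=
  X'.support = X.support ∧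
    ∀ σ', X'.IsMaxCell σ' → X'.weight σ' ≠ 0 →
      ∃ σ, X.IsMaxCell σ ∧ σ' ⊆ σ ∧ X'.weight σ' = X.weight σ

variable [AddCommGroup V] [Module ℝ V]

/-- The dimension of a complex: the largest dimension of a cell. -/
noncomputable def dim (X : WeightedComplex V) : ℕ := X.cells.sup cellDim

variable [TopologicalSpace V]

/-- `X` is a pure-dimensional rational polyhedral complex. Faces of a cell are its nonempty exposed
faces, i.e. the sets where some linear form attains its maximum on the cell. -/
structure IsRationalComplex (Λ : Submodule ℤ V) (X : WeightedComplex V) : Prop where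
  nonempty : ∀ σ ∈ X.cells, σ.Nonempty
  polyhedron : ∀ σ ∈ X.cells, IsRationalPolyhedron Λ σ
  face_mem : ∀ σ ∈ X.cells, ∀ τ : Set V, τ.Nonempty → IsExposed ℝ σ τ → τ ∈ X.cells
  inter_face : ∀ σ ∈ X.cells, ∀ σ' ∈ X.cells, (σ ∩ σ').Nonempty →
    IsExposed ℝ σ (σ ∩ σ') ∧ IsExposed ℝ σ' (σ ∩ σ')
  pure : ∀ σ, X.IsMaxCell σ → cellDim σ = X.dim

/-- A balanced weighted rational polyhedral complex. It represents a tropical cycle; complexes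
that are `Equivalent` (see below) represent the same cycle. -/
structure IsTropicalCycle (Λ : Submodule ℤ V) (X : WeightedComplex V) : Prop
    extends IsRationalComplex Λ X where
  balanced : ∀ τ ∈ X.cells, cellDim τ + 1 = X.dim →
    ∃ u : Set V → V, (∀ σ ∈ X.above τ, IsNormalVector Λ τ σ (u σ)) ∧
      ∑ σ ∈ X.above τ, X.weight σ • u σ ∈ vectorSpan ℝ τ

/-- Two complexes represent the same cycle if they have a common refinement. -/
def Equivalent (Λ : Submodule ℤ V) (X X' : WeightedComplex V) : Prop :=
  ∃ Z : WeightedComplex V, Z.IsRationalComplex Λ ∧ Z.Refines X ∧ Z.Refines X'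

/-- `𝒳` is a polyhedral structure of the cycle represented by `X`. -/
def IsPolyhedralStructure (Λ : Submodule ℤ V) (X 𝒳 : WeightedComplex V) : Prop :=
  𝒳.IsTropicalCycle Λ ∧ Equivalent Λ X 𝒳

open Classical in
/-- The star of `X` around the point `p`. The sum in `weight` has exactly one summand if `C` is a
cell of the star of a polyhedral complex. -/
noncomputable def star (X : WeightedComplex V) (p : V) : WeightedComplex V where
  cells := (X.cells.filter (fun σ => p ∈ σ)).image (localCone p)
  weight := fun C => ∑ σ ∈ X.cells.filter (fun σ => p ∈ σ ∧ localCone p σ = C), X.weight σ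

open Classical in
/-- The preimage in `V` of a weighted complex in `V ⧸ L`. -/
noncomputable def preimage (L : Submodule ℝ V) (Z : WeightedComplex (V ⧸ L)) :
    WeightedComplex V where
  cells := Z.cells.image (fun C => L.mkQ ⁻¹' C)
  weight := fun σ => Z.weight (L.mkQ '' σ)

end Basic

end WeightedComplex

section Morphisms

variable {V W : Type*} [AddCommGroup V] [Module ℝ V] [TopologicalSpace V]
  [AddCommGroup W] [Module ℝ W] [TopologicalSpace W]

/-- On `s`, the map `f` is the sum of the linear map `l`, which maps the lattice `Λ` into the
lattice `Λ'`, and a translation by a real vector. -/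
def IsIntegerAffineOn (Λ : Submodule ℤ V) (Λ' : Submodule ℤ W) (f : V → W) (s : Set V)
    (l : V →ₗ[ℝ] W) : Prop :=
  (∀ v ∈ Λ, l v ∈ Λ') ∧ ∃ c : W, ∀ x ∈ s, f x = l x + c

/-- `f` (of which only the values on `|X|` matter) is a morphism of tropical cycles: it maps `|X|`
to `|Y|` and is locally on `|X|` integer affine linear. -/
def IsMorphism (Λ : Submodule ℤ V) (Λ' : Submodule ℤ W) (X : WeightedComplex V)
    (Y : WeightedComplex W) (f : V → W) : Prop :=
  Set.MapsTo f X.support Y.support ∧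
    ∀ p ∈ X.support, ∃ U ∈ 𝓝 p, ∃ l : V →ₗ[ℝ] W, IsIntegerAffineOn Λ Λ' f (X.support ∩ U) l

/-- `f` respects the weights: for suitable polyhedral structures it maps maximal cells to maximal
cells of the same weight. -/
def RespectsWeights (Λ : Submodule ℤ V) (Λ' : Submodule ℤ W) (X : WeightedComplex V)
    (Y : WeightedComplex W) (f : V → W) : Prop :=
  ∃ (𝒳 : WeightedComplex V) (𝒴 : WeightedComplex W),
    X.IsPolyhedralStructure Λ 𝒳 ∧ Y.IsPolyhedralStructure Λ' 𝒴 ∧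
    ∀ σ, 𝒳.IsMaxCell σ → 𝒳.weight σ ≠ 0 → 𝒴.IsMaxCell (f '' σ) ∧ 𝒴.weight (f '' σ) = 𝒳.weight σ

/-- `f` is an isomorphism of tropical cycles. -/
def IsIsomorphism (Λ : Submodule ℤ V) (Λ' : Submodule ℤ W) (X : WeightedComplex V)
    (Y : WeightedComplex W) (f : V → W) : Prop :=
  IsMorphism Λ Λ' X Y f ∧ RespectsWeights Λ Λ' X Y f ∧
    ∃ g : W → V, IsMorphism Λ' Λ Y X g ∧ Set.InvOn g f X.support Y.support

/-- `f` (of which only the values on `|X|` matter) is a pseudo-morphism from `X` to `Y`: it maps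
`|X|` to `|Y|` and, for some polyhedral structure `𝒳` of `X`, it is integer affine linear on each
cell `σ` of `|X|`, with linear part `l σ`, and these linear parts respect the balancing equations:
`∑_{σ > τ} ω(σ) l_σ(u_{σ/τ}) = l_τ(∑_{σ > τ} ω(σ) u_{σ/τ})` for each codimension one cell `τ`
and representatives `u_{σ/τ}` of the primitive normal vectors (the choice of the representatives
does not matter, since `l_σ` and `l_τ` agree on `V_τ`). -/
def IsPseudoMorphism (Λ : Submodule ℤ V) (Λ' : Submodule ℤ W) (X : WeightedComplex V)
    (Y : WeightedComplex W) (f : V → W) : Prop :=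
  Set.MapsTo f X.support Y.support ∧
    ∃ 𝒳 : WeightedComplex V, X.IsPolyhedralStructure Λ 𝒳 ∧
    ∃ l : Set V → (V →ₗ[ℝ] W),
      (∀ σ ∈ 𝒳.cells, σ ⊆ X.support → IsIntegerAffineOn Λ Λ' f σ (l σ)) ∧
      ∀ τ ∈ 𝒳.cells, τ ⊆ X.support → cellDim τ + 1 = 𝒳.dim →
        ∃ u : Set V → V, (∀ σ ∈ 𝒳.above τ, IsNormalVector Λ τ σ (u σ)) ∧
          ∑ σ ∈ 𝒳.above τ, 𝒳.weight σ • l σ (u σ) = l τ (∑ σ ∈ 𝒳.above τ, 𝒳.weight σ • u σ)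

end Morphisms

section Matroids

/-- The lattice `ℤⁿ` in `ℝⁿ`. -/
noncomputable def standardLattice (n : ℕ) : Submodule ℤ (Fin n → ℝ) :=
  Submodule.span ℤ (Set.range (Pi.basisFun ℝ (Fin n)))

/-- The vector `V_F = -∑_{i ∈ F} e_i`. -/
noncomputable def flatVector {n : ℕ} (F : Set (Fin n)) : Fin n → ℝ := -F.indicator 1

/-- The cone generated by `V_F` for `F ∈ 𝓕` and by `± V_E`, where `E = [n]`. -/
def flagCone {n : ℕ} (𝓕 : Finset (Set (Fin n))) : Set (Fin n → ℝ) :=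
  {x | ∃ (c : Set (Fin n) → ℝ) (μ : ℝ), (∀ F ∈ 𝓕, 0 ≤ c F) ∧
    x = ∑ F ∈ 𝓕, c F • flatVector F + μ • flatVector Set.univ}

/-- `𝓕` is a chain of nonempty proper flats of the matroid `M` with ground set `[n]`. -/
def IsFlagOfFlats {n : ℕ} (M : Matroid (Fin n)) (𝓕 : Finset (Set (Fin n))) : Prop :=
  (∀ F ∈ 𝓕, M.IsFlat F ∧ F.Nonempty ∧ F ≠ Set.univ) ∧ IsChain (· ⊆ ·) (𝓕 : Set (Set (Fin n)))

open Classical in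
/-- The matroid variety `trop(M)` of a loopfree matroid `M` with ground set `[n]`, given by its fine
subdivision `ℬ(M)`: the cones of chains of flats, with trivial weights. -/
noncomputable def tropMatroid {n : ℕ} (M : Matroid (Fin n)) : WeightedComplex (Fin n → ℝ) where
  cells := (Finset.univ.filter (fun 𝓕 : Finset (Set (Fin n)) => IsFlagOfFlats M 𝓕)).image flagCone
  weight := fun _ => 1

/-- `Z` represents the cycle `trop(M)/L` in `ℝⁿ/L`, where `L` is a rational subspace of the
lineality space of `trop(M)`: the preimage of `Z` in `ℝⁿ` is the cycle `trop(M)`. The lattice of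
`ℝⁿ/L` is the image of `ℤⁿ`. -/
def IsTropMatroidModLineality {n : ℕ} (M : Matroid (Fin n)) (L : Submodule ℝ (Fin n → ℝ))
    (Z : WeightedComplex ((Fin n → ℝ) ⧸ L)) : Prop :=
  Submodule.span ℝ ((L : Set (Fin n → ℝ)) ∩ standardLattice n) = L ∧
    Z.IsTropicalCycle ((standardLattice n).map (L.mkQ.restrictScalars ℤ)) ∧
    WeightedComplex.Equivalent (standardLattice n) (tropMatroid M) (Z.preimage L)

variable {V : Type*} [AddCommGroup V] [Module ℝ V] [TopologicalSpace V]

/-- `X` represents a smooth tropical variety: a tropical cycle with positive weights all of whose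
stars are isomorphic to matroid varieties modulo lineality spaces. -/
structure IsSmoothVariety (Λ : Submodule ℤ V) (X : WeightedComplex V) : Prop
    extends X.IsTropicalCycle Λ where
  weight_pos : ∀ σ, X.IsMaxCell σ → X.weight σ ≠ 0 → 0 < X.weight σ
  locally_matroid : ∀ p ∈ X.support,
    ∃ (n : ℕ) (M : Matroid (Fin n)) (L : Submodule ℝ (Fin n → ℝ))
      (Z : WeightedComplex ((Fin n → ℝ) ⧸ L)) (φ : V → (Fin n → ℝ) ⧸ L),
      M.E = Set.univ ∧ M.Loopless ∧ IsTropMatroidModLineality M L Z ∧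
      IsIsomorphism Λ ((standardLattice n).map (L.mkQ.restrictScalars ℤ)) (X.star p) Z φ

end Matroids

open Filter

section Harmonic

variable {E W : Type*} [NormedAddCommGroup E] [NormedSpace ℝ E] [AddCommGroup W] [Module ℝ W]
  {ι : Type*}

/-- Near `x` the set `T` is the union of the half spaces `H + ℝ≥0 y s`, `s ∈ S`; on each of them
`g` agrees with the linear map `l s`, and these linear maps satisfy a balancing condition with
positive weights `ω s`. -/
structure HarmonicData (T : Set E) (g : E → W) (x : E) (H : Submodule ℝ E) (S : Finset ι)
    (y : ι → E) (ω : ι → ℝ) (l : ι → E →ₗ[ℝ] W) (l₀ : E →ₗ[ℝ] W) : Prop where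
  mem : x ∈ H
  pos : ∀ s ∈ S, 0 < ω s
  mem_iff : ∀ᶠ w in 𝓝 x, (w ∈ T ↔ ∃ s ∈ S, ∃ c : ℝ, 0 ≤ c ∧ w - c • y s ∈ H)
  eq : ∀ᶠ w in 𝓝 x, ∀ s ∈ S, ∀ c : ℝ, 0 ≤ c → w - c • y s ∈ H → g w = l s w
  eq_base : ∀ s ∈ S, ∀ h ∈ H, l s h = l₀ h
  sum_mem : ∑ s ∈ S, ω s • y s ∈ H
  sum_eq : ∑ s ∈ S, ω s • l s (y s) = l₀ (∑ s ∈ S, ω s • y s)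

/-- Near `x`, the pair `(T, g)` is a balanced fan with a codimension one lineality space and a
piecewise linear function on it that respects the balancing condition. -/
def IsHarmonicAt (ι : Type*) (T : Set E) (g : E → W) (x : E) : Prop :=
  ∃ (H : Submodule ℝ E) (S : Finset ι) (y : ι → E) (ω : ι → ℝ) (l : ι → E →ₗ[ℝ] W)
    (l₀ : E →ₗ[ℝ] W), HarmonicData T g x H S y ω l l₀

theorem eventually_ray {P : E → Prop} {x : E} (h : ∀ᶠ w in 𝓝 x, P w) (w : E) :
    ∀ᶠ ε : ℝ in 𝓝[>] 0, P (x + ε • w) := by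
  have : Tendsto (fun ε : ℝ => x + ε • w) (𝓝[>] 0) (𝓝 x) := by
    have h1 : ContinuousAt (fun ε : ℝ => x + ε • w) 0 := by fun_prop
    have h2 := h1.tendsto
    simp only [zero_smul, add_zero] at h2
    exact h2.mono_left nhdsWithin_le_nhds
  exact this.eventually h

theorem eq_of_eventually_ray {P Q : E →ₗ[ℝ] W} {g : E → W} {x w : E}
    (hx : P x = Q x) (hP : ∀ᶠ ε : ℝ in 𝓝[>] 0, g (x + ε • w) = P (x + ε • w))
    (hQ : ∀ᶠ ε : ℝ in 𝓝[>] 0, g (x + ε • w) = Q (x + ε • w)) : P w = Q w := by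
  obtain ⟨ε, ⟨h1, h2⟩, hε⟩ := ((hP.and hQ).and self_mem_nhdsWithin).exists
  have hε : 0 < ε := hε
  have h3 := h1.symm.trans h2
  simp only [map_add, map_smul, hx] at h3
  exact smul_right_injective W hε.ne' (add_left_cancel h3)

theorem LinearMap.eq_of_eventuallyEq {P Q : E →ₗ[ℝ] W} {x : E} (h : ∀ᶠ w in 𝓝 x, P w = Q w) :
    P = Q := by
  ext w
  exact eq_of_eventually_ray h.self_of_nhds (Eventually.of_forall fun _ => rfl)
    (eventually_ray h w)

theorem sum_smul_fiberwise {A κ : Type*} [AddCommGroup A] [Module ℝ A] [Fintype κ] [DecidableEq κ]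
    (S : Finset ι) (i : ι → κ) (a : ι → ℝ) (u : κ → A) :
    ∑ s ∈ S, a s • u (i s) = ∑ m, (∑ s ∈ S with i s = m, a s) • u m := by
  rw [← Finset.sum_fiberwise S i]
  refine Finset.sum_congr rfl fun m _ => ?_
  rw [Finset.sum_smul]
  refine Finset.sum_congr rfl fun s hs => ?_
  rw [(Finset.mem_filter.1 hs).2]

namespace HarmonicData

variable {T : Set E} {g : E → W} {x : E} {H : Submodule ℝ E} {S : Finset ι}
    {y : ι → E} {ω : ι → ℝ} {l : ι → E →ₗ[ℝ] W} {l₀ : E →ₗ[ℝ] W}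

theorem piece_ray (hd : HarmonicData T g x H S y ω l l₀) {s : ι} (hs : s ∈ S) {c : ℝ} (hc : 0 ≤ c)
    {w : E} (hw : w - c • y s ∈ H) :
    ∀ᶠ ε : ℝ in 𝓝[>] 0, x + ε • w ∈ T ∧ g (x + ε • w) = l s (x + ε • w) := by
  filter_upwards [eventually_ray hd.mem_iff w, eventually_ray hd.eq w, self_mem_nhdsWithin]
    with ε h1 h2 hε
  have hε : 0 < ε := hε
  have h3 : x + ε • w - (ε * c) • y s ∈ H := by
    have := H.add_mem hd.mem (H.smul_mem ε hw)
    convert this using 1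
    module
  have hc' : 0 ≤ ε * c := by positivity
  exact ⟨h1.2 ⟨s, hs, _, hc', h3⟩, h2 s hs _ hc' h3⟩

theorem exists_piece (hd : HarmonicData T g x H S y ω l l₀) {w : E}
    (hw : ∀ᶠ ε : ℝ in 𝓝[>] 0, x + ε • w ∈ T) :
    ∃ s ∈ S, ∃ c : ℝ, 0 ≤ c ∧ w - c • y s ∈ H := by
  obtain ⟨ε, ⟨h1, h2⟩, hε⟩ :=
    ((hw.and (eventually_ray hd.mem_iff w)).and self_mem_nhdsWithin).exists
  have hε : 0 < ε := hε
  obtain ⟨s, hs, c, hc, h3⟩ := h2.1 h1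
  refine ⟨s, hs, ε⁻¹ * c, by positivity, ?_⟩
  have := H.smul_mem ε⁻¹ (H.sub_mem h3 hd.mem)
  convert this using 1
  rw [show x + ε • w - c • y s - x = ε • w - c • y s by abel, smul_sub, smul_smul, smul_smul,
    inv_mul_cancel₀ hε.ne', one_smul]

theorem eq_self (hd : HarmonicData T g x H S y ω l l₀) {s : ι} (hs : s ∈ S) : g x = l s x := by
  have := hd.eq.self_of_nhds s hs 0 le_rfl (by simpa using hd.mem)
  exact this

theorem eq_of_piece (hd : HarmonicData T g x H S y ω l l₀) {s t : ι} (hs : s ∈ S) (ht : t ∈ S)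
    {c c' : ℝ} (hc : 0 ≤ c) (hc' : 0 ≤ c') {w : E} (hw : w - c • y s ∈ H)
    (hw' : w - c' • y t ∈ H) : l s w = l t w :=
  eq_of_eventually_ray ((hd.eq_self hs).symm.trans (hd.eq_self ht))
    ((hd.piece_ray hs hc hw).mono fun _ h => h.2) ((hd.piece_ray ht hc' hw').mono fun _ h => h.2)

/-- If `T` is a linear space `B` near `x`, then `g` is linear near `x`. -/
theorem exists_linear_of_flat (hd : HarmonicData T g x H S y ω l l₀) {B : Submodule ℝ E}
    (hTB : ∀ᶠ w in 𝓝 x, w ∈ T → w ∈ B)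
    (hBT : ∀ w ∈ B, ∀ᶠ ε : ℝ in 𝓝[>] 0, x + ε • w ∈ T) :
    ∃ k : E →ₗ[ℝ] W, ∀ᶠ w in 𝓝 x, w ∈ T → g w = k w := by
  have hB : ∀ w, (∀ᶠ ε : ℝ in 𝓝[>] 0, x + ε • w ∈ T) → w ∈ B := by
    intro w hw
    have hxB : x ∈ B := by
      have h0 := hBT 0 B.zero_mem
      simp only [smul_zero, add_zero] at h0
      exact hTB.self_of_nhds h0.exists.choose_spec
    obtain ⟨ε, ⟨h1, h2⟩, hε⟩ :=
      ((hw.and (eventually_ray hTB w)).and self_mem_nhdsWithin).exists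
    have h3 := B.smul_mem ε⁻¹ (B.sub_mem (h2 h1) hxB)
    rwa [add_sub_cancel_left, smul_smul, inv_mul_cancel₀ (ne_of_gt hε), one_smul] at h3
  have hyB : ∀ s ∈ S, y s ∈ B := fun s hs => hB _
    ((hd.piece_ray hs zero_le_one (by simp)).mono fun _ h => h.1)
  have hHB : H ≤ B := by
    intro h hh
    obtain ⟨s, hs, -⟩ := hd.exists_piece (hBT 0 B.zero_mem)
    exact hB _ ((hd.piece_ray hs le_rfl (by simpa using hh)).mono fun _ h => h.1)
  obtain ⟨⟨s₀, hs₀⟩, hs₀B⟩ : ∃ s : S, (H ⊔ Submodule.span ℝ {y s.1}).comap B.subtype = ⊤ := by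
    apply Subspace.exists_eq_top_of_iUnion_eq_univ
    refine Set.eq_univ_of_forall fun w => ?_
    obtain ⟨s, hs, c, -, h⟩ := hd.exists_piece (hBT w.1 w.2)
    refine Set.mem_iUnion.2 ⟨⟨s, hs⟩, ?_⟩
    refine Submodule.mem_sup.2 ⟨_, h, c • y s, Submodule.smul_mem _ _
      (Submodule.mem_span_singleton_self _), by simp⟩
  have hdec : ∀ s ∈ S, ∃ b : ℝ, y s - b • y s₀ ∈ H := by
    intro s hs
    have : (⟨y s, hyB s hs⟩ : B) ∈ (H ⊔ Submodule.span ℝ {y s₀}).comap B.subtype := by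
      rw [hs₀B]; trivial
    obtain ⟨h, hh, z, hz, e⟩ := Submodule.mem_sup.1 this
    obtain ⟨b, rfl⟩ := Submodule.mem_span_singleton.1 hz
    refine ⟨b, ?_⟩
    simp only [Submodule.subtype_apply] at e
    rw [← e]; simpa using hh
  choose! b hb using hdec
  have key : ∀ s ∈ S, y s ∉ H → l s (y s) = l s₀ (y s) := by
    by_cases hy0 : y s₀ ∈ H
    · intro s hs h
      exact absurd (by simpa using H.add_mem (hb s hs) (H.smul_mem (b s) hy0)) h
    have hpos : ∀ s ∈ S, 0 ≤ b s → l s (y s) = l s₀ (y s) := fun s hs h =>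
      hd.eq_of_piece hs hs₀ zero_le_one h (by simp) (hb s hs)
    have hsum : ∑ s ∈ S, ω s * b s = 0 := by
      have h1 : (∑ s ∈ S, ω s * b s) • y s₀ ∈ H := by
        have := H.sub_mem hd.sum_mem (H.sum_mem (t := S) (f := fun s => ω s • (y s - b s • y s₀))
          fun s hs => H.smul_mem _ (hb s hs))
        rw [← Finset.sum_sub_distrib] at this
        rw [Finset.sum_smul]
        convert this using 2
        module
      by_contra h
      exact hy0 ((H.smul_mem_iff h).1 h1)
    have hlin : ∀ s ∈ S, l s (y s) = l₀ (y s - b s • y s₀) + b s • l s (y s₀) := by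
      intro s hs
      rw [← hd.eq_base s hs _ (hb s hs)]
      simp
    have hsum2 : ∑ s ∈ S, (ω s * b s) • (l s (y s₀) - l s₀ (y s₀)) = 0 := by
      have h1 := hd.sum_eq
      have h2 : ∑ s ∈ S, ω s • y s = ∑ s ∈ S, ω s • (y s - b s • y s₀) := by
        rw [← sub_eq_zero, ← Finset.sum_sub_distrib]
        have : ∀ s ∈ S, ω s • y s - ω s • (y s - b s • y s₀) = (ω s * b s) • y s₀ := by
          intros; module
        rw [Finset.sum_congr rfl this, ← Finset.sum_smul, hsum, zero_smul]
      rw [h2, map_sum] at h1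
      rw [← sub_eq_zero, ← Finset.sum_sub_distrib] at h1
      simp only [smul_sub, Finset.sum_sub_distrib]
      rw [← Finset.sum_smul, hsum, zero_smul, sub_zero, ← h1]
      refine Finset.sum_congr rfl fun s hs => ?_
      rw [hlin s hs, map_smul]
      module
    intro s hs _
    rcases le_or_gt 0 (b s) with h | h
    · exact hpos s hs h
    have hconst : ∀ t ∈ S, (ω t * b t) • (l t (y s₀) - l s₀ (y s₀)) =
        (if b t < 0 then ω t * b t else 0) • (l s (y s₀) - l s₀ (y s₀)) := by
      intro t ht
      rcases lt_trichotomy (b t) 0 with h' | h' | h'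
      · rw [if_pos h']
        have h1 : l t (-y s₀) = l s (-y s₀) := by
          refine hd.eq_of_piece ht hs (c := -(b t)⁻¹) (c' := -(b s)⁻¹)
            (by simpa using h'.le) (by simpa using h.le) ?_ ?_
          · have := H.smul_mem (b t)⁻¹ (hb t ht)
            rw [smul_sub, smul_smul, inv_mul_cancel₀ h'.ne, one_smul] at this
            convert this using 1
            module
          · have := H.smul_mem (b s)⁻¹ (hb s hs)
            rw [smul_sub, smul_smul, inv_mul_cancel₀ h.ne, one_smul] at this
            convert this using 1
            module
        simp only [map_neg, neg_inj] at h1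
        rw [h1]
      · simp [h']
      · rw [if_neg h'.not_gt, zero_smul]
        have h1 : l t (y s₀) = l s₀ (y s₀) := by
          refine hd.eq_of_piece ht hs₀ (c := (b t)⁻¹) (c' := 1) (by positivity) zero_le_one ?_
            (by simp)
          have := H.smul_mem (b t)⁻¹ (hb t ht)
          rw [smul_sub, smul_smul, inv_mul_cancel₀ h'.ne', one_smul] at this
          convert H.neg_mem this using 1
          module
        rw [h1, sub_self, smul_zero]
    rw [Finset.sum_congr rfl hconst, ← Finset.sum_smul] at hsum2
    have hneg : ∑ t ∈ S, (if b t < 0 then ω t * b t else 0) < 0 := by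
      refine Finset.sum_neg' (fun t ht => ?_) ⟨s, hs, ?_⟩
      · split_ifs with h'
        · exact (mul_neg_of_pos_of_neg (hd.pos t ht) h').le
        · exact le_rfl
      · rw [if_pos h]; exact mul_neg_of_pos_of_neg (hd.pos s hs) h
    have h1 := (smul_eq_zero.1 hsum2).resolve_left hneg.ne
    rw [hlin s hs, sub_eq_zero.1 h1]
    rw [← hd.eq_base s₀ hs₀ _ (hb s hs)]
    simp
  refine ⟨l s₀, ?_⟩
  filter_upwards [hd.mem_iff, hd.eq] with w h1 h2 hwT
  obtain ⟨s, hs, c, hc, h3⟩ := h1.1 hwT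
  rw [h2 s hs c hc h3]
  have e : ∀ t ∈ S, l t w = l₀ (w - c • y s) + c • l t (y s) := by
    intro t ht
    rw [← hd.eq_base t ht _ h3]; simp
  by_cases hys : y s ∈ H
  · rw [e s hs, e s₀ hs₀, hd.eq_base _ hs _ hys, hd.eq_base _ hs₀ _ hys]
  · rw [e s hs, e s₀ hs₀, key s hs hys]

/-- If `T` is near `x` the union of half spaces `Q + ℝ≥0 v i` whose generators satisfy up to
scalars the unique relation `∑ i, v i ∈ Q`, then `g` respects this relation. -/
theorem sum_eq_of_pieces (hd : HarmonicData T g x H S y ω l l₀) {κ : Type*} [Fintype κ]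
    [Nontrivial κ] {Q : Submodule ℝ E} {v : κ → E} {k : κ → E →ₗ[ℝ] W}
    (hTQ : ∀ᶠ w in 𝓝 x, w ∈ T → ∃ i, ∃ c : ℝ, 0 ≤ c ∧ w - c • v i ∈ Q)
    (hQT : ∀ i, ∀ c : ℝ, 0 ≤ c → ∀ w, w - c • v i ∈ Q →
      ∀ᶠ ε : ℝ in 𝓝[>] 0, x + ε • w ∈ T ∧ g (x + ε • w) = k i (x + ε • w))
    (hx : x ∈ Q) (hg : ∀ i, g x = k i x)
    (hsum : ∑ i, v i ∈ Q) (huniq : ∀ a : κ → ℝ, ∑ i, a i • v i ∈ Q → ∀ i j, a i = a j) (j : κ) :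
    ∑ i, k i (v i) = k j (∑ i, v i) := by
  classical
  have hcone : ∀ w, (∀ᶠ ε : ℝ in 𝓝[>] 0, x + ε • w ∈ T) →
      ∃ i, ∃ c : ℝ, 0 ≤ c ∧ w - c • v i ∈ Q := by
    intro w hw
    obtain ⟨ε, ⟨h1, h2⟩, hε⟩ :=
      ((hw.and (eventually_ray hTQ w)).and self_mem_nhdsWithin).exists
    have hε : 0 < ε := hε
    obtain ⟨s, c, hc, h3⟩ := h2 h1
    refine ⟨s, ε⁻¹ * c, by positivity, ?_⟩
    have := Q.smul_mem ε⁻¹ (Q.sub_mem h3 hx)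
    convert this using 1
    rw [show x + ε • w - c • v s - x = ε • w - c • v s by abel, smul_sub, smul_smul, smul_smul,
      inv_mul_cancel₀ hε.ne', one_smul]
  have hkQ : ∀ i, ∀ q ∈ Q, k i q = k j q := fun i q hq =>
    eq_of_eventually_ray ((hg i).symm.trans (hg j))
      ((hQT i 0 le_rfl q (by simpa using hq)).mono fun _ h => h.2)
      ((hQT j 0 le_rfl q (by simpa using hq)).mono fun _ h => h.2)
  have hlk : ∀ s ∈ S, ∀ c : ℝ, 0 ≤ c → ∀ i, ∀ b : ℝ, 0 ≤ b → ∀ w, w - c • y s ∈ H →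
      w - b • v i ∈ Q → l s w = k i w := fun s hs c hc i b hb w h1 h2 =>
    eq_of_eventually_ray ((hd.eq_self hs).symm.trans (hg i))
      ((hd.piece_ray hs hc h1).mono fun _ h => h.2) ((hQT i b hb w h2).mono fun _ h => h.2)
  have hsingle : ∀ i, (fun m => (Pi.single i (1 : ℝ) : κ → ℝ) m • v m) =
      Pi.single i (v i) := by
    intro i; funext m
    by_cases h : m = i
    · subst h; simp
    · simp [h]
  have hsing : ∀ i, ∑ m, (Pi.single i (1 : ℝ) : κ → ℝ) m • v m = v i := by
    intro i; rw [hsingle]; simp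
  by_cases h3 : ∃ i₁ i₂ : κ, i₁ ≠ i₂ ∧ ∀ m, m = i₁ ∨ m = i₂
  · obtain ⟨i₁, i₂, hne, hall⟩ := h3
    have huniv : (Finset.univ : Finset κ) = {i₁, i₂} := by
      ext m; simpa using hall m
    simp only [huniv, Finset.sum_pair hne] at hsum ⊢
    obtain ⟨kk, hk⟩ := hd.exists_linear_of_flat (B := Q ⊔ Submodule.span ℝ {v i₁}) (by
      filter_upwards [hTQ] with w hw hwT
      obtain ⟨i, c, hc, h⟩ := hw hwT
      rcases hall i with rfl | rfl
      · exact Submodule.mem_sup.2 ⟨_, h, c • v i, Submodule.smul_mem _ _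
          (Submodule.mem_span_singleton_self _), by simp⟩
      · refine Submodule.mem_sup.2 ⟨_, Q.add_mem h (Q.smul_mem c hsum), -c • v i₁,
          Submodule.smul_mem _ _ (Submodule.mem_span_singleton_self _), by module⟩) (by
      intro w hw
      obtain ⟨q, hq, z, hz, rfl⟩ := Submodule.mem_sup.1 hw
      obtain ⟨b, rfl⟩ := Submodule.mem_span_singleton.1 hz
      rcases le_total 0 b with hb | hb
      · exact (hQT i₁ b hb _ (by simpa using hq)).mono fun _ h => h.1
      · refine (hQT i₂ (-b) (by linarith) _ ?_).mono fun _ h => h.1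
        convert Q.add_mem hq (Q.smul_mem b hsum) using 1
        module)
    have hxT : x ∈ T := by
      have := hQT i₁ 0 le_rfl 0 (by simp)
      simp only [smul_zero, add_zero] at this
      exact this.exists.choose_spec.1
    have hkk : ∀ i, ∀ c : ℝ, 0 ≤ c → ∀ w, w - c • v i ∈ Q → kk w = k i w := by
      intro i c hc w hw
      refine eq_of_eventually_ray ((hk.self_of_nhds hxT).symm.trans (hg i)) ?_
        ((hQT i c hc w hw).mono fun _ h => h.2)
      filter_upwards [eventually_ray hk w, hQT i c hc w hw] with ε h1 h2
      exact h1 h2.1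
    rw [← hkk i₁ 1 zero_le_one _ (by simp), ← hkk i₂ 1 zero_le_one _ (by simp), ← map_add]
    exact hkk j 0 le_rfl _ (by simpa using hsum)
  have hHQ : H ≤ Q := by
    intro h hh
    obtain ⟨s, hs, -⟩ := hd.exists_piece (w := 0)
      ((hQT j 0 le_rfl 0 (by simp)).mono fun _ h => h.1)
    obtain ⟨i, c, hc, hq⟩ := hcone h
      ((hd.piece_ray hs le_rfl (by simpa using hh)).mono fun _ h => h.1)
    rcases hc.eq_or_lt with rfl | hc
    · simpa using hq
    obtain ⟨i', hi'⟩ := exists_ne i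
    obtain ⟨s', hs', c', hc', hs2⟩ := hd.exists_piece (w := v i')
      ((hQT i' 1 zero_le_one _ (by simp)).mono fun _ h => h.1)
    obtain ⟨m, b, hb, hm⟩ := hcone (v i' + h)
      ((hd.piece_ray hs' hc' (by
        convert H.add_mem hs2 hh using 1; abel)).mono fun _ h => h.1)
    have hrel := huniq (fun r => (Pi.single i' (1 : ℝ) : κ → ℝ) r +
      c * (Pi.single i (1 : ℝ) : κ → ℝ) r - b * (Pi.single m (1 : ℝ) : κ → ℝ) r) (by
        simp only [sub_smul, add_smul, mul_smul, Finset.sum_sub_distrib, Finset.sum_add_distrib,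
          ← Finset.smul_sum, hsing]
        convert Q.sub_mem hm hq using 1
        module)
    push Not at h3
    obtain ⟨r, hr1, hr2⟩ := h3 i' i hi'
    have e1 := hrel r i'
    have e2 := hrel r i
    simp only [Pi.single_apply, hr1, hr2, hi', hi'.symm, if_true, if_false] at e1 e2
    exfalso
    by_cases hm1 : m = i'
    · subst hm1
      simp [hr1, hi'.symm] at e2
      linarith
    · have h1 : i' ≠ m := fun h => hm1 h.symm
      simp only [h1, if_false] at e1
      split_ifs at e1 <;> simp at e1
      linarith
  have hys : ∀ s ∈ S, ∃ i, ∃ c : ℝ, 0 ≤ c ∧ y s - c • v i ∈ Q := fun s hs => hcone _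
    ((hd.piece_ray hs zero_le_one (by simp)).mono fun _ h => h.1)
  choose! i c hc hi using hys
  have hrel : ∑ s ∈ S, (ω s * c s) • v (i s) ∈ Q := by
    have := Q.sub_mem (hHQ hd.sum_mem) (Q.sum_mem (t := S)
      (f := fun s => ω s • (y s - c s • v (i s))) fun s hs => Q.smul_mem _ (hi s hs))
    rw [← Finset.sum_sub_distrib] at this
    convert this using 2
    module
  rw [sum_smul_fiberwise _ _ _ v] at hrel
  have hconst := huniq _ hrel
  set C := ∑ s ∈ S with i s = j, ω s * c s with hC
  have hCm : ∀ m, ∑ s ∈ S with i s = m, ω s * c s = C := fun m => hconst m j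
  have hnn : ∀ s ∈ S, 0 ≤ ω s * c s := fun s hs => mul_nonneg (hd.pos s hs).le (hc s hs)
  have hC0 : C ≠ 0 := by
    intro h0
    have hyQ : ∀ s ∈ S, y s ∈ Q := by
      intro s hs
      have h1 := (Finset.sum_eq_zero_iff_of_nonneg (fun t ht => hnn t (Finset.mem_filter.1 ht).1)).1
        ((hCm (i s)).trans h0) s (Finset.mem_filter.2 ⟨hs, rfl⟩)
      have h2 := (mul_eq_zero.1 h1).resolve_left (hd.pos s hs).ne'
      simpa [h2] using hi s hs
    have hvQ : v j ∈ Q := by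
      obtain ⟨s, hs, b, -, h⟩ := hd.exists_piece (w := v j)
        ((hQT j 1 zero_le_one _ (by simp)).mono fun _ h => h.1)
      have := Q.add_mem (hHQ h) (Q.smul_mem b (hyQ s hs))
      simpa using this
    obtain ⟨j', hj'⟩ := exists_ne j
    have := huniq (Pi.single j (1 : ℝ)) (by rw [hsing]; exact hvQ) j j'
    simp [hj'] at this
  have hS : S.Nonempty := by
    obtain ⟨s, hs, -⟩ := hd.exists_piece (w := 0)
      ((hQT j 0 le_rfl 0 (by simp)).mono fun _ h => h.1)
    exact ⟨s, hs⟩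
  have hl₀ : l₀ (∑ s ∈ S, ω s • y s) = k j (∑ s ∈ S, ω s • y s) := by
    obtain ⟨s, hs⟩ := hS
    rw [← hd.eq_base s hs _ hd.sum_mem]
    exact hlk s hs 0 le_rfl j 0 le_rfl _ (by simpa using hd.sum_mem)
      (by simpa using hHQ hd.sum_mem)
  have hls : ∀ s ∈ S, ω s • l s (y s) =
      ω s • k j (y s) - (ω s * c s) • k j (v (i s)) + (ω s * c s) • k (i s) (v (i s)) := by
    intro s hs
    rw [hlk s hs 1 zero_le_one (i s) (c s) (hc s hs) _ (by simp) (hi s hs)]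
    have := hkQ (i s) _ (hi s hs)
    simp only [map_sub, map_smul] at this
    rw [sub_eq_iff_eq_add.1 this]
    module
  have hfin := hd.sum_eq
  rw [Finset.sum_congr rfl hls, Finset.sum_add_distrib, Finset.sum_sub_distrib, hl₀, map_sum,
    sum_smul_fiberwise _ _ _ fun m => k j (v m),
    sum_smul_fiberwise _ _ _ fun m => k m (v m)] at hfin
  simp only [hCm, map_smul, ← Finset.smul_sum] at hfin
  rw [sub_add, sub_eq_self, sub_eq_zero, ← map_sum] at hfin
  exact (smul_right_injective W hC0 hfin).symm

end HarmonicData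

theorem IsHarmonicAt.comap {E' : Type*} [NormedAddCommGroup E'] [NormedSpace ℝ E'] {D : Set E'}
    {f : E' → W} {Θ : E →L[ℝ] E'} {A : Submodule ℝ E} {T : Set E} {g : E → W} {x : E}
    (h : IsHarmonicAt ι D f (Θ x)) (hx : x ∈ A) (hT : ∀ᶠ w in 𝓝 x, (w ∈ T ↔ w ∈ A ∧ Θ w ∈ D))
    (hg : ∀ᶠ w in 𝓝 x, w ∈ T → g w = f (Θ w))
    (hD : ∀ᶠ v in 𝓝 (Θ x), v ∈ D → ∃ a ∈ A, Θ a = v) : IsHarmonicAt ι T g x := by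
  obtain ⟨H, S, y, ω, l, l₀, hd⟩ := h
  have hy : ∀ s ∈ S, ∃ a ∈ A, Θ a = y s := by
    intro s hs
    obtain ⟨ε, ⟨h1, h2⟩, hε⟩ := (((hd.piece_ray hs zero_le_one (w := y s) (by simp)).and
      (eventually_ray hD (y s))).and self_mem_nhdsWithin).exists
    have hε : 0 < ε := hε
    obtain ⟨a, ha, h3⟩ := h2 h1.1
    refine ⟨ε⁻¹ • (a - x), A.smul_mem _ (A.sub_mem ha hx), ?_⟩
    rw [map_smul, map_sub, h3, add_sub_cancel_left, smul_smul, inv_mul_cancel₀ hε.ne', one_smul]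
  choose! z hzA hz using hy
  have hiff : ∀ s ∈ S, ∀ (c : ℝ) (w : E), w - c • z s ∈ A ⊓ H.comap Θ.toLinearMap ↔
      w ∈ A ∧ Θ w - c • y s ∈ H := by
    intro s hs c w
    rw [Submodule.mem_inf, Submodule.mem_comap, ← hz s hs]
    refine and_congr ?_ (by simp)
    rw [A.sub_mem_iff_left (A.smul_mem c (hzA s hs))]
  have hev := Θ.continuous.tendsto x
  have hsum : Θ (∑ s ∈ S, ω s • z s) = ∑ s ∈ S, ω s • y s := by
    rw [map_sum]
    exact Finset.sum_congr rfl fun s hs => by rw [map_smul, hz s hs]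
  refine ⟨A ⊓ H.comap Θ.toLinearMap, S, z, ω, fun s => l s ∘ₗ Θ.toLinearMap,
    l₀ ∘ₗ Θ.toLinearMap, ⟨hx, hd.mem⟩, hd.pos, ?_, ?_, ?_, ?_, ?_⟩
  · filter_upwards [hT, hev.eventually hd.mem_iff] with w h1 h2
    rw [h1, h2]
    constructor
    · rintro ⟨hA, s, hs, c, hc, h3⟩
      exact ⟨s, hs, c, hc, (hiff s hs c w).2 ⟨hA, h3⟩⟩
    · rintro ⟨s, hs, c, hc, h3⟩
      exact ⟨((hiff s hs c w).1 h3).1, s, hs, c, hc, ((hiff s hs c w).1 h3).2⟩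
  · filter_upwards [hT, hg, hev.eventually hd.mem_iff, hev.eventually hd.eq]
      with w h1 h2 h3 h4 s hs c hc h5
    obtain ⟨hA, h6⟩ := (hiff s hs c w).1 h5
    rw [h2 (h1.2 ⟨hA, h3.2 ⟨s, hs, c, hc, h6⟩⟩), h4 s hs c hc h6]
    rfl
  · intro s hs h hh
    exact hd.eq_base s hs _ hh.2
  · refine ⟨A.sum_mem fun s hs => A.smul_mem _ (hzA s hs), ?_⟩
    change Θ _ ∈ H
    rw [hsum]; exact hd.sum_mem
  · change _ = l₀ (Θ _)
    rw [hsum, ← hd.sum_eq]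
    exact Finset.sum_congr rfl fun s hs => by simp [hz s hs]

end Harmonic

section Generic

variable {Q W : Type*} [NormedAddCommGroup Q] [NormedSpace ℝ Q] [FiniteDimensional ℝ Q]
  [NormedAddCommGroup W] [NormedSpace ℝ W] {ι : Type*}

theorem dense_compl_submodules (ℰ : Finset (Submodule ℝ Q)) (h : ∀ E ∈ ℰ, E ≠ ⊤) :
    Dense {q : Q | ∀ E ∈ ℰ, q ∉ E} := by
  have := FiniteDimensional.complete ℝ Q
  have h1 : Dense (⋂ E ∈ (ℰ : Set (Submodule ℝ Q)), ((E : Set Q)ᶜ)) := by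
    refine dense_biInter_of_isOpen (fun E _ => E.closed_of_finiteDimensional.isOpen_compl)
      ℰ.countable_toSet fun E hE => ?_
    rw [← interior_eq_empty_iff_dense_compl]
    by_contra hne
    exact h E hE (E.eq_top_of_nonempty_interior' (Set.nonempty_iff_ne_empty.2 hne))
  convert h1 using 1
  ext; simp

/-- Germs are constant along a preconnected set if they are locally constant and unique. -/
theorem IsPreconnected.germ_constant {X κ : Type*} [TopologicalSpace X] {Z : Set X}
    (hZ : IsPreconnected Z) (P : κ → X → Prop)
    (h : ∀ x ∈ Z, ∃ k, P k x ∧ ∀ᶠ x' in 𝓝[Z] x, P k x')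
    (huniq : ∀ k k' x, x ∈ Z → P k x → P k' x → k = k') {k : κ} {x y : X} (hx : x ∈ Z)
    (hy : y ∈ Z) (hk : P k x) : P k y := by
  refine (hZ.induction₂ (fun x y => ∀ k, P k x ↔ P k y) ?_ ?_ ?_ hx hy k).1 hk
  · intro x hx
    obtain ⟨k₀, h0, h1⟩ := h x hx
    filter_upwards [h1, self_mem_nhdsWithin] with x' h2 hx' k
    constructor
    · intro h; rwa [huniq k k₀ x hx h h0]
    · intro h; rwa [huniq k k₀ x' hx' h h2]
  · intro x y z _ _ _ h1 h2 k
    rw [h1, h2]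
  · intro x y _ _ h k
    rw [h]

/-- A continuous function on a convex open set that is harmonic off finitely many subspaces of
codimension at least two is linear. -/
theorem exists_linear_of_isHarmonicAt {U : Set Q} (hU : IsOpen U) (hconv : Convex ℝ U)
    (hne : U.Nonempty) {G : Q → W} (hG : ContinuousOn G (closure U)) (ℰ : Finset (Submodule ℝ Q))
    (hℰ : ∀ E ∈ ℰ, ∀ y, E ⊔ Submodule.span ℝ {y} ≠ ⊤)
    (hh : ∀ q ∈ U, (∀ E ∈ ℰ, q ∉ E) → IsHarmonicAt ι Set.univ G q) :
    ∃ m : Q →ₗ[ℝ] W, Set.EqOn G m (closure U) := by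
  have hgerm : ∀ q ∈ U, (∀ E ∈ ℰ, q ∉ E) → ∃ m : Q →ₗ[ℝ] W, ∀ᶠ w in 𝓝 q, G w = m w := by
    intro q hq hE
    obtain ⟨H, S, y, ω, l, l₀, hd⟩ := hh q hq hE
    simpa using hd.exists_linear_of_flat (B := ⊤) (by simp) (by simp)
  have hD := dense_compl_submodules ℰ fun E hE h => hℰ E hE 0 (by simp [h])
  obtain ⟨q₀, hq₀U, hq₀⟩ := hD.inter_open_nonempty U hU hne
  obtain ⟨m, hm⟩ := hgerm q₀ hq₀U hq₀
  have key : ∀ z ∈ U, (∀ E ∈ ℰ, z ∉ E) → G z = m z := by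
    intro z hzU hz
    classical
    have hD' := dense_compl_submodules (ℰ.image fun E => E ⊔ Submodule.span ℝ {z}) (by
      intro E hE
      obtain ⟨E', hE', rfl⟩ := Finset.mem_image.1 hE
      exact hℰ E' hE' z)
    obtain ⟨O, hO, hOo, hqO⟩ := mem_nhds_iff.1 (hm.eventually_nhds.and (hU.mem_nhds hq₀U))
    obtain ⟨q, hqO', hq⟩ := hD'.inter_open_nonempty O hOo ⟨q₀, hqO⟩
    obtain ⟨hqm, hqU⟩ := hO hqO'
    let γ : ℝ → Q := fun t => (1 - t) • q + t • z
    have hγ : Continuous γ := by fun_prop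
    have hγU : ∀ t ∈ Set.Icc (0 : ℝ) 1, γ t ∈ U := fun t ht =>
      hconv hqU hzU (by linarith [ht.2]) ht.1 (by ring)
    have hγE : ∀ t ∈ Set.Icc (0 : ℝ) 1, ∀ E ∈ ℰ, γ t ∉ E := by
      intro t ht E hE h
      rcases eq_or_ne t 1 with rfl | h1
      · exact hz E hE (by simpa [γ] using h)
      · refine hq _ (Finset.mem_image_of_mem _ hE) ?_
        have h2 : 1 - t ≠ 0 := sub_ne_zero.2 h1.symm
        refine ((Submodule.smul_mem_iff _ h2).1 ?_)
        refine Submodule.mem_sup.2 ⟨_, h, -t • z, Submodule.smul_mem _ _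
          (Submodule.mem_span_singleton_self _), ?_⟩
        simp only [γ]; module
    have hfin := (isPreconnected_Icc (a := (0 : ℝ)) (b := 1)).germ_constant
      (fun (k : Q →ₗ[ℝ] W) t => ∀ᶠ w in 𝓝 (γ t), G w = k w) (by
        intro t ht
        obtain ⟨k, hk⟩ := hgerm (γ t) (hγU t ht) (hγE t ht)
        exact ⟨k, hk, nhdsWithin_le_nhds ((hγ.tendsto t).eventually hk.eventually_nhds)⟩) (by
        intro k k' t _ h1 h2
        refine LinearMap.eq_of_eventuallyEq (x := γ t) ?_
        filter_upwards [h1, h2] with w h3 h4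
        rw [← h3, h4]) (k := m) (x := 0) (y := 1) (by simp) (by simp) (by simpa [γ] using hqm)
    have := hfin.self_of_nhds
    simpa [γ] using this
  refine ⟨m, ?_⟩
  have h1 : U ∩ {q : Q | ∀ E ∈ ℰ, q ∉ E} ⊆ closure U :=
    Set.inter_subset_left.trans subset_closure
  refine Set.EqOn.of_subset_closure (fun z hz => key z hz.1 hz.2) hG
    (LinearMap.continuous_of_finiteDimensional m).continuousOn h1 ?_
  exact closure_minimal (hD.open_subset_closure_inter hU) isClosed_closure

end Generic

section Flags

variable {n : ℕ}

theorem flatVector_apply (F : Set (Fin n)) (i : Fin n) [Decidable (i ∈ F)] :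
    flatVector F i = if i ∈ F then -1 else 0 := by
  classical
  simp only [flatVector, Pi.neg_apply, Set.indicator_apply, Pi.one_apply]
  split_ifs <;> simp

theorem flatVector_empty : flatVector (∅ : Set (Fin n)) = 0 := by
  ext; simp [flatVector]

/-- The linear parametrization of the span of the cone of a flag. -/
noncomputable def flagMap (𝓕 : Finset (Set (Fin n))) :
    ((Set (Fin n) → ℝ) × ℝ) →ₗ[ℝ] (Fin n → ℝ) where
  toFun q := ∑ F ∈ 𝓕, q.1 F • flatVector F + q.2 • flatVector Set.univ
  map_add' p q := by
    simp only [Prod.fst_add, Prod.snd_add, Pi.add_apply, add_smul, Finset.sum_add_distrib]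
    abel
  map_smul' a q := by
    simp only [Prod.smul_fst, Prod.smul_snd, Pi.smul_apply, smul_eq_mul, mul_smul,
      RingHom.id_apply, smul_add, Finset.smul_sum]

theorem flagMap_apply (𝓕 : Finset (Set (Fin n))) (q : (Set (Fin n) → ℝ) × ℝ) :
    flagMap 𝓕 q = ∑ F ∈ 𝓕, q.1 F • flatVector F + q.2 • flatVector Set.univ := rfl

theorem mem_flagCone {𝓕 : Finset (Set (Fin n))} {x : Fin n → ℝ} :
    x ∈ flagCone 𝓕 ↔ ∃ q : (Set (Fin n) → ℝ) × ℝ, (∀ F ∈ 𝓕, 0 ≤ q.1 F) ∧ x = flagMap 𝓕 q :=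
  ⟨fun ⟨c, μ, h1, h2⟩ => ⟨(c, μ), h1, h2⟩, fun ⟨q, h1, h2⟩ => ⟨q.1, q.2, h1, h2⟩⟩

theorem flagMap_single {𝓕 : Finset (Set (Fin n))} {F : Set (Fin n)} (hF : F ∈ 𝓕) (a : ℝ) :
    flagMap 𝓕 (Pi.single F a, 0) = a • flatVector F := by
  classical
  rw [flagMap_apply]
  simp only [zero_smul, add_zero]
  rw [Finset.sum_eq_single F]
  · simp
  · intro G _ h; simp [h]
  · intro h; exact absurd hF h

theorem flagMap_mono {𝓕 𝓕' : Finset (Set (Fin n))} (h : 𝓕 ⊆ 𝓕') (q : (Set (Fin n) → ℝ) × ℝ) :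
    ∃ q' : (Set (Fin n) → ℝ) × ℝ, flagMap 𝓕' q' = flagMap 𝓕 q ∧
      (∀ F ∈ 𝓕, q'.1 F = q.1 F) ∧ ∀ F ∉ 𝓕, q'.1 F = 0 := by
  classical
  refine ⟨(fun F => if F ∈ 𝓕 then q.1 F else 0, q.2), ?_, fun F hF => by simp [hF],
    fun F hF => by simp [hF]⟩
  rw [flagMap_apply, flagMap_apply]
  congr 1
  rw [← Finset.sum_subset h]
  · exact Finset.sum_congr rfl fun F hF => by simp [hF]
  · intro F _ hF; simp [hF]

theorem flagCone_mono {𝓕 𝓕' : Finset (Set (Fin n))} (h : 𝓕 ⊆ 𝓕') :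
    flagCone 𝓕 ⊆ flagCone 𝓕' := by
  intro x hx
  obtain ⟨q, hq, rfl⟩ := mem_flagCone.1 hx
  obtain ⟨q', h1, h2, h3⟩ := flagMap_mono h q
  refine mem_flagCone.2 ⟨q', fun F _ => ?_, h1.symm⟩
  by_cases hF' : F ∈ 𝓕
  · rw [h2 F hF']; exact hq F hF'
  · rw [h3 F hF']

theorem flatVector_mem_flagCone {𝓕 : Finset (Set (Fin n))} {F : Set (Fin n)} (hF : F ∈ 𝓕) :
    flatVector F ∈ flagCone 𝓕 := by
  classical
  refine mem_flagCone.2 ⟨(Pi.single F 1, 0), fun G _ => ?_, by rw [flagMap_single hF, one_smul]⟩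
  by_cases h : G = F
  · subst h; simp
  · simp [h]

theorem flagMap_univ (𝓕 : Finset (Set (Fin n))) (a : ℝ) :
    flagMap 𝓕 (0, a) = a • flatVector Set.univ := by
  simp [flagMap_apply]

theorem smul_univ_mem_flagCone (𝓕 : Finset (Set (Fin n))) (a : ℝ) :
    a • flatVector Set.univ ∈ flagCone 𝓕 :=
  mem_flagCone.2 ⟨(0, a), fun _ _ => by simp, (flagMap_univ 𝓕 a).symm⟩

theorem zero_mem_flagCone (𝓕 : Finset (Set (Fin n))) : (0 : Fin n → ℝ) ∈ flagCone 𝓕 := by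
  simpa using smul_univ_mem_flagCone 𝓕 0

theorem flagCone_smul {𝓕 : Finset (Set (Fin n))} {x : Fin n → ℝ} (hx : x ∈ flagCone 𝓕) {a : ℝ}
    (ha : 0 ≤ a) : a • x ∈ flagCone 𝓕 := by
  obtain ⟨q, hq, rfl⟩ := mem_flagCone.1 hx
  exact mem_flagCone.2 ⟨a • q, fun F hF => mul_nonneg ha (hq F hF), (map_smul _ _ _).symm⟩

/-- Coordinates of points of a flag cone increase from inside of a member of the flag to the
outside. -/
theorem flagMap_lt {𝓕 : Finset (Set (Fin n))} (h𝓕 : IsChain (· ⊆ ·) (𝓕 : Set (Set (Fin n))))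
    {q : (Set (Fin n) → ℝ) × ℝ} (hq : ∀ F ∈ 𝓕, 0 ≤ q.1 F) {F : Set (Fin n)} (hF : F ∈ 𝓕)
    (hF0 : 0 < q.1 F) {i j : Fin n} (hi : i ∈ F) (hj : j ∉ F) :
    flagMap 𝓕 q i < flagMap 𝓕 q j := by
  classical
  simp only [flagMap_apply, Pi.add_apply, Finset.sum_apply, Pi.smul_apply, smul_eq_mul,
    flatVector_apply, Set.mem_univ, if_true]
  refine add_lt_add_left (Finset.sum_lt_sum (fun G hG => ?_) ⟨F, hF, ?_⟩) _
  · have := hq G hG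
    by_cases hGF : G = F
    · subst hGF; simp [hi, hj, this]
    rcases h𝓕 hG hF hGF with h | h
    · have : j ∉ G := fun h' => hj (h h')
      simp only [this, if_false, mul_zero]
      split_ifs <;> simp [hq G hG]
    · have : i ∈ G := h hi
      simp only [this, if_true]
      split_ifs <;> simp [hq G hG]
  · simp [hi, hj, hF0]

theorem exists_mem_of_flagMap_lt {𝓕 : Finset (Set (Fin n))}
    {q : (Set (Fin n) → ℝ) × ℝ} (hq : ∀ F ∈ 𝓕, 0 ≤ q.1 F) {i j : Fin n}
    (hij : flagMap 𝓕 q i < flagMap 𝓕 q j) : ∃ F ∈ 𝓕, 0 < q.1 F ∧ i ∈ F ∧ j ∉ F := by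
  classical
  simp only [flagMap_apply, Pi.add_apply, Finset.sum_apply, Pi.smul_apply, smul_eq_mul,
    flatVector_apply, Set.mem_univ, if_true, add_lt_add_iff_right] at hij
  obtain ⟨F, hF, h⟩ := Finset.exists_lt_of_sum_lt hij
  have := hq F hF
  refine ⟨F, hF, ?_⟩
  split_ifs at h with h1 h2 <;> first | (exfalso; linarith) | simp_all

theorem mem_of_forall_flagMap_lt {𝓕 : Finset (Set (Fin n))}
    (h𝓕 : IsChain (· ⊆ ·) (𝓕 : Set (Set (Fin n))))
    {q : (Set (Fin n) → ℝ) × ℝ} (hq : ∀ F ∈ 𝓕, 0 ≤ q.1 F) {F : Set (Fin n)} (hF : F.Nonempty)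
    (hF' : F ≠ Set.univ) (h : ∀ i ∈ F, ∀ j ∉ F, flagMap 𝓕 q i < flagMap 𝓕 q j) : F ∈ 𝓕 := by
  obtain ⟨i, hi, him⟩ := F.toFinite.exists_maximalFor (flagMap 𝓕 q) F hF
  obtain ⟨j, hj, hjm⟩ := Fᶜ.toFinite.exists_minimalFor (flagMap 𝓕 q) Fᶜ (Set.nonempty_compl.2 hF')
  obtain ⟨G, hG, hG0, hiG, hjG⟩ := exists_mem_of_flagMap_lt hq (h i hi j hj)
  have hlt := fun {a b} => flagMap_lt h𝓕 hq hG hG0 (i := a) (j := b)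
  convert hG
  ext a
  constructor
  · intro ha
    by_contra haG
    have h1 := hlt hiG haG
    exact absurd (him ha h1.le) (not_le.2 h1)
  · intro ha
    by_contra haF
    have h1 := hlt ha hjG
    exact absurd (hjm haF h1.le) (not_le.2 h1)

/-- Flag cones that come close to an interior point of the cone of the flag `𝒢` belong to flags
that contain `𝒢`. -/
theorem eventually_subset_of_mem_flagCone {M : Matroid (Fin n)} {𝒢 : Finset (Set (Fin n))}
    (h𝒢 : IsFlagOfFlats M 𝒢) {q : (Set (Fin n) → ℝ) × ℝ} (hq : ∀ F ∈ 𝒢, 0 < q.1 F) :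
    ∀ᶠ y in 𝓝 (flagMap 𝒢 q), ∀ 𝓕, IsFlagOfFlats M 𝓕 → y ∈ flagCone 𝓕 → 𝒢 ⊆ 𝓕 := by
  have h : ∀ᶠ y in 𝓝 (flagMap 𝒢 q), ∀ F ∈ 𝒢, ∀ i : Fin n, ∀ j : Fin n, i ∈ F → j ∉ F → y i < y j := by
    refine (Filter.eventually_all_finset _).2 fun F hF => ?_
    refine eventually_all.2 fun i => eventually_all.2 fun j => ?_
    by_cases hi : i ∈ F
    · by_cases hj : j ∉ F
      · have h1 := flagMap_lt h𝒢.2 (fun F hF => (hq F hF).le) hF (hq F hF) hi hj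
        have h2 : IsOpen {y : Fin n → ℝ | y i < y j} :=
          isOpen_lt (continuous_apply i) (continuous_apply j)
        exact (h2.eventually_mem h1).mono fun y hy _ _ => hy
      · exact Eventually.of_forall fun _ _ h => absurd h hj
    · exact Eventually.of_forall fun _ h => absurd h hi
  filter_upwards [h] with y hy 𝓕 h𝓕 hy𝓕 F hF
  obtain ⟨q', hq', rfl⟩ := mem_flagCone.1 hy𝓕
  exact mem_of_forall_flagMap_lt h𝓕.2 hq' (h𝒢.1 F hF).2.1 (h𝒢.1 F hF).2.2
    fun i hi j hj => hy F hF i j hi hj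

theorem mem_support_tropMatroid {M : Matroid (Fin n)} {x : Fin n → ℝ} :
    x ∈ (tropMatroid M).support ↔ ∃ 𝓕, IsFlagOfFlats M 𝓕 ∧ x ∈ flagCone 𝓕 := by
  classical
  constructor
  · rintro ⟨σ, hσ, -, hx⟩
    obtain ⟨𝓕, h𝓕, rfl⟩ := Finset.mem_image.1 hσ.prop
    exact ⟨𝓕, (Finset.mem_filter.1 h𝓕).2, hx⟩
  · rintro ⟨𝓕, h𝓕, hx⟩
    have h1 : flagCone 𝓕 ∈ (tropMatroid M).cells :=
      Finset.mem_image_of_mem _ (Finset.mem_filter.2 ⟨Finset.mem_univ _, h𝓕⟩)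
    obtain ⟨σ, hσ, hmax⟩ := Finset.exists_le_maximal _ h1
    exact ⟨σ, hmax, one_ne_zero, hσ hx⟩

end Flags

section Intervals

variable {n : ℕ} {M : Matroid (Fin n)}

theorem IsFlagOfFlats.mem_of_maximal {𝓕 : Finset (Set (Fin n))}
    (h𝓕 : Maximal (IsFlagOfFlats M) 𝓕) {C : Set (Fin n)} (hC : M.IsFlat C) (hne : C.Nonempty)
    (hC' : C ≠ Set.univ) (h : ∀ F ∈ 𝓕, F ⊆ C ∨ C ⊆ F) : C ∈ 𝓕 := by
  classical
  have h1 : IsFlagOfFlats M (insert C 𝓕) := by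
    refine ⟨fun F hF => ?_, ?_⟩
    · rcases Finset.mem_insert.1 hF with rfl | hF
      · exact ⟨hC, hne, hC'⟩
      · exact h𝓕.prop.1 F hF
    · rw [Finset.coe_insert]
      exact h𝓕.prop.2.insert fun F hF _ => (h F hF).symm
  exact h𝓕.le_of_ge h1 (Finset.subset_insert _ _) (Finset.mem_insert_self _ _)

theorem IsFlagOfFlats.subset {𝓕 𝓕' : Finset (Set (Fin n))} (h : IsFlagOfFlats M 𝓕)
    (h' : 𝓕' ⊆ 𝓕) : IsFlagOfFlats M 𝓕' :=
  ⟨fun F hF => h.1 F (h' hF), h.2.mono (by exact_mod_cast h')⟩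

theorem IsFlagOfFlats.exists_maximal {𝓕 : Finset (Set (Fin n))} (h : IsFlagOfFlats M 𝓕) :
    ∃ 𝓕', 𝓕 ⊆ 𝓕' ∧ Maximal (IsFlagOfFlats M) 𝓕' :=
  Finite.exists_le_maximal h

theorem IsFlagOfFlats.comparable {𝓕 : Finset (Set (Fin n))} (h : IsFlagOfFlats M 𝓕)
    {F G : Set (Fin n)} (hF : F ∈ 𝓕) (hG : G ∈ 𝓕) : F ⊆ G ∨ G ⊆ F :=
  h.2.total hF hG

theorem Matroid.IsFlat.closure_subset_of_subset {F X : Set (Fin n)} (hF : M.IsFlat F)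
    (h : X ⊆ F) : M.closure X ⊆ F :=
  (M.closure_subset_closure h).trans hF.closure.subset

/-- The flats strictly between `F` and `H` partition `H \ F` if `F` and `H` are the ends of a
chain of two covers of flats. -/
theorem closure_insert_eq_of_covers {F G H K : Set (Fin n)} (hE : M.E = Set.univ)
    (hFG : F ⊂ G)
    (hGH : ∀ e ∈ H \ G, M.closure (insert e G) = H) (hFGc : ∀ e ∈ G \ F, M.closure (insert e F) = G)
    (hK : M.IsFlat K) (hFK : F ⊂ K) (hKH : K ⊂ H) {e : Fin n} (he : e ∈ K \ F) :
    M.closure (insert e F) = K := by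
  have hsub : ∀ X : Set (Fin n), X ⊆ M.E := fun X => by rw [hE]; exact Set.subset_univ X
  have hle : M.closure (insert e F) ⊆ K :=
    hK.closure_subset_of_subset (Set.insert_subset he.1 hFK.subset)
  by_cases heG : e ∈ G
  · rw [hFGc e ⟨heG, he.2⟩] at hle ⊢
    refine hle.antisymm fun f hf => ?_
    by_contra hfG
    refine hKH.not_subset ?_
    rw [← hGH f ⟨hKH.subset hf, hfG⟩]
    exact hK.closure_subset_of_subset (Set.insert_subset hf hle)
  · refine hle.antisymm fun f hf => ?_
    by_contra hf'
    obtain ⟨e', he'G, he'F⟩ := Set.exists_of_ssubset hFG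
    have hH : M.closure (insert e' (insert e F)) = H := by
      rw [← hGH e ⟨hKH.subset he.1, heG⟩, ← hFGc e' ⟨he'G, he'F⟩,
        M.closure_insert_closure_eq_closure_insert, Set.insert_comm]
    have h1 : f ∈ M.closure (insert e' (insert e F)) \ M.closure (insert e F) :=
      ⟨by rw [hH]; exact hKH.subset hf, hf'⟩
    have h2 := (Matroid.closure_exchange h1).1
    have h3 : e' ∈ K := hK.closure_subset_of_subset
      (Set.insert_subset hf (Set.insert_subset he.1 hFK.subset)) h2
    refine hKH.not_subset ?_
    rw [← hH]
    exact hK.closure_subset_of_subset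
      (Set.insert_subset h3 (Set.insert_subset he.1 hFK.subset))

/-- A flag `𝒢` of codimension one with a gap between the flats `F` and `H`, and the set `I` of flats
that fill the gap. -/
structure FlagGap (M : Matroid (Fin n)) (𝒢 : Finset (Set (Fin n))) (F H : Set (Fin n))
    (I : Finset (Set (Fin n))) : Prop where
  flag : IsFlagOfFlats M 𝒢
  isFlat : M.IsFlat F
  separated : ∀ G ∈ 𝒢, G ⊆ F ∨ H ⊆ G
  lower : F = ∅ ∨ F ∈ 𝒢
  upper : H = Set.univ ∨ H ∈ 𝒢
  between : ∀ G ∈ I, M.IsFlat G ∧ F ⊂ G ∧ G ⊂ H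
  flag_insert : ∀ G ∈ I, IsFlagOfFlats M (insert G 𝒢)
  partition : ∀ e ∈ H, e ∉ F → ∃ G ∈ I, e ∈ G
  disjoint : ∀ G ∈ I, ∀ G' ∈ I, ∀ e ∉ F, e ∈ G → e ∈ G' → G = G'
  subset_insert : ∀ 𝓕, IsFlagOfFlats M 𝓕 → 𝒢 ⊆ 𝓕 → ∃ G ∈ I, 𝓕 ⊆ insert G 𝒢
  maximal : ∃ G ∈ I, Maximal (IsFlagOfFlats M) (insert G 𝒢)

theorem exists_flagGap (hE : M.E = Set.univ) (hM : M.Loopless) {H : Set (Fin n)} (hH : M.IsFlat H)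
    (hne : H.Nonempty) (hatom : ∀ e ∈ H, M.closure {e} ≠ H) :
    ∃ 𝒢 F I, FlagGap M 𝒢 F H I := by
  classical
  have hsub : ∀ X : Set (Fin n), X ⊆ M.E := fun X => by rw [hE]; exact Set.subset_univ X
  obtain ⟨𝓕, hH𝓕, h𝓕⟩ : ∃ 𝓕, (H = Set.univ ∨ H ∈ 𝓕) ∧ Maximal (IsFlagOfFlats M) 𝓕 := by
    by_cases hu : H = Set.univ
    · obtain ⟨𝓕, -, h⟩ := IsFlagOfFlats.exists_maximal (M := M) (𝓕 := ∅) ⟨by simp, by simp⟩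
      exact ⟨𝓕, Or.inl hu, h⟩
    · obtain ⟨𝓕, h1, h⟩ := IsFlagOfFlats.exists_maximal (M := M) (𝓕 := {H})
        ⟨by simp [hH, hne, hu], by simp⟩
      exact ⟨𝓕, Or.inr (h1 (Finset.mem_singleton_self H)), h⟩
  have hcompH : ∀ F ∈ 𝓕, F ⊂ H ∨ H ⊆ F := by
    intro F hF
    rcases hH𝓕 with rfl | hH'
    · exact Or.inl (Set.ssubset_univ_iff.2 (h𝓕.prop.1 F hF).2.2)
    · rcases h𝓕.prop.comparable hF hH' with h | h
      · by_cases h' : H ⊆ F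
        · exact Or.inr h'
        · exact Or.inl ⟨h, h'⟩
      · exact Or.inr h
  obtain ⟨G, ⟨hG, hGH⟩, hGmax⟩ : ∃ G, (G ∈ 𝓕 ∧ G ⊂ H) ∧ ∀ F ∈ 𝓕, F ⊂ H → F ⊆ G := by
    have hex : {F | F ∈ 𝓕 ∧ F ⊂ H}.Nonempty := by
      by_contra hemp
      have hno : ∀ F ∈ 𝓕, ¬ F ⊂ H := fun F hF h => hemp ⟨F, hF, h⟩
      obtain ⟨e, he⟩ := hne
      have hsubH : M.closure {e} ⊂ H :=
        (hH.closure_subset_of_subset (Set.singleton_subset_iff.2 he)).ssubset_of_ne (hatom e he)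
      refine hno _ (IsFlagOfFlats.mem_of_maximal h𝓕 (M.isFlat_closure _)
        ⟨e, M.mem_closure_of_mem (Set.mem_singleton e) (hsub _)⟩ ?_ fun F hF => Or.inr ?_) hsubH
      · intro h; rw [h] at hsubH; exact hsubH.not_subset (Set.subset_univ _)
      · exact hsubH.subset.trans ((hcompH F hF).resolve_left (hno F hF))
    obtain ⟨G, hG, hm⟩ := (Set.toFinite {F | F ∈ 𝓕 ∧ F ⊂ H}).exists_maximal hex
    refine ⟨G, hG, fun F hF hFH => ?_⟩
    rcases h𝓕.prop.comparable hF hG.1 with h | h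
    · exact h
    · exact hm ⟨hF, hFH⟩ h
  obtain ⟨F, hFf, hFG, hF𝓕, hFmax⟩ : ∃ F, M.IsFlat F ∧ F ⊂ G ∧ (F = ∅ ∨ F ∈ 𝓕) ∧
      ∀ F' ∈ 𝓕, F' ⊂ G → F' ⊆ F := by
    by_cases hex : {F | F ∈ 𝓕 ∧ F ⊂ G}.Nonempty
    · obtain ⟨F, hF, hm⟩ := (Set.toFinite {F | F ∈ 𝓕 ∧ F ⊂ G}).exists_maximal hex
      refine ⟨F, (h𝓕.prop.1 F hF.1).1, hF.2, Or.inr hF.1, fun F' hF' hFG => ?_⟩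
      rcases h𝓕.prop.comparable hF' hF.1 with h | h
      · exact h
      · exact hm ⟨hF', hFG⟩ h
    · refine ⟨∅, ?_, Set.empty_ssubset.2 (h𝓕.prop.1 G hG).2.1, Or.inl rfl,
        fun F' hF' h => absurd ⟨F', hF', h⟩ hex⟩
      rw [Matroid.isFlat_iff_closure_eq]
      exact M.closure_empty.trans ((Matroid.loopless_iff M).1 hM)
  have hGf := (h𝓕.prop.1 G hG).1
  have hcompG : ∀ F' ∈ 𝓕, F' ⊆ F ∨ F' = G ∨ H ⊆ F' := by
    intro F' hF'
    rcases hcompH F' hF' with h | h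
    · rcases (hGmax F' hF' h).eq_or_ssubset with h1 | h1
      · exact Or.inr (Or.inl h1)
      · exact Or.inl (hFmax F' hF' h1)
    · exact Or.inr (Or.inr h)
  have hnu : ∀ {C : Set (Fin n)}, C ⊂ H → C ≠ Set.univ := by
    rintro C h rfl
    exact h.not_subset (Set.subset_univ _)
  have hFGc : ∀ e ∈ G \ F, M.closure (insert e F) = G := by
    intro e he
    by_contra hne'
    have hCG : M.closure (insert e F) ⊂ G :=
      (hGf.closure_subset_of_subset (Set.insert_subset he.1 hFG.subset)).ssubset_of_ne hne'
    have hins := M.subset_closure (insert e F) (hsub _)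
    have hmem := IsFlagOfFlats.mem_of_maximal h𝓕 (M.isFlat_closure (insert e F))
      ⟨e, hins (Set.mem_insert _ _)⟩ (hnu (hCG.trans hGH)) fun F' hF' => by
        rcases hcompG F' hF' with h | rfl | h
        · exact Or.inl (h.trans ((Set.subset_insert _ _).trans hins))
        · exact Or.inr hCG.subset
        · exact Or.inr ((hCG.trans hGH).subset.trans h)
    exact he.2 (hFmax _ hmem hCG (hins (Set.mem_insert _ _)))
  have hGHc : ∀ e ∈ H \ G, M.closure (insert e G) = H := by
    intro e he
    by_contra hne'
    have hCH : M.closure (insert e G) ⊂ H :=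
      (hH.closure_subset_of_subset (Set.insert_subset he.1 hGH.subset)).ssubset_of_ne hne'
    have hins := M.subset_closure (insert e G) (hsub _)
    have hmem := IsFlagOfFlats.mem_of_maximal h𝓕 (M.isFlat_closure (insert e G))
      ⟨e, hins (Set.mem_insert _ _)⟩ (hnu hCH) fun F' hF' => by
        rcases hcompH F' hF' with h | h
        · exact Or.inl ((hGmax F' hF' h).trans ((Set.subset_insert _ _).trans hins))
        · exact Or.inr (hCH.subset.trans h)
    exact he.2 (hGmax _ hmem hCH (hins (Set.mem_insert _ _)))
  have hcl : ∀ {K : Set (Fin n)}, M.IsFlat K → F ⊂ K → K ⊂ H → ∀ e ∈ K, e ∉ F →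
      M.closure (insert e F) = K := fun hK h1 h2 e he he' =>
    closure_insert_eq_of_covers hE hFG hGHc hFGc hK h1 h2 ⟨he, he'⟩
  have hsep : ∀ F' ∈ 𝓕.erase G, F' ⊆ F ∨ H ⊆ F' := by
    intro F' hF'
    rcases hcompG F' (Finset.mem_of_mem_erase hF') with h | h | h
    · exact Or.inl h
    · exact absurd h (Finset.ne_of_mem_erase hF')
    · exact Or.inr h
  have h𝒢 := h𝓕.prop.subset (Finset.erase_subset G 𝓕)
  have hlow : F = ∅ ∨ F ∈ 𝓕.erase G := hF𝓕.imp id fun h => Finset.mem_erase.2 ⟨hFG.ne, h⟩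
  have hup : H = Set.univ ∨ H ∈ 𝓕.erase G := hH𝓕.imp id fun h => Finset.mem_erase.2 ⟨hGH.ne', h⟩
  refine ⟨𝓕.erase G, F, Finset.univ.filter fun K => M.IsFlat K ∧ F ⊂ K ∧ K ⊂ H,
    h𝒢, hFf, hsep, hlow, hup, fun K hK => (Finset.mem_filter.1 hK).2, ?_, ?_, ?_, ?_, ?_⟩
  · intro K hK
    obtain ⟨hKf, hFK, hKH⟩ := (Finset.mem_filter.1 hK).2
    refine ⟨fun F' hF' => ?_, ?_⟩
    · rcases Finset.mem_insert.1 hF' with rfl | hF'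
      · exact ⟨hKf, Set.nonempty_of_ssubset' hFK, hnu hKH⟩
      · exact h𝒢.1 F' hF'
    · rw [Finset.coe_insert]
      refine h𝒢.2.insert fun F' hF' _ => ?_
      rcases hsep F' hF' with h | h
      · exact Or.inr (h.trans hFK.subset)
      · exact Or.inl (hKH.subset.trans h)
  · intro e heH heF
    have hins := M.subset_closure (insert e F) (hsub _)
    refine ⟨M.closure (insert e F), Finset.mem_filter.2 ⟨Finset.mem_univ _, M.isFlat_closure _,
      ?_, ?_⟩, hins (Set.mem_insert _ _)⟩
    · exact ⟨(Set.subset_insert _ _).trans hins, fun h => heF (h (hins (Set.mem_insert _ _)))⟩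
    · refine (hH.closure_subset_of_subset (Set.insert_subset heH
        (hFG.trans hGH).subset)).ssubset_of_ne fun h => ?_
      obtain ⟨e', he', he'F⟩ := Set.exists_of_ssubset hFG
      have h1 : e' ∈ M.closure (insert e F) \ M.closure F :=
        ⟨by rw [h]; exact hGH.subset he', by rw [hFf.closure]; exact he'F⟩
      have h2 := (Matroid.closure_exchange h1).1
      rw [hFGc e' ⟨he', he'F⟩] at h2
      refine hGH.not_subset ?_
      rw [← h]
      exact hGf.closure_subset_of_subset (Set.insert_subset h2 hFG.subset)
  · intro K hK K' hK' e he heK heK'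
    obtain ⟨h1, h2, h3⟩ := (Finset.mem_filter.1 hK).2
    obtain ⟨h1', h2', h3'⟩ := (Finset.mem_filter.1 hK').2
    rw [← hcl h1 h2 h3 e heK he, hcl h1' h2' h3' e heK' he]
  · intro 𝓕' h𝓕' hsub'
    have hnew : ∀ X ∈ 𝓕', X ∉ 𝓕.erase G → F ⊂ X ∧ X ⊂ H := by
      intro X hX hX𝒢
      have hcomp : ∀ F' ∈ 𝓕.erase G, F' ⊆ X ∨ X ⊆ F' := fun F' hF' =>
        h𝓕'.comparable (hsub' hF') hX
      have hXF : ¬ X ⊆ F := by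
        intro h
        have hX𝓕 := IsFlagOfFlats.mem_of_maximal h𝓕 (h𝓕'.1 X hX).1 (h𝓕'.1 X hX).2.1
          (h𝓕'.1 X hX).2.2 fun F' hF' => by
            by_cases hF'G : F' = G
            · subst hF'G; exact Or.inr (h.trans hFG.subset)
            · exact hcomp F' (Finset.mem_erase.2 ⟨hF'G, hF'⟩)
        refine hX𝒢 (Finset.mem_erase.2 ⟨?_, hX𝓕⟩)
        rintro rfl
        exact hFG.not_subset h
      have hHX : ¬ H ⊆ X := by
        intro h
        have hX𝓕 := IsFlagOfFlats.mem_of_maximal h𝓕 (h𝓕'.1 X hX).1 (h𝓕'.1 X hX).2.1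
          (h𝓕'.1 X hX).2.2 fun F' hF' => by
            by_cases hF'G : F' = G
            · subst hF'G; exact Or.inl (hGH.subset.trans h)
            · exact hcomp F' (Finset.mem_erase.2 ⟨hF'G, hF'⟩)
        refine hX𝒢 (Finset.mem_erase.2 ⟨?_, hX𝓕⟩)
        rintro rfl
        exact hGH.not_subset h
      refine ⟨⟨?_, hXF⟩, ⟨?_, hHX⟩⟩
      · rcases hlow with h | h
        · rw [h]; exact Set.empty_subset _
        · exact (hcomp F h).resolve_right hXF
      · rcases hup with h | h
        · rw [h]; exact Set.subset_univ _
        · exact (hcomp H h).resolve_left hHX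
    by_cases hex : ∃ X ∈ 𝓕', X ∉ 𝓕.erase G
    · obtain ⟨X, hX, hX𝒢⟩ := hex
      obtain ⟨h1, h2⟩ := hnew X hX hX𝒢
      refine ⟨X, Finset.mem_filter.2 ⟨Finset.mem_univ _, (h𝓕'.1 X hX).1, h1, h2⟩, fun Y hY => ?_⟩
      by_cases hY𝒢 : Y ∈ 𝓕.erase G
      · exact Finset.mem_insert_of_mem hY𝒢
      obtain ⟨h1', h2'⟩ := hnew Y hY hY𝒢
      have : Y = X := by
        rcases h𝓕'.comparable hX hY with h | h
        · obtain ⟨e, he, heF⟩ := Set.exists_of_ssubset h1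
          rw [← hcl (h𝓕'.1 X hX).1 h1 h2 e he heF, hcl (h𝓕'.1 Y hY).1 h1' h2' e (h he) heF]
        · obtain ⟨e, he, heF⟩ := Set.exists_of_ssubset h1'
          rw [← hcl (h𝓕'.1 X hX).1 h1 h2 e (h he) heF, hcl (h𝓕'.1 Y hY).1 h1' h2' e he heF]
      rw [this]; exact Finset.mem_insert_self _ _
    · push Not at hex
      exact ⟨G, Finset.mem_filter.2 ⟨Finset.mem_univ _, hGf, hFG, hGH⟩,
        fun X hX => Finset.mem_insert_of_mem (hex X hX)⟩
  · refine ⟨G, Finset.mem_filter.2 ⟨Finset.mem_univ _, hGf, hFG, hGH⟩, ?_⟩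
    rw [Finset.insert_erase hG]
    exact h𝓕

end Intervals

section MatroidHarmonic

theorem LinearMap.exists_comp_eq {K A B C : Type*} [Field K] [AddCommGroup A] [Module K A]
    [AddCommGroup B] [Module K B] [AddCommGroup C] [Module K C] (ρ : A →ₗ[K] B) (m : A →ₗ[K] C)
    (h : ρ.ker ≤ m.ker) : ∃ k : B →ₗ[K] C, ∀ a, k (ρ a) = m a := by
  obtain ⟨k, hk⟩ := LinearMap.exists_extend
    (ρ.ker.liftQ m h ∘ₗ (ρ.quotKerEquivRange.symm : ρ.range →ₗ[K] A ⧸ ρ.ker))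
  refine ⟨k, fun a => ?_⟩
  have h1 := LinearMap.congr_fun hk (ρ.rangeRestrict a)
  have h2 : ρ.quotKerEquivRange.symm (ρ.rangeRestrict a) = ρ.ker.mkQ a := by
    rw [LinearEquiv.symm_apply_eq]
    ext; rfl
  simpa [h2] using h1

variable {n : ℕ} {M : Matroid (Fin n)}

theorem isOpen_flagInterior (𝓕 : Finset (Set (Fin n))) :
    IsOpen {q : (Set (Fin n) → ℝ) × ℝ | ∀ F ∈ 𝓕, 0 < q.1 F} := by
  have : {q : (Set (Fin n) → ℝ) × ℝ | ∀ F ∈ 𝓕, 0 < q.1 F} = ⋂ F ∈ 𝓕, {q | 0 < q.1 F} := by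
    ext; simp
  rw [this]
  exact isOpen_biInter_finset fun F _ => isOpen_lt continuous_const (by fun_prop)

theorem mem_closure_flagInterior {𝓕 : Finset (Set (Fin n))} {q : (Set (Fin n) → ℝ) × ℝ} :
    q ∈ closure {q : (Set (Fin n) → ℝ) × ℝ | ∀ F ∈ 𝓕, 0 < q.1 F} ↔ ∀ F ∈ 𝓕, 0 ≤ q.1 F := by
  constructor
  · intro h
    have hc : IsClosed {q : (Set (Fin n) → ℝ) × ℝ | ∀ F ∈ 𝓕, 0 ≤ q.1 F} := by
      have : {q : (Set (Fin n) → ℝ) × ℝ | ∀ F ∈ 𝓕, 0 ≤ q.1 F} = ⋂ F ∈ 𝓕, {q | 0 ≤ q.1 F} := by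
        ext; simp
      rw [this]
      exact isClosed_biInter fun F _ => isClosed_le continuous_const (by fun_prop)
    exact closure_minimal (fun q hq F hF => (hq F hF).le) hc h
  · intro h
    have h1 : Tendsto (fun ε : ℝ => q + ε • ((1, 0) : (Set (Fin n) → ℝ) × ℝ)) (𝓝[>] 0) (𝓝 q) := by
      have h1 : ContinuousAt (fun ε : ℝ => q + ε • ((1, 0) : (Set (Fin n) → ℝ) × ℝ)) 0 := by
        fun_prop
      have h2 := h1.tendsto
      simp only [zero_smul, add_zero] at h2
      exact h2.mono_left nhdsWithin_le_nhds
    refine mem_closure_of_tendsto h1 ?_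
    filter_upwards [self_mem_nhdsWithin] with ε hε F hF
    have hε : 0 < ε := hε
    have := h F hF
    simp only [Prod.fst_add, Prod.smul_fst, Pi.add_apply, Pi.smul_apply, Pi.one_apply, smul_eq_mul]
    linarith

theorem convex_flagInterior (𝓕 : Finset (Set (Fin n))) :
    Convex ℝ {q : (Set (Fin n) → ℝ) × ℝ | ∀ F ∈ 𝓕, 0 < q.1 F} := by
  intro p hp q hq a b ha hb hab F hF
  simp only [Prod.fst_add, Prod.smul_fst, Pi.add_apply, Pi.smul_apply, smul_eq_mul]
  have h1 := hp F hF
  have h2 := hq F hF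
  rcases ha.eq_or_lt with rfl | ha
  · have : b = 1 := by linarith
    subst this; linarith
  · have := mul_pos ha h1
    have := mul_nonneg hb h2.le
    linarith

theorem flagMap_mem_flagCone {𝓕 : Finset (Set (Fin n))} {q : (Set (Fin n) → ℝ) × ℝ}
    (hq : ∀ F ∈ 𝓕, 0 ≤ q.1 F) : flagMap 𝓕 q ∈ flagCone 𝓕 :=
  mem_flagCone.2 ⟨q, hq, rfl⟩

theorem flagMap_insert [DecidableEq (Set (Fin n))] {𝓕 : Finset (Set (Fin n))} {G : Set (Fin n)}
    (hG : G ∉ 𝓕) (q : (Set (Fin n) → ℝ) × ℝ) :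
    flagMap (insert G 𝓕) q = q.1 G • flatVector G + flagMap 𝓕 q := by
  rw [flagMap_apply, flagMap_apply, Finset.sum_insert hG, add_assoc]

theorem flagMap_add_mem_flagCone [DecidableEq (Set (Fin n))] {𝓕 : Finset (Set (Fin n))}
    {G : Set (Fin n)} (hG : G ∉ 𝓕) {q : (Set (Fin n) → ℝ) × ℝ} (hq : ∀ F ∈ 𝓕, 0 ≤ q.1 F) {c : ℝ}
    (hc : 0 ≤ c) : flagMap 𝓕 q + c • flatVector G ∈ flagCone (insert G 𝓕) := by
  have key : flagMap 𝓕 (fun F => if F = G then c else q.1 F, q.2) = flagMap 𝓕 q := by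
    rw [flagMap_apply, flagMap_apply]
    congr 1
    refine Finset.sum_congr rfl fun F hF => ?_
    have : F ≠ G := fun h => hG (h ▸ hF)
    simp [this]
  refine mem_flagCone.2 ⟨(fun F => if F = G then c else q.1 F, q.2), fun F hF => ?_, ?_⟩
  · rcases Finset.mem_insert.1 hF with rfl | hF
    · simpa using hc
    · by_cases h : F = G
      · simpa [h] using hc
      · simpa [h] using hq F hF
  · rw [flagMap_insert hG, key]
    simp [add_comm]

namespace FlagGap

variable {𝒢 : Finset (Set (Fin n))} {F H : Set (Fin n)} {I : Finset (Set (Fin n))}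

theorem notMem (hgap : FlagGap M 𝒢 F H I) {G : Set (Fin n)} (hG : G ∈ I) : G ∉ 𝒢 := by
  intro h
  obtain ⟨-, h1, h2⟩ := hgap.between G hG
  rcases hgap.separated G h with h' | h'
  · exact h1.not_subset h'
  · exact h2.not_subset h'

theorem sum_flatVector (hgap : FlagGap M 𝒢 F H I) :
    ∑ G : I, (flatVector G.1 - flatVector F) = flatVector H - flatVector F := by
  classical
  rw [Finset.univ_eq_attach, Finset.sum_attach I fun G => flatVector G - flatVector F]
  ext i
  simp only [Finset.sum_apply, Pi.sub_apply, flatVector_apply]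
  by_cases hiF : i ∈ F
  · have hiH : i ∈ H := by
      obtain ⟨G, hG, -⟩ := hgap.maximal
      obtain ⟨-, h1, h2⟩ := hgap.between G hG
      exact (h1.trans h2).subset hiF
    rw [Finset.sum_eq_zero]
    · simp [hiF, hiH]
    · intro G hG
      simp [hiF, (hgap.between G hG).2.1.subset hiF]
  by_cases hiH : i ∈ H
  · obtain ⟨G, hG, hiG⟩ := hgap.partition i hiH hiF
    rw [Finset.sum_eq_single G]
    · simp [hiF, hiH, hiG]
    · intro G' hG' hne
      have : i ∉ G' := fun h => hne (hgap.disjoint G' hG' G hG i hiF h hiG)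
      simp [hiF, this]
    · intro h; exact absurd hG h
  · rw [Finset.sum_eq_zero]
    · simp [hiF, hiH]
    · intro G hG
      have : i ∉ G := fun h => hiH ((hgap.between G hG).2.2.subset h)
      simp [hiF, this]

theorem flagMap_apply_eq (hgap : FlagGap M 𝒢 F H I) (q : (Set (Fin n) → ℝ) × ℝ) {i j : Fin n}
    (hi : i ∈ H) (hiF : i ∉ F) (hj : j ∈ H) (hjF : j ∉ F) : flagMap 𝒢 q i = flagMap 𝒢 q j := by
  classical
  simp only [flagMap_apply, Pi.add_apply, Finset.sum_apply, Pi.smul_apply, smul_eq_mul,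
    flatVector_apply, Set.mem_univ, if_true, add_left_inj]
  refine Finset.sum_congr rfl fun G hG => ?_
  rcases hgap.separated G hG with h | h
  · have h1 : i ∉ G := fun h' => hiF (h h')
    have h2 : j ∉ G := fun h' => hjF (h h')
    simp [h1, h2]
  · simp [h hi, h hj]

theorem eq_of_sum_mem (hgap : FlagGap M 𝒢 F H I) (a : I → ℝ)
    (ha : ∑ G : I, a G • (flatVector G.1 - flatVector F) ∈ (flagMap 𝒢).range) (G G' : I) :
    a G = a G' := by
  classical
  obtain ⟨q, hq⟩ := ha
  have hval : ∀ G : I, ∃ i ∈ H, i ∉ F ∧ flagMap 𝒢 q i = - a G := by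
    intro G
    obtain ⟨-, h1, h2⟩ := hgap.between G G.2
    obtain ⟨i, hiG, hiF⟩ := Set.exists_of_ssubset h1
    refine ⟨i, h2.subset hiG, hiF, ?_⟩
    rw [hq]
    simp only [Finset.sum_apply, Pi.smul_apply, Pi.sub_apply, flatVector_apply, smul_eq_mul]
    rw [Finset.sum_eq_single G]
    · simp [hiG, hiF]
    · intro G' _ hne
      have : i ∉ G'.1 := fun h => hne (Subtype.ext (hgap.disjoint G' G'.2 G G.2 i hiF h hiG))
      simp [hiF, this]
    · intro h; exact absurd (Finset.mem_univ _) h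
  obtain ⟨i, hi, hiF, h1⟩ := hval G
  obtain ⟨j, hj, hjF, h2⟩ := hval G'
  have := hgap.flagMap_apply_eq q hi hiF hj hjF
  linarith

theorem nontrivial (hgap : FlagGap M 𝒢 F H I) : Nontrivial I := by
  obtain ⟨G, hG, -⟩ := hgap.maximal
  obtain ⟨-, h1, h2⟩ := hgap.between G hG
  obtain ⟨e, heH, heG⟩ := Set.exists_of_ssubset h2
  obtain ⟨G', hG', he⟩ := hgap.partition e heH fun h => heG (h1.subset h)
  refine ⟨⟨G, hG⟩, ⟨G', hG'⟩, fun h => heG ?_⟩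
  rw [show G = G' from congrArg Subtype.val h]; exact he

theorem lower_mem_range (hgap : FlagGap M 𝒢 F H I) : flatVector F ∈ (flagMap 𝒢).range := by
  classical
  rcases hgap.lower with rfl | h
  · rw [flatVector_empty]; exact Submodule.zero_mem _
  · exact ⟨_, by rw [flagMap_single h 1, one_smul]⟩

theorem upper_mem_range (hgap : FlagGap M 𝒢 F H I) : flatVector H ∈ (flagMap 𝒢).range := by
  classical
  rcases hgap.upper with rfl | h
  · exact ⟨(0, 1), by rw [flagMap_univ, one_smul]⟩
  · exact ⟨_, by rw [flagMap_single h 1, one_smul]⟩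

theorem lower_mem_flagCone (hgap : FlagGap M 𝒢 F H I) : flatVector F ∈ flagCone 𝒢 := by
  rcases hgap.lower with rfl | h
  · rw [flatVector_empty]; exact zero_mem_flagCone _
  · exact flatVector_mem_flagCone h

theorem upper_mem_flagCone (hgap : FlagGap M 𝒢 F H I) : flatVector H ∈ flagCone 𝒢 := by
  rcases hgap.upper with rfl | h
  · simpa using smul_univ_mem_flagCone 𝒢 1
  · exact flatVector_mem_flagCone h

end FlagGap

variable {W : Type*} [NormedAddCommGroup W] [NormedSpace ℝ W] {ι : Type*}
  {g : (Fin n → ℝ) → W} {ℰ : Finset (Submodule ℝ (Fin n → ℝ))}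

theorem eventually_mem_range_of_maximal {𝓕 : Finset (Set (Fin n))}
    (h𝓕 : Maximal (IsFlagOfFlats M) 𝓕) {q : (Set (Fin n) → ℝ) × ℝ} (hq : ∀ F ∈ 𝓕, 0 < q.1 F) :
    ∀ᶠ y in 𝓝 (flagMap 𝓕 q), y ∈ (tropMatroid M).support → y ∈ (flagMap 𝓕).range := by
  filter_upwards [eventually_subset_of_mem_flagCone h𝓕.prop hq] with y hy hyT
  obtain ⟨𝓕', h𝓕', hy'⟩ := mem_support_tropMatroid.1 hyT
  have : 𝓕' = 𝓕 := (h𝓕.eq_of_le h𝓕' (hy 𝓕' h𝓕' hy')).symm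
  subst this
  obtain ⟨q', -, rfl⟩ := mem_flagCone.1 hy'
  exact ⟨q', rfl⟩

theorem not_range_le_of_maximal
    (hℰ : ∀ E ∈ ℰ, ∀ x ∈ (tropMatroid M).support, ∀ y,
      ¬ ∀ᶠ w in 𝓝 x, w ∈ (tropMatroid M).support → w ∈ E ⊔ Submodule.span ℝ {y})
    {𝓕 : Finset (Set (Fin n))} (h𝓕 : Maximal (IsFlagOfFlats M) 𝓕)
    {E : Submodule ℝ (Fin n → ℝ)} (hE : E ∈ ℰ) (y : Fin n → ℝ) :
    ¬ (flagMap 𝓕).range ≤ E ⊔ Submodule.span ℝ {y} := by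
  intro h
  have hq : ∀ F ∈ 𝓕, (0 : ℝ) < ((1, 0) : (Set (Fin n) → ℝ) × ℝ).1 F := by simp
  refine hℰ E hE (flagMap 𝓕 (1, 0)) (mem_support_tropMatroid.2 ⟨𝓕, h𝓕.prop,
    flagMap_mem_flagCone fun F hF => (hq F hF).le⟩) y ?_
  exact (eventually_mem_range_of_maximal h𝓕 hq).mono fun w hw hwT => h (hw hwT)

/-- A harmonic function on the support of a matroid variety is linear on the cones of flags. -/
theorem exists_linear_on_flagCone (hg : ContinuousOn g (tropMatroid M).support)
    (hℰ : ∀ E ∈ ℰ, ∀ x ∈ (tropMatroid M).support, ∀ y,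
      ¬ ∀ᶠ w in 𝓝 x, w ∈ (tropMatroid M).support → w ∈ E ⊔ Submodule.span ℝ {y})
    (hh : ∀ x ∈ (tropMatroid M).support, (∀ E ∈ ℰ, x ∉ E) →
      IsHarmonicAt ι (tropMatroid M).support g x)
    {𝓕 : Finset (Set (Fin n))} (h𝓕 : IsFlagOfFlats M 𝓕) :
    ∃ k : (Fin n → ℝ) →ₗ[ℝ] W, ∀ x ∈ flagCone 𝓕, g x = k x := by
  classical
  suffices h : ∀ 𝓕, Maximal (IsFlagOfFlats M) 𝓕 →
      ∃ k : (Fin n → ℝ) →ₗ[ℝ] W, ∀ x ∈ flagCone 𝓕, g x = k x by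
    obtain ⟨𝓕', hsub, hmax⟩ := h𝓕.exists_maximal
    obtain ⟨k, hk⟩ := h 𝓕' hmax
    exact ⟨k, fun x hx => hk x (flagCone_mono hsub hx)⟩
  intro 𝓕 h𝓕
  have hmemT : ∀ q : (Set (Fin n) → ℝ) × ℝ, (∀ F ∈ 𝓕, 0 ≤ q.1 F) →
      flagMap 𝓕 q ∈ (tropMatroid M).support := fun q hq =>
    mem_support_tropMatroid.2 ⟨𝓕, h𝓕.prop, flagMap_mem_flagCone hq⟩
  have hcont : Continuous (flagMap 𝓕) := LinearMap.continuous_of_finiteDimensional _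
  obtain ⟨m, hm⟩ := exists_linear_of_isHarmonicAt (ι := ι) (isOpen_flagInterior 𝓕)
    (convex_flagInterior 𝓕) ⟨(1, 0), by simp⟩ (G := fun q => g (flagMap 𝓕 q))
    (hg.comp hcont.continuousOn fun q hq => hmemT q (mem_closure_flagInterior.1 hq))
    (ℰ.image fun E => E.comap (flagMap 𝓕)) (by
      intro E' hE' y htop
      obtain ⟨E, hE, rfl⟩ := Finset.mem_image.1 hE'
      refine not_range_le_of_maximal hℰ h𝓕 hE (flagMap 𝓕 y) ?_
      rintro _ ⟨q, rfl⟩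
      have hq : q ∈ E.comap (flagMap 𝓕) ⊔ Submodule.span ℝ {y} := by rw [htop]; trivial
      obtain ⟨a, ha, b, hb, rfl⟩ := Submodule.mem_sup.1 hq
      obtain ⟨c, rfl⟩ := Submodule.mem_span_singleton.1 hb
      rw [map_add, map_smul]
      exact Submodule.add_mem_sup ha (Submodule.smul_mem _ _ (Submodule.mem_span_singleton_self _)))
    (by
      intro q hq hqE
      have hqT := hmemT q fun F hF => (hq F hF).le
      refine IsHarmonicAt.comap (Θ := (flagMap 𝓕).toContinuousLinearMap) (A := ⊤)
        (hh (flagMap 𝓕 q) hqT fun E hE h => hqE _ (Finset.mem_image_of_mem _ hE) h)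
        trivial ?_ (Eventually.of_forall fun _ _ => rfl) ?_
      · filter_upwards [(isOpen_flagInterior 𝓕).mem_nhds hq] with w hw
        simpa using hmemT w fun F hF => (hw F hF).le
      · refine (eventually_mem_range_of_maximal h𝓕 hq).mono fun v hv hvT => ?_
        obtain ⟨a, ha⟩ := hv hvT
        exact ⟨a, trivial, ha⟩)
  have hker : (flagMap 𝓕).ker ≤ m.ker := by
    intro z hz
    have hz : flagMap 𝓕 z = 0 := hz
    have hU : ((1, 0) : (Set (Fin n) → ℝ) × ℝ) ∈ {q : (Set (Fin n) → ℝ) × ℝ | ∀ F ∈ 𝓕, 0 < q.1 F} :=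
      by simp
    obtain ⟨ε, h1, hε⟩ := ((eventually_ray ((isOpen_flagInterior 𝓕).eventually_mem hU) z).and
      self_mem_nhdsWithin).exists
    have hε : 0 < ε := hε
    have h2 := hm (subset_closure h1)
    have h3 := hm (subset_closure hU)
    simp only [map_add, map_smul, hz, smul_zero, add_zero] at h2 h3
    rw [h3] at h2
    exact (smul_eq_zero.1 (left_eq_add.1 h2)).resolve_left hε.ne'
  obtain ⟨k, hk⟩ := LinearMap.exists_comp_eq _ _ hker
  refine ⟨k, fun x hx => ?_⟩
  obtain ⟨q, hq, rfl⟩ := mem_flagCone.1 hx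
  rw [hk]
  exact hm (mem_closure_flagInterior.2 hq)

/-- The values of a harmonic function satisfy the balancing condition at a gap of a flag. -/
theorem FlagGap.sum_eq (hg : ContinuousOn g (tropMatroid M).support)
    (hℰ : ∀ E ∈ ℰ, ∀ x ∈ (tropMatroid M).support, ∀ y,
      ¬ ∀ᶠ w in 𝓝 x, w ∈ (tropMatroid M).support → w ∈ E ⊔ Submodule.span ℝ {y})
    (hh : ∀ x ∈ (tropMatroid M).support, (∀ E ∈ ℰ, x ∉ E) →
      IsHarmonicAt ι (tropMatroid M).support g x)
    {𝒢 : Finset (Set (Fin n))} {F H : Set (Fin n)} {I : Finset (Set (Fin n))}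
    (hgap : FlagGap M 𝒢 F H I) :
    ∑ G : I, (g (flatVector G.1) - g (flatVector F)) = g (flatVector H) - g (flatVector F) := by
  classical
  have hnt := hgap.nontrivial
  obtain ⟨G₀, hG₀, hG₀max⟩ := hgap.maximal
  have hdense := dense_compl_submodules (ℰ.image fun E => E.comap (flagMap 𝒢)) (by
    intro E' hE' htop
    obtain ⟨E, hE, rfl⟩ := Finset.mem_image.1 hE'
    refine not_range_le_of_maximal hℰ hG₀max hE (flatVector G₀) ?_
    rintro _ ⟨q, rfl⟩
    rw [flagMap_insert (hgap.notMem hG₀), add_comm]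
    refine Submodule.add_mem_sup ?_ (Submodule.smul_mem _ _ (Submodule.mem_span_singleton_self _))
    have : q ∈ E.comap (flagMap 𝒢) := by rw [htop]; trivial
    exact this)
  obtain ⟨q, hq, hqE⟩ := hdense.inter_open_nonempty _ (isOpen_flagInterior 𝒢) ⟨(1, 0), by simp⟩
  have hxT : flagMap 𝒢 q ∈ (tropMatroid M).support := mem_support_tropMatroid.2
    ⟨𝒢, hgap.flag, flagMap_mem_flagCone fun F hF => (hq F hF).le⟩
  obtain ⟨HH, S, y, ω, l, l₀, hd⟩ := hh _ hxT fun E hE h =>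
    hqE _ (Finset.mem_image_of_mem _ hE) h
  choose k hk using fun G : I =>
    exists_linear_on_flagCone hg hℰ hh (hgap.flag_insert G.1 G.2)
  have hk𝒢 : ∀ G : I, ∀ x ∈ flagCone 𝒢, g x = k G x := fun G x hx =>
    hk G x (flagCone_mono (Finset.subset_insert _ _) hx)
  obtain ⟨qF, hqF⟩ := hgap.lower_mem_range
  have key := hd.sum_eq_of_pieces (κ := I) (Q := (flagMap 𝒢).range)
    (v := fun G => flatVector G.1 - flatVector F) (k := k) (by
      filter_upwards [eventually_subset_of_mem_flagCone hgap.flag hq] with w hw hwT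
      obtain ⟨𝓕, h𝓕, hw𝓕⟩ := mem_support_tropMatroid.1 hwT
      obtain ⟨G, hG, hsub⟩ := hgap.subset_insert 𝓕 h𝓕 (hw 𝓕 h𝓕 hw𝓕)
      obtain ⟨p, hp, rfl⟩ := mem_flagCone.1 (flagCone_mono hsub hw𝓕)
      refine ⟨⟨G, hG⟩, p.1 G, hp G (Finset.mem_insert_self _ _), p + p.1 G • qF, ?_⟩
      rw [flagMap_insert (hgap.notMem hG), map_add, map_smul, hqF]
      module) (by
      rintro G c hc w ⟨p, hp⟩
      have hray := eventually_ray ((isOpen_flagInterior 𝒢).eventually_mem hq) (p - c • qF)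
      filter_upwards [hray, self_mem_nhdsWithin] with ε h1 hε
      have hε : 0 < ε := hε
      have h2 : flagMap 𝒢 q + ε • w ∈ flagCone (insert G.1 𝒢) := by
        have h3 := flagMap_add_mem_flagCone (hgap.notMem G.2) (fun F hF => (h1 F hF).le)
          (mul_nonneg hε.le hc)
        convert h3 using 1
        rw [map_add, map_smul, map_sub, map_smul, hqF, hp]
        module
      exact ⟨mem_support_tropMatroid.2 ⟨_, hgap.flag_insert G.1 G.2, h2⟩, hk G _ h2⟩)
    ⟨q, rfl⟩ (fun G => hk𝒢 G _ (flagMap_mem_flagCone fun F hF => (hq F hF).le))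
    (by
      rw [hgap.sum_flatVector]
      exact Submodule.sub_mem _ hgap.upper_mem_range hgap.lower_mem_range)
    hgap.eq_of_sum_mem ⟨G₀, hG₀⟩
  rw [hgap.sum_flatVector, map_sub, ← hk𝒢 _ _ hgap.lower_mem_flagCone,
    ← hk𝒢 _ _ hgap.upper_mem_flagCone] at key
  rw [← key]
  refine Finset.sum_congr rfl fun G _ => ?_
  rw [map_sub, ← hk𝒢 G _ hgap.lower_mem_flagCone,
    ← hk G _ (flatVector_mem_flagCone (Finset.mem_insert_self _ _))]

theorem flatVector_mem_support {F : Set (Fin n)} (hF : M.IsFlat F) :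
    flatVector F ∈ (tropMatroid M).support := by
  by_cases h0 : F.Nonempty
  · by_cases hu : F = Set.univ
    · subst hu
      exact mem_support_tropMatroid.2 ⟨∅, ⟨by simp, by simp⟩, by
        simpa using smul_univ_mem_flagCone ∅ 1⟩
    · exact mem_support_tropMatroid.2 ⟨{F}, ⟨by simp [hF, h0, hu], by simp⟩,
        flatVector_mem_flagCone (Finset.mem_singleton_self F)⟩
  · rw [Set.not_nonempty_iff_eq_empty.1 h0, flatVector_empty]
    exact mem_support_tropMatroid.2 ⟨∅, ⟨by simp, by simp⟩, zero_mem_flagCone _⟩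

/-- A harmonic function on the support of a matroid variety is the restriction of a linear map,
which is integral if the values of the function at the flats are. -/
theorem exists_linear_on_tropMatroid (hE : M.E = Set.univ) (hM : M.Loopless)
    (hg : ContinuousOn g (tropMatroid M).support)
    (hℰ : ∀ E ∈ ℰ, ∀ x ∈ (tropMatroid M).support, ∀ y,
      ¬ ∀ᶠ w in 𝓝 x, w ∈ (tropMatroid M).support → w ∈ E ⊔ Submodule.span ℝ {y})
    (hh : ∀ x ∈ (tropMatroid M).support, (∀ E ∈ ℰ, x ∉ E) →
      IsHarmonicAt ι (tropMatroid M).support g x) (Λ' : Submodule ℤ W)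
    (hint : ∀ F, M.IsFlat F → g (flatVector F) ∈ Λ') :
    ∃ k : (Fin n → ℝ) →ₗ[ℝ] W, (∀ x ∈ (tropMatroid M).support, g x = k x) ∧
      ∀ z ∈ standardLattice n, k z ∈ Λ' := by
  classical
  have hsub : ∀ X : Set (Fin n), X ⊆ M.E := fun X => by rw [hE]; exact Set.subset_univ X
  have hflag := fun {𝓕} (h𝓕 : IsFlagOfFlats M 𝓕) => exists_linear_on_flagCone hg hℰ hh h𝓕
  rcases isEmpty_or_nonempty (Fin n) with hn | hn
  · refine ⟨0, fun x hx => ?_, fun z hz => by simp⟩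
    obtain ⟨k', hk'⟩ := hflag (𝓕 := ∅) ⟨by simp, by simp⟩
    rw [Subsingleton.elim x 0, hk' 0 (zero_mem_flagCone _), map_zero, map_zero]
  let 𝒜 : Finset (Set (Fin n)) := Finset.univ.filter fun a => ∃ e, M.closure {e} = a
  have h𝒜 : ∀ a ∈ 𝒜, ∃ e, M.closure {e} = a := fun a ha => (Finset.mem_filter.1 ha).2
  choose! r hr using h𝒜
  have hrmem : ∀ a ∈ 𝒜, ∀ b ∈ 𝒜, r a ∈ b → a = b := by
    intro a ha b hb h
    have h1 : r a ∈ M.closure (insert (r b) ∅) \ M.closure ∅ := by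
      refine ⟨by rw [insert_empty_eq, hr b hb]; exact h, ?_⟩
      rw [M.closure_empty, (Matroid.loopless_iff M).1 hM]
      exact Set.notMem_empty _
    have h2 := M.closure_insert_congr h1
    rwa [insert_empty_eq, insert_empty_eq, hr a ha, hr b hb] at h2
  have hrself : ∀ a ∈ 𝒜, r a ∈ a := by
    intro a ha
    have := M.mem_closure_of_mem (Set.mem_singleton (r a)) (hsub _)
    rwa [hr a ha] at this
  let k : (Fin n → ℝ) →ₗ[ℝ] W :=
    -∑ a ∈ 𝒜, (LinearMap.proj (r a) : (Fin n → ℝ) →ₗ[ℝ] ℝ).smulRight (g (flatVector a))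
  have hkapp : ∀ x, k x = -∑ a ∈ 𝒜, x (r a) • g (flatVector a) := by
    intro x; simp [k]
  have hkatom : ∀ b ∈ 𝒜, g (flatVector b) = k (flatVector b) := by
    intro b hb
    rw [hkapp, Finset.sum_eq_single b]
    · simp [flatVector_apply, hrself b hb]
    · intro a ha hab
      have : r a ∉ b := fun h => hab (hrmem a ha b hb h)
      simp [flatVector_apply, this]
    · intro h; exact absurd hb h
  have hflat : ∀ (N : ℕ) (H : Set (Fin n)), H.ncard = N → M.IsFlat H →
      g (flatVector H) = k (flatVector H) := by
    intro N
    induction N using Nat.strong_induction_on with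
    | _ N ih =>
      intro H hN hH
      by_cases h0 : H.Nonempty
      · by_cases hat : ∃ e ∈ H, M.closure {e} = H
        · obtain ⟨e, -, he⟩ := hat
          exact hkatom H (Finset.mem_filter.2 ⟨Finset.mem_univ _, e, he⟩)
        · push Not at hat
          obtain ⟨𝒢, F, I, hgap⟩ := exists_flagGap hE hM hH h0 hat
          have hlt : ∀ K, K ⊂ H → M.IsFlat K → g (flatVector K) = k (flatVector K) :=
            fun K hK hKf => ih K.ncard (hN ▸ Set.ncard_lt_ncard hK) K rfl hKf
          have hFH : F ⊂ H := by
            obtain ⟨G, hG, -⟩ := hgap.maximal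
            obtain ⟨-, h1, h2⟩ := hgap.between G hG
            exact h1.trans h2
          have h1 := hgap.sum_eq hg hℰ hh
          have h2 := congrArg k hgap.sum_flatVector
          rw [map_sum, map_sub] at h2
          rw [Finset.sum_congr rfl fun (G : I) _ => show g (flatVector G.1) - g (flatVector F) =
            k (flatVector G.1 - flatVector F) by
              rw [map_sub, hlt _ (hgap.between G.1 G.2).2.2 (hgap.between G.1 G.2).1,
                hlt F hFH hgap.isFlat], h2, hlt F hFH hgap.isFlat] at h1
          exact (sub_left_injective h1).symm
      · rw [Set.not_nonempty_iff_eq_empty.1 h0, flatVector_empty, map_zero]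
        obtain ⟨k', hk'⟩ := hflag (𝓕 := ∅) ⟨by simp, by simp⟩
        rw [hk' 0 (zero_mem_flagCone _), map_zero]
  refine ⟨k, fun x hx => ?_, fun z hz => ?_⟩
  · obtain ⟨𝓕, h𝓕, hx⟩ := mem_support_tropMatroid.1 hx
    obtain ⟨k', hk'⟩ := hflag h𝓕
    rw [hk' x hx]
    obtain ⟨q, -, rfl⟩ := mem_flagCone.1 hx
    rw [flagMap_apply]
    simp only [map_add, map_sum, map_smul]
    have hu : k' (flatVector Set.univ) = k (flatVector Set.univ) := by
      rw [← hflat _ _ rfl (hE ▸ M.ground_isFlat), hk']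
      simpa using smul_univ_mem_flagCone 𝓕 1
    rw [hu]
    congr 1
    refine Finset.sum_congr rfl fun F hF => ?_
    rw [← hflat _ _ rfl (h𝓕.1 F hF).1, hk' _ (flatVector_mem_flagCone hF)]
  · rw [hkapp]
    refine Λ'.neg_mem (Λ'.sum_mem fun a ha => ?_)
    have hz' : ∃ m : ℤ, z (r a) = (m : ℝ) := by
      refine Submodule.span_induction (p := fun (z : Fin n → ℝ) _ => ∃ m : ℤ, z (r a) = (m : ℝ)) ?_ ?_ ?_ ?_ hz
      · rintro _ ⟨i, rfl⟩
        refine ⟨if r a = i then 1 else 0, ?_⟩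
        rw [Pi.basisFun_apply, Pi.single_apply]
        split_ifs <;> simp
      · exact ⟨0, by simp⟩
      · rintro x y _ _ ⟨a, ha⟩ ⟨b, hb⟩
        exact ⟨a + b, by simp [ha, hb]⟩
      · rintro c x _ ⟨a, ha⟩
        exact ⟨c * a, by simp [ha]⟩
    obtain ⟨m, hm⟩ := hz'
    rw [hm, Int.cast_smul_eq_zsmul]
    refine Λ'.smul_mem m (hint a ?_)
    rw [← hr a ha]
    exact M.isFlat_closure _

theorem flatVector_mem_standardLattice (F : Set (Fin n)) : flatVector F ∈ standardLattice n := by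
  classical
  have : flatVector F = -∑ i with i ∈ F, Pi.basisFun ℝ (Fin n) i := by
    ext j
    simp [flatVector_apply, Pi.single_apply, Finset.sum_ite_eq]
    split_ifs <;> simp
  rw [this]
  exact Submodule.neg_mem _ (Submodule.sum_mem _ fun i _ => Submodule.subset_span ⟨i, rfl⟩)

end MatroidHarmonic

section PolyhedralGeometry

variable {V : Type*} [NormedAddCommGroup V] [NormedSpace ℝ V] {Λ : Submodule ℤ V} {σ τ : Set V}
  {p : V}

theorem eventually_le_ray {a b c : ℝ} (h : a < b ∨ a ≤ b ∧ 0 ≤ c) :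
    ∀ᶠ ε : ℝ in 𝓝[>] 0, a ≤ b + ε * c := by
  rcases h with h | ⟨h, hc⟩
  · have h1 := eventually_ray (P := fun x : ℝ => a < x) (x := b) (lt_mem_nhds h) c
    exact h1.mono fun ε h => by simpa using h.le
  · filter_upwards [self_mem_nhdsWithin] with ε hε
    have : 0 ≤ ε * c := mul_nonneg (le_of_lt hε) hc
    linarith

theorem IsRationalPolyhedron.convex (hσ : IsRationalPolyhedron Λ σ) : Convex ℝ σ := by
  obtain ⟨t, -, rfl⟩ := hσ
  have : {x : V | ∀ a ∈ t, a.2 ≤ a.1 x} = ⋂ a ∈ t, {x | a.2 ≤ a.1 x} := by ext; simp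
  rw [this]
  exact convex_iInter₂ fun a _ => convex_halfSpace_ge a.1.isLinear _

theorem IsRationalPolyhedron.isClosed [FiniteDimensional ℝ V] (hσ : IsRationalPolyhedron Λ σ) :
    IsClosed σ := by
  obtain ⟨t, -, rfl⟩ := hσ
  have : {x : V | ∀ a ∈ t, a.2 ≤ a.1 x} = ⋂ a ∈ t, {x | a.2 ≤ a.1 x} := by ext; simp
  rw [this]
  exact isClosed_biInter fun a _ =>
    isClosed_le continuous_const (LinearMap.continuous_of_finiteDimensional a.1)

theorem eventually_mem_of_mem_localCone (hσ : IsRationalPolyhedron Λ σ) (hp : p ∈ σ) {v : V}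
    (hv : v ∈ localCone p σ) : ∀ᶠ ε : ℝ in 𝓝[>] 0, p + ε • v ∈ σ := by
  obtain ⟨δ, hδ, h⟩ := hv
  have h1 : ∀ᶠ ε : ℝ in 𝓝[>] 0, ε ∈ Set.Ioo 0 δ := Ioo_mem_nhdsGT hδ
  filter_upwards [h1] with ε hε
  have h2 := hσ.convex hp h (a := 1 - ε / δ) (b := ε / δ)
    (by rw [sub_nonneg, div_le_one hδ]; exact hε.2.le) (div_nonneg hε.1.le hδ.le) (by ring)
  convert h2 using 1
  rw [smul_add, smul_smul, div_mul_cancel₀ _ hδ.ne']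
  module

theorem mem_localCone_of_eventually {v : V} (h : ∀ᶠ ε : ℝ in 𝓝[>] 0, p + ε • v ∈ σ) :
    v ∈ localCone p σ := by
  obtain ⟨ε, h1, h2⟩ := (h.and self_mem_nhdsWithin).exists
  exact ⟨ε, h2, h1⟩

theorem sub_mem_localCone {x : V} (hx : x ∈ σ) : x - p ∈ localCone p σ :=
  ⟨1, one_pos, by simpa using hx⟩

theorem localCone_mono (h : τ ⊆ σ) : localCone p τ ⊆ localCone p σ :=
  fun _ ⟨ε, hε, h'⟩ => ⟨ε, hε, h h'⟩

theorem localCone_subset_vectorSpan (hp : p ∈ σ) : localCone p σ ⊆ vectorSpan ℝ σ := by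
  rintro v ⟨ε, hε, h⟩
  have h1 := vsub_mem_vectorSpan ℝ h hp
  rw [vsub_eq_sub, add_sub_cancel_left] at h1
  exact (Submodule.smul_mem_iff _ hε.ne').1 h1

theorem vectorSpan_le_of_localCone_subset {E : Submodule ℝ V} (h : localCone p σ ⊆ E) :
    vectorSpan ℝ σ ≤ E := by
  refine Submodule.span_le.2 ?_
  rintro _ ⟨x, hx, y, hy, rfl⟩
  have := E.sub_mem (h (sub_mem_localCone (p := p) hx)) (h (sub_mem_localCone (p := p) hy))
  simpa using this

/-- Local cones of polyhedra are the cones cut out by the active inequalities. -/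
theorem IsRationalPolyhedron.exists_localCone_eq (hσ : IsRationalPolyhedron Λ σ) (hp : p ∈ σ) :
    ∃ s : Finset (V →ₗ[ℝ] ℝ), (∀ a ∈ s, ∀ x ∈ σ, a p ≤ a x) ∧
      localCone p σ = {v | ∀ a ∈ s, 0 ≤ a v} := by
  classical
  obtain ⟨t, -, rfl⟩ := hσ
  refine ⟨(t.filter fun a => a.1 p = a.2).image Prod.fst, ?_, ?_⟩
  · intro a ha x hx
    obtain ⟨b, hb, rfl⟩ := Finset.mem_image.1 ha
    obtain ⟨hb, h⟩ := Finset.mem_filter.1 hb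
    rw [h]; exact hx b hb
  · ext v
    constructor
    · rintro ⟨ε, hε, h⟩ a ha
      obtain ⟨b, hb, rfl⟩ := Finset.mem_image.1 ha
      obtain ⟨hb, h'⟩ := Finset.mem_filter.1 hb
      have := h b hb
      rw [map_add, map_smul, h', le_add_iff_nonneg_right, smul_eq_mul] at this
      exact nonneg_of_mul_nonneg_right this hε
    · intro h
      refine mem_localCone_of_eventually ((Filter.eventually_all_finset _).2 fun b hb => ?_)
      have h1 : b.2 < b.1 p ∨ b.2 ≤ b.1 p ∧ 0 ≤ b.1 v := by
        rcases (hp b hb).lt_or_eq with h1 | h1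
        · exact Or.inl h1
        · exact Or.inr ⟨h1.le, h b.1 (Finset.mem_image_of_mem _
            (Finset.mem_filter.2 ⟨hb, h1.symm⟩))⟩
      simpa using eventually_le_ray h1

theorem localCone_add_mem (hσ : IsRationalPolyhedron Λ σ) (hp : p ∈ σ) {v w : V}
    (hv : v ∈ localCone p σ) (hw : w ∈ localCone p σ) : v + w ∈ localCone p σ := by
  obtain ⟨s, -, h⟩ := hσ.exists_localCone_eq hp
  rw [h] at hv hw ⊢
  intro a ha
  rw [map_add]; exact add_nonneg (hv a ha) (hw a ha)

theorem localCone_smul_mem {v : V} (hp : p ∈ σ) (hv : v ∈ localCone p σ) {c : ℝ} (hc : 0 ≤ c) :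
    c • v ∈ localCone p σ := by
  obtain ⟨ε, hε, h⟩ := hv
  rcases hc.eq_or_lt with rfl | hc
  · exact ⟨1, one_pos, by simpa using hp⟩
  · exact ⟨ε / c, by positivity, by rwa [smul_smul, div_mul_cancel₀ _ hc.ne']⟩

theorem isClosed_localCone [FiniteDimensional ℝ V] (hσ : IsRationalPolyhedron Λ σ) (hp : p ∈ σ) :
    IsClosed (localCone p σ) := by
  obtain ⟨s, -, h⟩ := hσ.exists_localCone_eq hp
  have : {v : V | ∀ a ∈ s, 0 ≤ a v} = ⋂ a ∈ s, {v | 0 ≤ a v} := by ext; simp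
  rw [h, this]
  exact isClosed_biInter fun a _ =>
    isClosed_le continuous_const (LinearMap.continuous_of_finiteDimensional a)

/-- A linear map that is constant on `σ` vanishes on `V_σ`. -/
theorem map_eq_zero_of_constant_on {W : Type*} [AddCommGroup W] [Module ℝ W] {a : V →ₗ[ℝ] W}
    (h : ∀ x ∈ σ, ∀ y ∈ σ, a x = a y) {w : V} (hw : w ∈ vectorSpan ℝ σ) : a w = 0 := by
  have : vectorSpan ℝ σ ≤ a.ker := by
    refine Submodule.span_le.2 ?_
    rintro _ ⟨x, hx, y, hy, rfl⟩
    simp [h x hx y hy]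
  exact this hw

/-- A polyhedron has a point in its relative interior, and `V_σ` is cut out by integral forms. -/
theorem IsRationalPolyhedron.exists_relInterior (hσ : IsRationalPolyhedron Λ σ)
    (hne : σ.Nonempty) :
    ∃ x ∈ σ, (∀ w ∈ vectorSpan ℝ σ, ∀ᶠ ε : ℝ in 𝓝[>] 0, x + ε • w ∈ σ) ∧
      ∃ s : Finset (V →ₗ[ℝ] ℝ), (∀ a ∈ s, ∀ v ∈ Λ, ∃ k : ℤ, a v = k) ∧
        ∀ w, w ∈ vectorSpan ℝ σ ↔ ∀ a ∈ s, a w = 0 := by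
  classical
  have hconv := hσ.convex
  obtain ⟨t, hint, rfl⟩ := hσ
  set σ : Set V := {x | ∀ a ∈ t, a.2 ≤ a.1 x} with hσdef
  obtain ⟨x, hx, hxt⟩ : ∃ x ∈ σ, ∀ a ∈ t, a.1 x = a.2 → ∀ y ∈ σ, a.1 y = a.2 := by
    suffices h : ∀ t' ⊆ t, ∃ x ∈ σ, ∀ a ∈ t', a.1 x = a.2 → ∀ y ∈ σ, a.1 y = a.2 from
      h t subset_rfl
    intro t'
    induction t' using Finset.induction_on with
    | empty => intro _; obtain ⟨x, hx⟩ := hne; exact ⟨x, hx, by simp⟩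
    | insert b t' _ ih =>
      intro hsub
      obtain ⟨x, hx, h⟩ := ih ((Finset.subset_insert _ _).trans hsub)
      by_cases hb : ∃ y ∈ σ, b.1 y ≠ b.2
      · obtain ⟨y, hy, hyb⟩ := hb
        refine ⟨(1 / 2 : ℝ) • x + (1 / 2 : ℝ) • y, hconv hx hy (by norm_num) (by norm_num)
          (by norm_num), fun a ha hax => ?_⟩
        have h1 := hx a (hsub ha)
        have h2 := hy a (hsub ha)
        simp only [map_add, map_smul, smul_eq_mul] at hax
        rcases Finset.mem_insert.1 ha with rfl | ha
        · exact absurd (by linarith) hyb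
        · exact h a ha (by linarith)
      · push Not at hb
        refine ⟨x, hx, fun a ha hax => ?_⟩
        rcases Finset.mem_insert.1 ha with rfl | ha
        · exact hb
        · exact h a ha hax
  have hray : ∀ w, (∀ a ∈ t, a.1 x = a.2 → a.1 w = 0) → ∀ᶠ ε : ℝ in 𝓝[>] 0, x + ε • w ∈ σ := by
    intro w hw
    refine (Filter.eventually_all_finset _).2 fun a ha => ?_
    have h1 : a.2 < a.1 x ∨ a.2 ≤ a.1 x ∧ 0 ≤ a.1 w := by
      rcases (hx a ha).lt_or_eq with h1 | h1
      · exact Or.inl h1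
      · exact Or.inr ⟨h1.le, (hw a ha h1.symm).ge⟩
    simpa using eventually_le_ray h1
  have hspan : ∀ w ∈ vectorSpan ℝ σ, ∀ a ∈ t, a.1 x = a.2 → a.1 w = 0 := fun w hw a ha hax =>
    map_eq_zero_of_constant_on (fun y hy z hz => by rw [hxt a ha hax y hy, hxt a ha hax z hz]) hw
  refine ⟨x, hx, fun w hw => hray w (hspan w hw),
    (t.filter fun a => a.1 x = a.2).image Prod.fst, ?_, fun w => ⟨fun hw a ha => ?_, fun h => ?_⟩⟩
  · intro a ha
    obtain ⟨b, hb, rfl⟩ := Finset.mem_image.1 ha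
    exact hint b (Finset.mem_filter.1 hb).1
  · obtain ⟨b, hb, rfl⟩ := Finset.mem_image.1 ha
    exact hspan w hw b (Finset.mem_filter.1 hb).1 (Finset.mem_filter.1 hb).2
  · have h1 := hray w fun a ha hax => h a.1 (Finset.mem_image_of_mem _
      (Finset.mem_filter.2 ⟨ha, hax⟩))
    exact localCone_subset_vectorSpan hx (mem_localCone_of_eventually h1)

/-- Simultaneous Diophantine approximation: positive multiples of `v` come arbitrarily close to
lattice points. -/
theorem exists_lattice_near [FiniteDimensional ℝ V] [DiscreteTopology Λ] [IsZLattice ℝ Λ] (v : V)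
    {O : Set V} (hO : O ∈ 𝓝 (0 : V)) : ∃ k : ℕ, 0 < k ∧ ∃ z ∈ Λ, z - (k : ℝ) • v ∈ O := by
  have := ZLattice.module_free ℝ Λ
  have := ZLattice.module_finite ℝ Λ
  let b₀ := Module.Free.chooseBasis ℤ Λ
  let b := b₀.ofZLatticeBasis ℝ Λ
  have hb : Submodule.span ℤ (Set.range b) = Λ := b₀.ofZLatticeBasis_span ℝ
  obtain ⟨δ, hδ, hball⟩ := Metric.mem_nhds_iff.1 hO
  let x : ℕ → V := fun k => ZSpan.fract b ((k : ℝ) • v)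
  have hbdd : Bornology.IsBounded (Set.range x) := by
    refine (Metric.isBounded_closedBall (x := (0 : V)) (r := ∑ i, ‖b i‖)).subset ?_
    rintro _ ⟨k, rfl⟩
    simpa using ZSpan.norm_fract_le (K := ℝ) b ((k : ℝ) • v)
  obtain ⟨a, -, φ, hφ, hlim⟩ := tendsto_subseq_of_bounded hbdd fun k => Set.mem_range_self k
  have hc := hlim.cauchySeq
  obtain ⟨N, hN⟩ := Metric.cauchySeq_iff.1 hc δ hδ
  have h1 := hN N le_rfl (N + 1) (Nat.le_succ N)
  have hlt : φ N < φ (N + 1) := hφ (Nat.lt_succ_self N)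
  refine ⟨φ (N + 1) - φ N, Nat.sub_pos_of_lt hlt,
    (ZSpan.floor b ((φ (N + 1) : ℝ) • v) : V) - ZSpan.floor b ((φ N : ℝ) • v), ?_, hball ?_⟩
  · exact Λ.sub_mem (hb.le (SetLike.coe_mem _)) (hb.le (SetLike.coe_mem _))
  · rw [mem_ball_zero_iff]
    rw [dist_eq_norm] at h1
    refine lt_of_eq_of_lt (congrArg norm ?_) h1
    change _ = ZSpan.fract b ((φ N : ℝ) • v) - ZSpan.fract b ((φ (N + 1) : ℝ) • v)
    rw [ZSpan.fract_apply, ZSpan.fract_apply, Nat.cast_sub hlt.le]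
    module

theorem exists_lattice_mem_of_integral [FiniteDimensional ℝ V] [DiscreteTopology Λ]
    [IsZLattice ℝ Λ] (s : Finset (V →ₗ[ℝ] ℝ)) (hs : ∀ a ∈ s, ∀ v ∈ Λ, ∃ k : ℤ, a v = k)
    {v : V} (hv : ∀ a ∈ s, a v = 0) (b : V →ₗ[ℝ] ℝ) (hb : b v ≠ 0) :
    ∃ z ∈ Λ, (∀ a ∈ s, a z = 0) ∧ b z ≠ 0 := by
  have hcont := fun a : V →ₗ[ℝ] ℝ => LinearMap.continuous_of_finiteDimensional a
  have hO : ∀ᶠ w in 𝓝 (0 : V), (∀ a ∈ s, |a w| < 1) ∧ |b w| < |b v| := by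
    refine ((Filter.eventually_all_finset _).2 fun a _ => ?_).and ?_
    · have h1 : ContinuousAt (fun w => |a w|) 0 := (hcont a).abs.continuousAt
      exact h1.eventually_lt continuousAt_const (by simp)
    · have h1 : ContinuousAt (fun w => |b w|) 0 := (hcont b).abs.continuousAt
      exact h1.eventually_lt continuousAt_const (by simpa using hb)
  obtain ⟨k, hk, z, hz, h1, h2⟩ := exists_lattice_near (Λ := Λ) v hO
  refine ⟨z, hz, fun a ha => ?_, fun h0 => ?_⟩
  · obtain ⟨m, hm⟩ := hs a ha z hz
    have h3 := h1 a ha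
    rw [map_sub, map_smul, hv a ha, smul_zero, sub_zero, hm] at h3
    have h4 : |m| < 1 := by exact_mod_cast h3
    rw [hm, Int.abs_lt_one_iff.1 h4, Int.cast_zero]
  · rw [map_sub, h0, map_smul, zero_sub, abs_neg, smul_eq_mul, abs_mul, Nat.abs_cast] at h2
    have h3 : (1 : ℝ) ≤ k := by exact_mod_cast hk
    have h4 := abs_nonneg (b v)
    nlinarith

/-- A representative of the primitive normal vector of a face does not lie in the span of the
face. -/
theorem IsNormalVector.notMem [FiniteDimensional ℝ V] [DiscreteTopology Λ]
    [IsZLattice ℝ Λ] (hσ : IsRationalPolyhedron Λ σ) (hτ : IsRationalPolyhedron Λ τ)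
    (hne : τ.Nonempty) (hne' : σ.Nonempty) (hlt : vectorSpan ℝ τ < vectorSpan ℝ σ) {u : V}
    (hu : IsNormalVector Λ τ σ u) : u ∉ vectorSpan ℝ τ := by
  intro hmem
  obtain ⟨-, -, -, s, hs, hsσ⟩ := hσ.exists_relInterior hne'
  obtain ⟨-, -, -, t, -, htτ⟩ := hτ.exists_relInterior hne
  obtain ⟨w, hw, hwτ⟩ := SetLike.exists_of_lt hlt
  rw [htτ] at hwτ
  push Not at hwτ
  obtain ⟨b, hb, hbw⟩ := hwτ
  obtain ⟨z, hz, hzs, hbz⟩ := exists_lattice_mem_of_integral s hs ((hsσ w).1 hw) b hbw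
  obtain ⟨k, hk⟩ := hu.2.2.1 z hz ((hsσ z).2 hzs)
  have : z ∈ vectorSpan ℝ τ := by
    have := Submodule.add_mem _ hk (zsmul_mem hmem k)
    simpa using this
  exact hbz ((htτ z).1 this b hb)

end PolyhedralGeometry

namespace WeightedComplex

section Cells

variable {V : Type*} {X : WeightedComplex V} {σ τ : Set V}

theorem IsMaxCell.mem (h : X.IsMaxCell σ) : σ ∈ X.cells := h.prop

theorem IsMaxCell.subset_support (h : X.IsMaxCell σ) (h0 : X.weight σ ≠ 0) : σ ⊆ X.support :=
  fun _ hx => ⟨σ, h, h0, hx⟩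

theorem IsMaxCell.eq_of_subset (h : X.IsMaxCell σ) (hτ : τ ∈ X.cells) (hs : σ ⊆ τ) : σ = τ :=
  h.eq_of_le hτ hs

theorem exists_isMaxCell (hσ : σ ∈ X.cells) : ∃ τ, σ ⊆ τ ∧ X.IsMaxCell τ :=
  X.cells.exists_le_maximal hσ

theorem mem_above : σ ∈ X.above τ ↔ σ ∈ X.cells ∧ τ ⊂ σ := by
  simp [above]

theorem sum_filter_weight_smul {A : Type*} [AddCommGroup A] [Module ℝ A] (T : Finset (Set V))
    (F : Set V → A) :
    ∑ σ ∈ T with X.weight σ ≠ 0, (X.weight σ : ℝ) • F σ = ∑ σ ∈ T, X.weight σ • F σ := by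
  rw [Finset.sum_filter]
  refine Finset.sum_congr rfl fun σ _ => ?_
  split_ifs with h
  · rw [Int.cast_smul_eq_zsmul]
  · push Not at h
    rw [h, zero_smul]

end Cells

section LocalStructure

variable {V : Type*} [NormedAddCommGroup V] [NormedSpace ℝ V]
  {Λ : Submodule ℤ V} {X X' : WeightedComplex V} {σ τ : Set V} {p : V}

/-- The support of the star of `X` at `p`. -/
def localSupport (X : WeightedComplex V) (p : V) : Set V :=
  {v | ∃ σ, X.IsMaxCell σ ∧ X.weight σ ≠ 0 ∧ p ∈ σ ∧ v ∈ localCone p σ}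

theorem smul_mem_localSupport {v : V} (hv : v ∈ X.localSupport p) {c : ℝ} (hc : 0 ≤ c) :
    c • v ∈ X.localSupport p := by
  obtain ⟨σ, h1, h2, h3, h4⟩ := hv
  exact ⟨σ, h1, h2, h3, localCone_smul_mem h3 h4 hc⟩

namespace IsRationalComplex

theorem inter_mem (hX : X.IsRationalComplex Λ) (hσ : σ ∈ X.cells) (hτ : τ ∈ X.cells)
    (hpσ : p ∈ σ) (hpτ : p ∈ τ) : σ ∩ τ ∈ X.cells :=
  hX.face_mem σ hσ _ ⟨p, hpσ, hpτ⟩ (hX.inter_face σ hσ τ hτ ⟨p, hpσ, hpτ⟩).1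

theorem localCone_inter (hX : X.IsRationalComplex Λ) (hσ : σ ∈ X.cells) (hτ : τ ∈ X.cells)
    (hpσ : p ∈ σ) (hpτ : p ∈ τ) {v : V} (h1 : v ∈ localCone p σ) (h2 : v ∈ localCone p τ) :
    v ∈ localCone p (σ ∩ τ) :=
  mem_localCone_of_eventually ((eventually_mem_of_mem_localCone (hX.polyhedron σ hσ) hpσ h1).and
    (eventually_mem_of_mem_localCone (hX.polyhedron τ hτ) hpτ h2))

/-- A linear form exposing the face `σ ∩ τ` of `σ`. -/
theorem exists_exposing (hX : X.IsRationalComplex Λ) (hσ : σ ∈ X.cells) (hτ : τ ∈ X.cells)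
    (hpσ : p ∈ σ) (hpτ : p ∈ τ) :
    ∃ h : V →ₗ[ℝ] ℝ, (∀ x ∈ σ, h x ≤ h p) ∧ ∀ x ∈ σ, (x ∈ τ ↔ h x = h p) := by
  obtain ⟨h, hh⟩ := (hX.inter_face σ hσ τ hτ ⟨p, hpσ, hpτ⟩).1 ⟨p, hpσ, hpτ⟩
  have hp : p ∈ {x ∈ σ | ∀ y ∈ σ, h y ≤ h x} := hh ▸ ⟨hpσ, hpτ⟩
  refine ⟨h.toLinearMap, hp.2, fun x hx => ⟨fun hxτ => ?_, fun hxp => ?_⟩⟩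
  · have hx' : x ∈ {x ∈ σ | ∀ y ∈ σ, h y ≤ h x} := hh ▸ ⟨hx, hxτ⟩
    exact le_antisymm (hp.2 x hx) (hx'.2 p hpσ)
  · have hx' : x ∈ {x ∈ σ | ∀ y ∈ σ, h y ≤ h x} :=
      ⟨hx, fun y hy => (hp.2 y hy).trans_eq hxp.symm⟩
    rw [← hh] at hx'
    exact hx'.2

theorem subset_of_localCone_subset (hX : X.IsRationalComplex Λ) (hσ : σ ∈ X.cells)
    (hτ : τ ∈ X.cells) (hpσ : p ∈ σ) (hpτ : p ∈ τ) (hsub : localCone p σ ⊆ localCone p τ) :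
    σ ⊆ τ := by
  obtain ⟨h, -, heq⟩ := hX.exists_exposing hσ hτ hpσ hpτ
  intro x hx
  have h1 : x - p ∈ localCone p σ := sub_mem_localCone hx
  obtain ⟨ε, ⟨h2, h3⟩, hε⟩ :=
    (((eventually_mem_of_mem_localCone (hX.polyhedron σ hσ) hpσ h1).and
    (eventually_mem_of_mem_localCone (hX.polyhedron τ hτ) hpτ (hsub h1))).and
    self_mem_nhdsWithin).exists
  have hε : 0 < ε := hε
  have h4 := (heq _ h2).1 h3
  rw [map_add, map_smul, map_sub, add_eq_left, smul_eq_mul, mul_eq_zero, sub_eq_zero] at h4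
  exact (heq x hx).2 (h4.resolve_left hε.ne')

theorem support_star (hX : X.IsRationalComplex Λ) : (X.star p).support = X.localSupport p := by
  classical
  have hmem : ∀ {C : Set V}, C ∈ (X.star p).cells ↔ ∃ σ ∈ X.cells, p ∈ σ ∧ localCone p σ = C := by
    intro C
    simp only [star, Finset.mem_image, Finset.mem_filter, and_assoc]
  have hweight : ∀ σ ∈ X.cells, p ∈ σ → (X.star p).weight (localCone p σ) = X.weight σ := by
    intro σ hσ hp
    simp only [star]
    rw [Finset.sum_eq_single_of_mem σ (Finset.mem_filter.2 ⟨hσ, hp, rfl⟩)]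
    intro τ hτ hne
    obtain ⟨hτ, hpτ, he⟩ := Finset.mem_filter.1 hτ
    exact absurd ((hX.subset_of_localCone_subset hτ hσ hpτ hp he.le).antisymm
      (hX.subset_of_localCone_subset hσ hτ hp hpτ he.ge)) hne
  have hmax : ∀ σ ∈ X.cells, p ∈ σ → ((X.star p).IsMaxCell (localCone p σ) ↔ X.IsMaxCell σ) := by
    intro σ hσ hp
    constructor
    · intro h
      refine ⟨hσ, fun τ hτ hle => ?_⟩
      have hpτ : p ∈ τ := hle hp
      exact hX.subset_of_localCone_subset hτ hσ hpτ hp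
        (h.le_of_ge (hmem.2 ⟨τ, hτ, hpτ, rfl⟩) (localCone_mono hle))
    · intro h
      refine ⟨hmem.2 ⟨σ, hσ, hp, rfl⟩, fun C hC hle => ?_⟩
      obtain ⟨τ, hτ, hpτ, rfl⟩ := hmem.1 hC
      exact localCone_mono (h.le_of_ge hτ (hX.subset_of_localCone_subset hσ hτ hp hpτ hle))
  ext v
  constructor
  · rintro ⟨C, hC, h0, hv⟩
    obtain ⟨σ, hσ, hp, rfl⟩ := hmem.1 hC.prop
    exact ⟨σ, (hmax σ hσ hp).1 hC, hweight σ hσ hp ▸ h0, hp, hv⟩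
  · rintro ⟨σ, hσ, h0, hp, hv⟩
    exact ⟨localCone p σ, (hmax σ hσ.mem hp).2 hσ, (hweight σ hσ.mem hp).symm ▸ h0, hv⟩

theorem vectorSpan_lt (hX : X.IsRationalComplex Λ) (hσ : σ ∈ X.cells) (hτ : τ ∈ X.cells)
    (h : τ ⊂ σ) : vectorSpan ℝ τ < vectorSpan ℝ σ := by
  refine lt_of_le_of_ne (vectorSpan_mono ℝ h.subset) fun heq => ?_
  obtain ⟨p, hp⟩ := hX.nonempty τ hτ
  obtain ⟨l, -, hl⟩ := hX.exists_exposing hσ hτ (h.subset hp) hp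
  refine h.not_subset fun x hx => (hl x hx).2 ?_
  have h1 : x - p ∈ vectorSpan ℝ τ := heq ▸ vsub_mem_vectorSpan ℝ hx (h.subset hp)
  have h2 := map_eq_zero_of_constant_on (a := l) (fun y hy z hz => by
    rw [(hl y (h.subset hy)).1 hy, (hl z (h.subset hz)).1 hz]) h1
  rwa [map_sub, sub_eq_zero] at h2

theorem cellDim_le (hσ : σ ∈ X.cells) : cellDim σ ≤ X.dim := Finset.le_sup hσ

variable [FiniteDimensional ℝ V]

theorem cellDim_lt (hX : X.IsRationalComplex Λ) (hσ : σ ∈ X.cells) (hτ : τ ∈ X.cells)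
    (h : τ ⊂ σ) : cellDim τ < cellDim σ :=
  Submodule.finrank_lt_finrank_of_lt (hX.vectorSpan_lt hσ hτ h)

theorem isMaxCell_of_cellDim (hX : X.IsRationalComplex Λ) (hσ : σ ∈ X.cells)
    (h : X.dim ≤ cellDim σ) : X.IsMaxCell σ := by
  obtain ⟨τ, hsub, hτ⟩ := exists_isMaxCell hσ
  rcases hsub.eq_or_ssubset with rfl | hss
  · exact hτ
  · have := hX.cellDim_lt hτ.mem hσ hss
    have := cellDim_le hτ.mem
    omega

theorem eventually_mem_of_mem (hX : X.IsRationalComplex Λ) (p : V) :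
    ∀ᶠ x in 𝓝 p, ∀ σ ∈ X.cells, x ∈ σ → p ∈ σ := by
  refine (Filter.eventually_all_finset _).2 fun σ hσ => ?_
  by_cases hp : p ∈ σ
  · exact Eventually.of_forall fun _ _ => hp
  · filter_upwards [(hX.polyhedron σ hσ).isClosed.isOpen_compl.mem_nhds hp] with x hx h
    exact absurd h hx

theorem eventually_localCone_of_mem (hX : X.IsRationalComplex Λ) (v : V) :
    ∀ᶠ w in 𝓝 v, ∀ σ ∈ X.cells, p ∈ σ → w ∈ localCone p σ → v ∈ localCone p σ := by
  refine (Filter.eventually_all_finset _).2 fun σ hσ => ?_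
  by_cases hp : p ∈ σ
  · by_cases hv : v ∈ localCone p σ
    · exact Eventually.of_forall fun _ _ _ => hv
    · filter_upwards [(isClosed_localCone (hX.polyhedron σ hσ) hp).isOpen_compl.mem_nhds hv]
        with x hx _ h
      exact absurd h hx
  · exact Eventually.of_forall fun _ h => absurd h hp

theorem mem_localSupport (hX : X.IsRationalComplex Λ) {v : V} :
    v ∈ X.localSupport p ↔ ∀ᶠ ε : ℝ in 𝓝[>] 0, p + ε • v ∈ X.support := by
  constructor
  · rintro ⟨σ, hσ, h0, hp, hv⟩
    exact (eventually_mem_of_mem_localCone (hX.polyhedron σ hσ.mem) hp hv).mono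
      fun ε h => hσ.subset_support h0 h
  · intro h
    obtain ⟨ε, ⟨⟨σ, hσ, h0, h1⟩, h2⟩, hε⟩ := ((h.and
      (eventually_ray (hX.eventually_mem_of_mem p) v)).and self_mem_nhdsWithin).exists
    exact ⟨σ, hσ, h0, h2 σ hσ.mem h1, ε, hε, h1⟩

theorem isClosed_localSupport (hX : X.IsRationalComplex Λ) : IsClosed (X.localSupport p) := by
  refine isClosed_of_closure_subset fun v hv => ?_
  obtain ⟨w, ⟨σ, hσ, h0, hp, hw⟩, h⟩ :=
    ((mem_closure_iff_frequently.1 hv).and_eventually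
      (hX.eventually_localCone_of_mem (p := p) v)).exists
  exact ⟨σ, hσ, h0, hp, h σ hσ.mem hp hw⟩

end IsRationalComplex

theorem Equivalent.support_eq (h : Equivalent Λ X X') : X'.support = X.support := by
  obtain ⟨Z, -, h1, h2⟩ := h
  rw [← h1.1, ← h2.1]

theorem Equivalent.weight_pos (h : Equivalent Λ X X') (hX' : X'.IsRationalComplex Λ)
    (hpos : ∀ σ, X.IsMaxCell σ → X.weight σ ≠ 0 → 0 < X.weight σ)
    (hσ : X'.IsMaxCell σ) (h0 : X'.weight σ ≠ 0) : 0 < X'.weight σ := by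
  obtain ⟨Z, -, h1, h2⟩ := h
  obtain ⟨x, hx, hray, -⟩ := (hX'.polyhedron σ hσ.mem).exists_relInterior (hX'.nonempty σ hσ.mem)
  have hxZ : x ∈ Z.support := h2.1 ▸ hσ.subset_support h0 hx
  obtain ⟨ρ, hρ, hρ0, hxρ⟩ := hxZ
  obtain ⟨σ', hσ', hsub, hw⟩ := h2.2 ρ hρ hρ0
  obtain ⟨σX, hσX, -, hwX⟩ := h1.2 ρ hρ hρ0
  have heq : σ = σ' := by
    refine hσ.eq_of_subset hσ'.mem fun y hy => ?_
    obtain ⟨l, hl, hlτ⟩ := hX'.exists_exposing hσ.mem hσ'.mem hx (hsub hxρ)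
    refine (hlτ y hy).2 (le_antisymm (hl y hy) ?_)
    obtain ⟨ε, h3, hε⟩ :=
      ((hray (x - y) (vsub_mem_vectorSpan ℝ hx hy)).and self_mem_nhdsWithin).exists
    have hε : 0 < ε := hε
    have h4 := hl _ h3
    rw [map_add, map_smul, map_sub, smul_eq_mul, add_le_iff_nonpos_right] at h4
    by_contra h5
    push Not at h5
    have := mul_pos hε (sub_pos.2 h5)
    linarith
  rw [heq, ← hw, hwX]
  exact hpos σX hσX (by rw [← hwX]; exact hρ0)

variable [FiniteDimensional ℝ V]

theorem not_localSupport_subset (hX : X.IsRationalComplex Λ) {v : V} (hv : v ∈ X.localSupport p)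
    {E : Submodule ℝ V} (hE : Module.finrank ℝ E + 2 ≤ X.dim) (y : V) :
    ¬ ∀ w ∈ X.localSupport p, ∀ᶠ ε : ℝ in 𝓝[>] 0, v + ε • w ∈ X.localSupport p →
      v + ε • w ∈ E ⊔ Submodule.span ℝ {y} := by
  intro h
  obtain ⟨σ, hσ, h0, hp, hvσ⟩ := hv
  have hray : ∀ w ∈ localCone p σ, ∀ ε : ℝ, 0 < ε → v + ε • w ∈ X.localSupport p :=
    fun w hw ε hε => ⟨σ, hσ, h0, hp, localCone_add_mem (hX.polyhedron σ hσ.mem) hp hvσ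
      (localCone_smul_mem hp hw hε.le)⟩
  have h0σ : (0 : V) ∈ localCone p σ := by simpa using sub_mem_localCone (p := p) hp
  have hvE : v ∈ E ⊔ Submodule.span ℝ {y} := by
    obtain ⟨ε, h1, hε⟩ := ((h 0 ⟨σ, hσ, h0, hp, h0σ⟩).and self_mem_nhdsWithin).exists
    simpa using h1 (hray 0 h0σ ε hε)
  have hle : vectorSpan ℝ σ ≤ E ⊔ Submodule.span ℝ {y} := by
    refine vectorSpan_le_of_localCone_subset (p := p) fun w hw => ?_
    obtain ⟨ε, h1, hε⟩ := ((h w ⟨σ, hσ, h0, hp, hw⟩).and self_mem_nhdsWithin).exists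
    have hε : 0 < ε := hε
    have h2 := Submodule.sub_mem _ (h1 (hray w hw ε hε)) hvE
    rw [add_sub_cancel_left] at h2
    exact (Submodule.smul_mem_iff _ hε.ne').1 h2
  have h1 := Submodule.finrank_mono hle
  have h2 := Submodule.finrank_add_le_finrank_add_finrank E (Submodule.span ℝ {y})
  have h3 := finrank_span_le_card (R := ℝ) ({y} : Set V)
  simp only [Set.toFinset_singleton, Finset.card_singleton] at h3
  have h4 : Module.finrank ℝ (vectorSpan ℝ σ) = X.dim := hX.pure σ hσ
  omega

end LocalStructure

section Harmonic

variable {V : Type*} [NormedAddCommGroup V] [NormedSpace ℝ V] [FiniteDimensional ℝ V]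
  {Λ : Submodule ℤ V} [DiscreteTopology Λ] [IsZLattice ℝ Λ] {X : WeightedComplex V} {σ τ : Set V}
  {p : V}

/-- A linear form that vanishes on `τ` and is negative on the normal vectors of `σ` relative to
`τ`. -/
theorem IsRationalComplex.exists_form (hX : X.IsRationalComplex Λ) (hσ : σ ∈ X.cells)
    (hτ : τ ∈ X.cells) (hlt : τ ⊂ σ) (hdim : cellDim σ ≤ cellDim τ + 1) (hp : p ∈ τ) :
    ∃ h : V →ₗ[ℝ] ℝ, (∀ w ∈ localCone p σ, h w ≤ 0) ∧ (∀ w ∈ vectorSpan ℝ τ, h w = 0) ∧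
      (∀ u, IsNormalVector Λ τ σ u → h u < 0) ∧
      ∀ u, IsNormalVector Λ τ σ u → ∀ w ∈ vectorSpan ℝ σ, w - (h w / h u) • u ∈ vectorSpan ℝ τ := by
  obtain ⟨h, hle, hiff⟩ := hX.exists_exposing hσ hτ (hlt.subset hp) hp
  have hvan : ∀ w ∈ vectorSpan ℝ τ, h w = 0 := fun w hw =>
    map_eq_zero_of_constant_on (fun x hx y hy => by
      rw [(hiff x (hlt.subset hx)).1 hx, (hiff y (hlt.subset hy)).1 hy]) hw
  have hneg : ∀ u, IsNormalVector Λ τ σ u → h u < 0 := by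
    intro u hu
    have hmem := hu.notMem (hX.polyhedron σ hσ) (hX.polyhedron τ hτ) (hX.nonempty τ hτ)
      (hX.nonempty σ hσ) (hX.vectorSpan_lt hσ hτ hlt)
    obtain ⟨q, hq, t, ht, h1⟩ := hu.2.2.2
    have hqp := (hiff q (hlt.subset hq)).1 hq
    have h2 := hle _ h1
    rw [map_add, hqp, map_smul, smul_eq_mul, add_le_iff_nonpos_right] at h2
    rcases h2.lt_or_eq with h3 | h3
    · exact neg_of_mul_neg_right h3 ht.le
    · exfalso
      have h4 := vsub_mem_vectorSpan ℝ ((hiff _ h1).2 (by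
        rw [map_add, hqp, map_smul, smul_eq_mul, h3, add_zero])) hq
      rw [vsub_eq_sub, add_sub_cancel_left] at h4
      exact hmem ((Submodule.smul_mem_iff _ ht.ne').1 h4)
  refine ⟨h, ?_, hvan, hneg, fun u hu w hw => ?_⟩
  · rintro w ⟨ε, hε, h1⟩
    have h2 := hle _ h1
    rw [map_add, map_smul, smul_eq_mul, add_le_iff_nonpos_right] at h2
    exact nonpos_of_mul_nonpos_right h2 hε
  · have hu0 := hneg u hu
    have hK : vectorSpan ℝ τ = vectorSpan ℝ σ ⊓ h.ker := by
      refine Submodule.eq_of_le_of_finrank_le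
        (le_inf (vectorSpan_mono ℝ hlt.subset) fun w hw => hvan w hw) ?_
      have h1 : vectorSpan ℝ σ ⊓ h.ker < vectorSpan ℝ σ := by
        refine lt_of_le_of_ne inf_le_left fun heq => ?_
        have : u ∈ vectorSpan ℝ σ ⊓ h.ker := by rw [heq]; exact hu.2.1
        exact hu0.ne this.2
      have h2 := Submodule.finrank_lt_finrank_of_lt h1
      unfold cellDim at hdim
      omega
    rw [hK]
    refine ⟨Submodule.sub_mem _ hw (Submodule.smul_mem _ _ hu.2.1), ?_⟩
    change h _ = 0
    rw [map_sub, map_smul, smul_eq_mul, div_mul_cancel₀ _ hu0.ne, sub_self]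

/-- Two representatives of a primitive normal vector differ by a vector in the span of the face. -/
theorem IsRationalComplex.normalVector_sub_mem (hX : X.IsRationalComplex Λ) (hσ : σ ∈ X.cells)
    (hτ : τ ∈ X.cells) (hlt : τ ⊂ σ) (hdim : cellDim σ ≤ cellDim τ + 1) {u u' : V}
    (hu : IsNormalVector Λ τ σ u) (hu' : IsNormalVector Λ τ σ u') : u' - u ∈ vectorSpan ℝ τ := by
  obtain ⟨p, hp⟩ := hX.nonempty τ hτ
  obtain ⟨h, -, hvan, hneg, -⟩ := hX.exists_form hσ hτ hlt hdim hp
  obtain ⟨k, hk⟩ := hu.2.2.1 u' hu'.1 hu'.2.1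
  obtain ⟨k', hk'⟩ := hu'.2.2.1 u hu.1 hu.2.1
  have h1 := hvan _ hk
  have h2 := hvan _ hk'
  rw [map_sub, map_zsmul, sub_eq_zero, zsmul_eq_mul] at h1 h2
  have hu0 := hneg u hu
  have hu0' := hneg u' hu'
  have hkpos : (0 : ℝ) < k := by
    by_contra hk
    push Not at hk
    have := mul_nonneg_of_nonpos_of_nonpos hk hu0.le
    linarith
  have hkk : (k' * k : ℝ) = 1 := by
    have : (k' * k : ℝ) * h u = 1 * h u := by rw [mul_assoc, ← h1, ← h2, one_mul]
    exact mul_right_cancel₀ hu0.ne this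
  have hkk' : k' * k = 1 := by exact_mod_cast hkk
  have hk1 : k = 1 := by
    have h3 : 0 < k := by exact_mod_cast hkpos
    rcases Int.isUnit_iff.1 (IsUnit.of_mul_eq_one_right _ hkk') with h4 | h4 <;> omega
  rwa [hk1, one_smul] at hk

variable {W : Type*} [NormedAddCommGroup W] [NormedSpace ℝ W] {f df : V → W} {l : Set V → V →ₗ[ℝ] W}

/-- The derivative of a pseudo-morphism is harmonic outside of the spans of the cells of codimension
at least two. -/
theorem IsTropicalCycle.isHarmonicAt (hX : X.IsTropicalCycle Λ)
    (hpos : ∀ σ, X.IsMaxCell σ → X.weight σ ≠ 0 → 0 < X.weight σ)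
    (hl : ∀ σ ∈ X.cells, σ ⊆ X.support → ∃ c, ∀ x ∈ σ, f x = l σ x + c)
    (hbal : ∀ τ ∈ X.cells, τ ⊆ X.support → cellDim τ + 1 = X.dim →
        ∃ u : Set V → V, (∀ σ ∈ X.above τ, IsNormalVector Λ τ σ (u σ)) ∧
          ∑ σ ∈ X.above τ, X.weight σ • l σ (u σ) = l τ (∑ σ ∈ X.above τ, X.weight σ • u σ))
    (hdf : ∀ σ ∈ X.cells, σ ⊆ X.support → p ∈ σ → ∀ v ∈ localCone p σ, df v = l σ v)
    {v : V} (hv : v ∈ X.localSupport p)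
    (hgen : ∀ τ ∈ X.cells, cellDim τ + 2 ≤ X.dim → v ∉ vectorSpan ℝ τ) :
    IsHarmonicAt (Set V) (X.localSupport p) df v := by
  classical
  have hXr := hX.toIsRationalComplex
  obtain ⟨σ₁, hσ₁, hσ₁0, hpσ₁, hvσ₁⟩ := hv
  obtain ⟨τ, ⟨hτ, hpτ, hvτ⟩, hτmin⟩ : ∃ τ, (τ ∈ X.cells ∧ p ∈ τ ∧ v ∈ localCone p τ) ∧
      ∀ σ ∈ X.cells, p ∈ σ → v ∈ localCone p σ → τ ⊆ σ := by
    have hfin : {τ | τ ∈ X.cells ∧ p ∈ τ ∧ v ∈ localCone p τ}.Finite :=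
      X.cells.finite_toSet.subset fun τ h => h.1
    obtain ⟨τ, hτ, hmin⟩ := hfin.exists_minimal ⟨σ₁, hσ₁.mem, hpσ₁, hvσ₁⟩
    refine ⟨τ, hτ, fun σ hσ hpσ hvσ => ?_⟩
    have := hmin ⟨hXr.inter_mem hσ hτ.1 hpσ hτ.2.1, ⟨hpσ, hτ.2.1⟩,
      hXr.localCone_inter hσ hτ.1 hpσ hτ.2.1 hvσ hτ.2.2⟩ Set.inter_subset_right
    exact this.trans Set.inter_subset_left
  have hτσ₁ := hτmin σ₁ hσ₁.mem hpσ₁ hvσ₁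
  have hτsupp : τ ⊆ X.support := hτσ₁.trans (hσ₁.subset_support hσ₁0)
  have hvspan := localCone_subset_vectorSpan hpτ hvτ
  have hdimτ : X.dim ≤ cellDim τ + 1 := by
    by_contra h
    exact hgen τ hτ (by omega) hvspan
  have hnear : ∀ᶠ w in 𝓝 v, w ∈ vectorSpan ℝ τ → w ∈ localCone p τ := by
    obtain ⟨s, hs, hcone⟩ := (hXr.polyhedron τ hτ).exists_localCone_eq hpτ
    have hdich : ∀ a ∈ s, 0 < a v ∨ ∀ w ∈ vectorSpan ℝ τ, a w = 0 := by
      intro a ha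
      have h1 : 0 ≤ a v := by
        have : v ∈ {v | ∀ a ∈ s, 0 ≤ a v} := hcone ▸ hvτ
        exact this a ha
      rcases h1.lt_or_eq with h1 | h1
      · exact Or.inl h1
      refine Or.inr fun w hw => ?_
      let ac : StrongDual ℝ V := (-a).toContinuousLinearMap
      have hface : {x ∈ τ | ∀ y ∈ τ, ac y ≤ ac x} ∈ X.cells := by
        refine hXr.face_mem τ hτ _ ⟨p, hpτ, fun y hy => ?_⟩ fun _ => ⟨ac, rfl⟩
        simpa [ac] using hs a ha y hy
      have hsub := hτmin _ hface ⟨hpτ, fun y hy => by simpa [ac] using hs a ha y hy⟩ (by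
        obtain ⟨ε, hε, h2⟩ := hvτ
        refine ⟨ε, hε, h2, fun y hy => ?_⟩
        simpa [ac, ← h1] using hs a ha y hy)
      have heq : ∀ x ∈ τ, a x = a p := fun x hx => by
        refine le_antisymm ?_ (hs a ha x hx)
        simpa [ac] using (hsub hx).2 p hpτ
      exact map_eq_zero_of_constant_on (fun x hx y hy => by rw [heq x hx, heq y hy]) hw
    have : ∀ᶠ w in 𝓝 v, ∀ a ∈ s, w ∈ vectorSpan ℝ τ → 0 ≤ a w := by
      refine (Filter.eventually_all_finset _).2 fun a ha => ?_
      rcases hdich a ha with h | h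
      · have hc := (LinearMap.continuous_of_finiteDimensional a).continuousAt (x := v)
        exact (continuousAt_const.eventually_lt hc h).mono fun w hw _ => hw.le
      · exact Eventually.of_forall fun w hw => (h w hw).ge
    rw [hcone]
    exact this.mono fun w hw hwτ a ha => hw a ha hwτ
  have hcells : ∀ᶠ w in 𝓝 v, w ∈ X.localSupport p →
      ∃ σ, X.IsMaxCell σ ∧ X.weight σ ≠ 0 ∧ p ∈ σ ∧ w ∈ localCone p σ ∧ τ ⊆ σ := by
    filter_upwards [hXr.eventually_localCone_of_mem (p := p) v] with w hw
    rintro ⟨σ, hσ, h0, hp, hwσ⟩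
    exact ⟨σ, hσ, h0, hp, hwσ, hτmin σ hσ.mem hp (hw σ hσ.mem hp hwσ)⟩
  by_cases hd : cellDim τ = X.dim
  · have hτmax := hXr.isMaxCell_of_cellDim hτ hd.ge
    have heq : τ = σ₁ := hτmax.eq_of_subset hσ₁.mem hτσ₁
    refine ⟨vectorSpan ℝ τ, {τ}, 0, 1, l, l τ, hvspan, by simp, ?_, ?_, by simp, by simp, by simp⟩
    · filter_upwards [hnear, hcells] with w h1 h2
      simp only [Finset.mem_singleton, exists_eq_left, Pi.zero_apply, smul_zero, sub_zero]
      constructor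
      · intro hw
        obtain ⟨σ, hσ, -, hp, hwσ, hτσ⟩ := h2 hw
        obtain rfl := hτmax.eq_of_subset hσ.mem hτσ
        exact ⟨0, le_rfl, localCone_subset_vectorSpan hp hwσ⟩
      · rintro ⟨-, -, hw⟩
        exact ⟨τ, hτmax, heq ▸ hσ₁0, hpτ, h1 hw⟩
    · filter_upwards [hnear] with w h1 s hs c _ hw
      obtain rfl := Finset.mem_singleton.1 hs
      simp only [Pi.zero_apply, smul_zero, sub_zero] at hw
      exact hdf s hτ hτsupp hpτ w (h1 hw)
  have hd1 : cellDim τ + 1 = X.dim := by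
    have := IsRationalComplex.cellDim_le hτ
    omega
  obtain ⟨u, hu, husum⟩ := hbal τ hτ hτsupp hd1
  obtain ⟨u', hu', husum'⟩ := hX.balanced τ hτ hd1
  have habove : ∀ σ ∈ X.above τ, σ ∈ X.cells ∧ τ ⊂ σ ∧ cellDim σ ≤ cellDim τ + 1 ∧
      X.IsMaxCell σ ∧ p ∈ σ := by
    intro σ hσ
    obtain ⟨h1, h2⟩ := mem_above.1 hσ
    have h3 := hXr.cellDim_lt h1 hτ h2
    have h4 := IsRationalComplex.cellDim_le h1
    exact ⟨h1, h2, by omega, hXr.isMaxCell_of_cellDim h1 (by omega), h2.subset hpτ⟩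
  have husum₀ : ∑ σ ∈ X.above τ, X.weight σ • u σ ∈ vectorSpan ℝ τ := by
    have h1 : ∑ σ ∈ X.above τ, X.weight σ • (u σ - u' σ) ∈ vectorSpan ℝ τ :=
      Submodule.sum_mem _ fun σ hσ => zsmul_mem (hXr.normalVector_sub_mem (habove σ hσ).1 hτ
        (habove σ hσ).2.1 (habove σ hσ).2.2.1 (hu' σ hσ) (hu σ hσ)) _
    have h2 := Submodule.add_mem _ h1 husum'
    rw [← Finset.sum_add_distrib] at h2
    simpa [smul_sub] using h2
  set S := (X.above τ).filter fun σ => X.weight σ ≠ 0 with hSdef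
  have hcone : ∀ σ ∈ X.above τ, ∀ᶠ w in 𝓝 v, ∀ c : ℝ, 0 ≤ c → w - c • u σ ∈ vectorSpan ℝ τ →
      w ∈ localCone p σ := by
    intro σ hσ
    obtain ⟨hσc, hlt, hdim, -, hpσ⟩ := habove σ hσ
    obtain ⟨h, -, hvan, hneg, -⟩ := hXr.exists_form hσc hτ hlt hdim hpτ
    have hu0 := hneg _ (hu σ hσ)
    obtain ⟨q, hq, t, ht, hqt⟩ := (hu σ hσ).2.2.2
    let F : V → V := fun w => w - (h w / h (u σ)) • u σ - (h w / h (u σ) / t) • (q - p)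
    have hF : Tendsto F (𝓝 v) (𝓝 v) := by
      have hc := LinearMap.continuous_of_finiteDimensional h
      have h1 : ContinuousAt F v := by fun_prop
      have h2 := h1.tendsto
      simpa [F, hvan v hvspan] using h2
    filter_upwards [hF.eventually hnear] with w h1 c hc h2
    have h3 : h w / h (u σ) = c := by
      have := hvan _ h2
      rw [map_sub, map_smul, smul_eq_mul, sub_eq_zero] at this
      rw [this, mul_div_cancel_right₀ _ hu0.ne]
    have h4 : F w ∈ localCone p τ := by
      refine h1 ?_
      simp only [F, h3]
      exact Submodule.sub_mem _ h2 (Submodule.smul_mem _ _ (vsub_mem_vectorSpan ℝ hq hpτ))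
    have h5 := localCone_add_mem (hXr.polyhedron σ hσc) hpσ (localCone_mono hlt.subset h4)
      (localCone_smul_mem hpσ (sub_mem_localCone (p := p) hqt) (div_nonneg hc ht.le))
    convert h5 using 1
    simp only [F, h3]
    rw [show q + t • u σ - p = (q - p) + t • u σ by abel, smul_add, smul_smul,
      div_mul_cancel₀ _ ht.ne']
    abel
  have hcone' : ∀ᶠ w in 𝓝 v, ∀ σ ∈ X.above τ, ∀ c : ℝ, 0 ≤ c → w - c • u σ ∈ vectorSpan ℝ τ →
      w ∈ localCone p σ := (Filter.eventually_all_finset _).2 hcone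
  have hS : ∀ σ ∈ S, σ ∈ X.above τ ∧ X.weight σ ≠ 0 := fun σ hσ => Finset.mem_filter.1 hσ
  refine ⟨vectorSpan ℝ τ, S, u, fun σ => (X.weight σ : ℝ), l, l τ, hvspan, ?_, ?_, ?_, ?_, ?_, ?_⟩
  · intro σ hσ
    obtain ⟨h1, h2⟩ := hS σ hσ
    exact_mod_cast hpos σ (habove σ h1).2.2.2.1 h2
  · filter_upwards [hcone', hcells] with w h1 h2
    constructor
    · intro hw
      obtain ⟨σ, hσ, h0, hp, hwσ, hτσ⟩ := h2 hw
      have hlt : τ ⊂ σ := hτσ.ssubset_of_ne fun h => by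
        have h3 : cellDim σ = X.dim := hXr.pure σ hσ
        rw [← h] at h3
        exact hd h3
      have hab : σ ∈ X.above τ := mem_above.2 ⟨hσ.mem, hlt⟩
      obtain ⟨h, hle, -, hneg, hdec⟩ :=
        hXr.exists_form hσ.mem hτ hlt (habove σ hab).2.2.1 hpτ
      exact ⟨σ, Finset.mem_filter.2 ⟨hab, h0⟩, _,
        div_nonneg_of_nonpos (hle w hwσ) (hneg _ (hu σ hab)).le,
        hdec _ (hu σ hab) w (localCone_subset_vectorSpan hp hwσ)⟩
    · rintro ⟨σ, hσ, c, hc, hw⟩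
      obtain ⟨hab, h0⟩ := hS σ hσ
      exact ⟨σ, (habove σ hab).2.2.2.1, h0, (habove σ hab).2.2.2.2, h1 σ hab c hc hw⟩
  · filter_upwards [hcone'] with w h1 σ hσ c hc hw
    obtain ⟨hab, h0⟩ := hS σ hσ
    obtain ⟨h2, -, -, h3, h4⟩ := habove σ hab
    exact hdf σ h2 (h3.subset_support h0) h4 w (h1 σ hab c hc hw)
  · intro σ hσ w hw
    obtain ⟨hab, h0⟩ := hS σ hσ
    obtain ⟨h2, h3, -, h4, -⟩ := habove σ hab
    obtain ⟨c, hc⟩ := hl σ h2 (h4.subset_support h0)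
    obtain ⟨c', hc'⟩ := hl τ hτ hτsupp
    have : (l σ - l τ) w = 0 := by
      refine map_eq_zero_of_constant_on (σ := τ) (fun x hx y hy => ?_) hw
      have e : ∀ x ∈ τ, (l σ - l τ) x = c' - c := by
        intro x hx
        have := (hc x (h3.subset hx)).symm.trans (hc' x hx)
        rw [LinearMap.sub_apply, sub_eq_sub_iff_add_eq_add, this, add_comm]
      rw [e x hx, e y hy]
    rwa [LinearMap.sub_apply, sub_eq_zero] at this
  · rw [sum_filter_weight_smul]
    exact husum₀
  · rw [sum_filter_weight_smul, sum_filter_weight_smul]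
    exact husum

end Harmonic

end WeightedComplex

section Cones

/-- A map that is locally affine on a ray is affine on the ray. -/
theorem eq_affine_of_locally_affine_ray {E : Type*} [AddCommGroup E] [Module ℝ E] {h : ℝ → E}
    (hloc : ∀ t, 0 ≤ t → ∃ a c : E, ∀ᶠ s in 𝓝 t, 0 ≤ s → h s = s • a + c) {a c : E}
    (h0 : ∀ᶠ s in 𝓝 (0 : ℝ), 0 ≤ s → h s = s • a + c) {t : ℝ} (ht : 0 ≤ t) :
    h t = t • a + c := by
  have key := (isPreconnected_Ici (a := (0 : ℝ))).germ_constant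
    (fun (k : E × E) t => ∀ᶠ s in 𝓝 t, 0 ≤ s → h s = s • k.1 + k.2) (by
      intro t ht
      obtain ⟨a, c, hk⟩ := hloc t ht
      exact ⟨(a, c), hk, nhdsWithin_le_nhds hk.eventually_nhds⟩) (by
      rintro ⟨a, c⟩ ⟨a', c'⟩ t ht h1 h2
      have ht : 0 ≤ t := ht
      have h3 : ∀ᶠ s in 𝓝[>] t, s • a + c = s • a' + c' := by
        filter_upwards [nhdsWithin_le_nhds (h1.and h2), self_mem_nhdsWithin] with s hs hts
        have h0s : 0 ≤ s := ht.trans (le_of_lt hts)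
        rw [← hs.1 h0s, hs.2 h0s]
      obtain ⟨s, hs, hts⟩ := (h3.and self_mem_nhdsWithin).exists
      obtain ⟨s', hs', hts'⟩ := (h3.and (Ioo_mem_nhdsGT hts)).exists
      have h4 : (s - s') • (a - a') = 0 := by
        have : (s - s') • (a - a') = (s • a + c - (s • a' + c')) - (s' • a + c - (s' • a' + c')) := by
          module
        rw [this, hs, hs', sub_self, sub_self, sub_self]
      have h5 : a = a' := sub_eq_zero.1 ((smul_eq_zero.1 h4).resolve_left
        (sub_pos.2 hts'.2).ne')
      subst h5
      rw [add_left_cancel hs]) (k := (a, c)) (x := 0) (y := t) (Set.mem_Ici.2 le_rfl)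
    (Set.mem_Ici.2 ht) h0
  exact key.self_of_nhds ht

/-- A morphism from a cycle supported on a cone is affine. -/
theorem IsMorphism.exists_linear_of_cone {V W : Type*} [AddCommGroup V] [Module ℝ V]
    [TopologicalSpace V] [AddCommGroup W] [Module ℝ W] [TopologicalSpace W]
    {Λ : Submodule ℤ V} {Λ' : Submodule ℤ W} {X : WeightedComplex V} {Y : WeightedComplex W}
    {φ : V → W} (h : IsMorphism Λ Λ' X Y φ) (hsmul : ∀ v : V, Continuous fun t : ℝ => t • v)
    (h0 : (0 : V) ∈ X.support) (hcone : ∀ v ∈ X.support, ∀ t : ℝ, 0 ≤ t → t • v ∈ X.support) :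
    ∃ l : V →ₗ[ℝ] W, (∀ v ∈ Λ, l v ∈ Λ') ∧ ∀ v ∈ X.support, φ v = l v + φ 0 := by
  obtain ⟨U, hU, l, hl, c, hc⟩ := h.2 0 h0
  have hc0 : φ 0 = c := by
    rw [hc 0 ⟨h0, mem_of_mem_nhds hU⟩, map_zero, zero_add]
  refine ⟨l, hl, fun v hv => ?_⟩
  have key := eq_affine_of_locally_affine_ray (h := fun t : ℝ => φ (t • v)) (fun t ht => by
    obtain ⟨U', hU', l', -, c', hc'⟩ := h.2 (t • v) (hcone v hv t ht)
    refine ⟨l' v, c', ?_⟩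
    filter_upwards [((hsmul v).tendsto t).eventually hU'] with s hs h0s
    rw [hc' _ ⟨hcone v hv s h0s, hs⟩, map_smul]) (a := l v) (c := c) (by
    have h1 := ((hsmul v).tendsto 0)
    rw [zero_smul] at h1
    filter_upwards [h1.eventually hU] with s hs h0s
    rw [hc _ ⟨hcone v hv s h0s, hs⟩, map_smul]) zero_le_one
  simpa [hc0] using key

theorem IsClosed.mem_of_ray {E : Type*} [NormedAddCommGroup E] [NormedSpace ℝ E] {C : Set E}
    (hC : IsClosed C) {x w : E} (h : ∀ ε : ℝ, 0 < ε → x + ε • w ∈ C) : x ∈ C := by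
  by_contra hx
  obtain ⟨ε, h1, hε⟩ := ((eventually_ray (hC.isOpen_compl.eventually_mem hx) w).and
    self_mem_nhdsWithin).exists
  exact h1 (h ε hε)

end Cones

namespace WeightedComplex

theorem support_preimage {V : Type*} [AddCommGroup V] [Module ℝ V] (L : Submodule ℝ V)
    (Z : WeightedComplex (V ⧸ L)) : (Z.preimage L).support = L.mkQ ⁻¹' Z.support := by
  classical
  have himage : ∀ C : Set (V ⧸ L), L.mkQ '' (L.mkQ ⁻¹' C) = C := fun C =>
    Set.image_preimage_eq C L.mkQ_surjective
  have hle : ∀ C C' : Set (V ⧸ L), L.mkQ ⁻¹' C ≤ L.mkQ ⁻¹' C' ↔ C ≤ C' := fun C C' =>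
    Set.preimage_subset_preimage_iff (by rw [L.mkQ_surjective.range_eq]; exact Set.subset_univ C)
  have hmem : ∀ {σ : Set V}, σ ∈ (Z.preimage L).cells ↔ ∃ C ∈ Z.cells, L.mkQ ⁻¹' C = σ := by
    intro σ; simp only [preimage, Finset.mem_image]
  have hmax : ∀ C ∈ Z.cells, ((Z.preimage L).IsMaxCell (L.mkQ ⁻¹' C) ↔ Z.IsMaxCell C) := by
    intro C hC
    constructor
    · exact fun h => ⟨hC, fun C' hC' hle' =>
        (hle _ _).1 (h.le_of_ge (hmem.2 ⟨C', hC', rfl⟩) ((hle _ _).2 hle'))⟩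
    · refine fun h => ⟨hmem.2 ⟨C, hC, rfl⟩, fun σ hσ hle' => ?_⟩
      obtain ⟨C', hC', rfl⟩ := hmem.1 hσ
      exact (hle _ _).2 (h.le_of_ge hC' ((hle _ _).1 hle'))
  have hw : ∀ C, (Z.preimage L).weight (L.mkQ ⁻¹' C) = Z.weight C := fun C => by
    simp only [preimage, himage]
  ext x
  constructor
  · rintro ⟨σ, hσ, h0, hx⟩
    obtain ⟨C, hC, rfl⟩ := hmem.1 hσ.prop
    exact ⟨C, (hmax C hC).1 hσ, hw C ▸ h0, hx⟩
  · rintro ⟨C, hC, h0, hx⟩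
    exact ⟨_, (hmax C hC.prop).2 hC, (hw C).symm ▸ h0, hx⟩

theorem isClosed_preimage_support {V : Type*} [NormedAddCommGroup V] [NormedSpace ℝ V]
    [FiniteDimensional ℝ V] {L : Submodule ℝ V} {Λ : Submodule ℤ (V ⧸ L)}
    {Z : WeightedComplex (V ⧸ L)} (hZ : ∀ σ ∈ Z.cells, IsRationalPolyhedron Λ σ) :
    IsClosed (L.mkQ ⁻¹' Z.support) := by
  classical
  have : L.mkQ ⁻¹' Z.support =
      ⋃ σ ∈ Z.cells.filter (fun σ => Z.IsMaxCell σ ∧ Z.weight σ ≠ 0), L.mkQ ⁻¹' σ := by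
    ext x
    simp only [Set.mem_preimage, Set.mem_iUnion, Finset.mem_filter, exists_prop, support]
    exact ⟨fun ⟨σ, h1, h2, h3⟩ => ⟨σ, ⟨h1.prop, h1, h2⟩, h3⟩,
      fun ⟨σ, ⟨_, h1, h2⟩, h3⟩ => ⟨σ, h1, h2, h3⟩⟩
  rw [this]
  refine isClosed_biUnion_finset fun σ hσ => ?_
  obtain ⟨t, -, rfl⟩ := hZ σ (Finset.mem_filter.1 hσ).1
  have : L.mkQ ⁻¹' {x | ∀ a ∈ t, a.2 ≤ a.1 x} = ⋂ a ∈ t, {x | a.2 ≤ (a.1 ∘ₗ L.mkQ) x} := by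
    ext; simp
  rw [this]
  exact isClosed_biInter fun a _ =>
    isClosed_le continuous_const (LinearMap.continuous_of_finiteDimensional (a.1 ∘ₗ L.mkQ))

section Derivative

variable {V W : Type*} [NormedAddCommGroup V] [NormedSpace ℝ V] [NormedAddCommGroup W]
  [NormedSpace ℝ W] {Λ : Submodule ℤ V} {X : WeightedComplex V} {p : V} {f df : V → W}
  {l : Set V → V →ₗ[ℝ] W}

/-- The directional derivative at `p` of a function that is affine on the cells. -/
theorem IsRationalComplex.exists_derivative (hX : X.IsRationalComplex Λ)
    (hl : ∀ σ ∈ X.cells, σ ⊆ X.support → ∃ c, ∀ x ∈ σ, f x = l σ x + c) (p : V) :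
    ∃ df : V → W, ∀ σ ∈ X.cells, σ ⊆ X.support → p ∈ σ → ∀ v ∈ localCone p σ, df v = l σ v := by
  classical
  refine ⟨fun v => if h : ∃ σ ∈ X.cells, σ ⊆ X.support ∧ p ∈ σ ∧ v ∈ localCone p σ then
    l h.choose v else 0, fun σ hσ hσX hp v hv => ?_⟩
  have h : ∃ σ ∈ X.cells, σ ⊆ X.support ∧ p ∈ σ ∧ v ∈ localCone p σ := ⟨σ, hσ, hσX, hp, hv⟩
  beta_reduce
  rw [dif_pos h]
  obtain ⟨h1, h2, h3, h4⟩ := h.choose_spec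
  set τ := h.choose
  obtain ⟨c, hc⟩ := hl σ hσ hσX
  obtain ⟨c', hc'⟩ := hl τ h1 h2
  obtain ⟨ε, ⟨e1, e2⟩, hε⟩ :=
    (((eventually_mem_of_mem_localCone (hX.polyhedron σ hσ) hp hv).and
    (eventually_mem_of_mem_localCone (hX.polyhedron τ h1) h3 h4)).and self_mem_nhdsWithin).exists
  have hε : 0 < ε := hε
  have h5 := (hc p hp).symm.trans (hc' p h3)
  have h6 := (hc _ e1).symm.trans (hc' _ e2)
  rw [map_add, map_add, add_right_comm, h5, add_right_comm, add_left_inj, add_right_inj, map_smul,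
    map_smul] at h6
  exact (smul_right_injective W hε.ne' h6).symm

theorem IsRationalComplex.continuousOn_derivative [FiniteDimensional ℝ V]
    (hX : X.IsRationalComplex Λ)
    (hdf : ∀ σ ∈ X.cells, σ ⊆ X.support → p ∈ σ → ∀ v ∈ localCone p σ, df v = l σ v) :
    ContinuousOn df (X.localSupport p) := by
  intro v _ O hO
  have h1 : ∀ᶠ w in 𝓝 v, ∀ σ ∈ X.cells, σ ⊆ X.support → p ∈ σ → v ∈ localCone p σ → l σ w ∈ O := by
    refine (Filter.eventually_all_finset _).2 fun σ hσ => ?_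
    by_cases h : σ ⊆ X.support ∧ p ∈ σ ∧ v ∈ localCone p σ
    · have hc := (LinearMap.continuous_of_finiteDimensional (l σ)).tendsto v
      rw [← hdf σ hσ h.1 h.2.1 v h.2.2] at hc
      exact (hc.eventually hO).mono fun w hw _ _ _ => hw
    · exact Eventually.of_forall fun w h1 h2 h3 => absurd ⟨h1, h2, h3⟩ h
  change ∀ᶠ w in 𝓝[X.localSupport p] v, df w ∈ O
  filter_upwards [nhdsWithin_le_nhds h1, self_mem_nhdsWithin,
    nhdsWithin_le_nhds (hX.eventually_localCone_of_mem (p := p) v)] with w h2 h3 h4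
  obtain ⟨σ, hσ, h0, hp, hw⟩ := h3
  have hsub := hσ.subset_support h0
  rw [hdf σ hσ.mem hsub hp w hw]
  exact h2 σ hσ.mem hsub hp (h4 σ hσ.mem hp hw)

end Derivative

end WeightedComplex

theorem mainTheorem8
    {V : Type*} [NormedAddCommGroup V] [NormedSpace ℝ V] [FiniteDimensional ℝ V]
    (Λ : Submodule ℤ V) [DiscreteTopology Λ] [IsZLattice ℝ Λ]
    {W : Type*} [NormedAddCommGroup W] [NormedSpace ℝ W] [FiniteDimensional ℝ W]
    (Λ' : Submodule ℤ W) [DiscreteTopology Λ'] [IsZLattice ℝ Λ']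
    (X : WeightedComplex V) (hX : IsSmoothVariety Λ X)
    (Y : WeightedComplex W) (hY : Y.IsTropicalCycle Λ')
    (f : V → W) (hf : IsPseudoMorphism Λ Λ' X Y f) :
    IsMorphism Λ Λ' X Y f := by
  classical
  refine ⟨hf.1, fun p hp => ?_⟩
  obtain ⟨-, 𝒳, ⟨h𝒳, heq⟩, lin, hlin, hbal⟩ := hf
  have h𝒳r := h𝒳.toIsRationalComplex
  have hXr := hX.toIsRationalComplex
  have hsupp := heq.support_eq
  rw [← hsupp] at hlin hbal
  have hpos : ∀ σ, 𝒳.IsMaxCell σ → 𝒳.weight σ ≠ 0 → 0 < 𝒳.weight σ := fun σ hσ h0 =>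
    heq.weight_pos h𝒳r hX.weight_pos hσ h0
  have hl : ∀ σ ∈ 𝒳.cells, σ ⊆ 𝒳.support → ∃ c, ∀ x ∈ σ, f x = lin σ x + c :=
    fun σ hσ h => (hlin σ hσ h).2
  obtain ⟨df, hdf⟩ := h𝒳r.exists_derivative hl p
  obtain ⟨n, M, L, Z, φ, hE, hM, ⟨-, hZ, hZeq⟩, hφ, -, ψ, hψ, hinv⟩ := hX.locally_matroid p hp
  set D := 𝒳.localSupport p with hDdef
  have hstar : (X.star p).support = D := by
    rw [hXr.support_star]
    ext v
    rw [hXr.mem_localSupport, hDdef, h𝒳r.mem_localSupport, hsupp]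
  have hDclosed : IsClosed D := h𝒳r.isClosed_localSupport
  have hDsmul : ∀ v ∈ D, ∀ t : ℝ, 0 ≤ t → t • v ∈ D :=
    fun v hv t ht => WeightedComplex.smul_mem_localSupport hv ht
  obtain ⟨σp, hσp, hσp0, hpσp⟩ : p ∈ 𝒳.support := hsupp ▸ hp
  have hD0 : (0 : V) ∈ D :=
    ⟨σp, hσp, hσp0, hpσp, by simpa using sub_mem_localCone (p := p) hpσp⟩
  have hT : (tropMatroid M).support = L.mkQ ⁻¹' Z.support := by
    rw [← hZeq.support_eq, WeightedComplex.support_preimage]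
  have hTclosed : IsClosed (L.mkQ ⁻¹' Z.support) :=
    WeightedComplex.isClosed_preimage_support hZ.polyhedron
  have hTsmul : ∀ x ∈ L.mkQ ⁻¹' Z.support, ∀ t : ℝ, 0 ≤ t → t • x ∈ L.mkQ ⁻¹' Z.support := by
    rw [← hT]
    intro x hx t ht
    obtain ⟨𝓕, h1, h2⟩ := mem_support_tropMatroid.1 hx
    exact mem_support_tropMatroid.2 ⟨𝓕, h1, flagCone_smul h2 ht⟩
  have hZsmul : ∀ z ∈ Z.support, ∀ t : ℝ, 0 ≤ t → t • z ∈ Z.support := by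
    intro z hz t ht
    obtain ⟨x, rfl⟩ := L.mkQ_surjective z
    exact hTsmul x hz t ht
  have hT0 : (0 : Fin n → ℝ) ∈ L.mkQ ⁻¹' Z.support := by
    rw [← hT]
    exact mem_support_tropMatroid.2 ⟨∅, ⟨by simp, by simp⟩, zero_mem_flagCone _⟩
  have hZ0 : (0 : (Fin n → ℝ) ⧸ L) ∈ Z.support := by simpa using hT0
  obtain ⟨l, hlΛ, hlφ⟩ := hφ.exists_linear_of_cone (fun v => by fun_prop) (hstar ▸ hD0)
    (by rw [hstar]; exact hDsmul)
  obtain ⟨m, hmΛ, hmψ⟩ := hψ.exists_linear_of_cone (fun z => by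
    obtain ⟨x, rfl⟩ := L.mkQ_surjective z
    have h1 : Continuous fun t : ℝ => t • x := by fun_prop
    exact continuous_quotient_mk'.comp h1) hZ0 hZsmul
  rw [hstar] at hlφ
  have hφmaps : ∀ v ∈ D, φ v ∈ Z.support := fun v hv => hφ.1 (hstar ▸ hv)
  have hψmaps : ∀ z ∈ Z.support, ψ z ∈ D := fun z hz => hstar ▸ hψ.1 hz
  have hml : ∀ v ∈ D, m (l v) = v := by
    have h1 : ∀ v ∈ D, m (l v) + (m (φ 0) + ψ 0) = v := by
      intro v hv
      have h2 : ψ (φ v) = v := hinv.1 (hstar ▸ hv)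
      rw [hmψ _ (hφmaps v hv), hlφ v hv, map_add, add_assoc] at h2
      exact h2
    have h3 := h1 0 hD0
    rw [map_zero, map_zero, zero_add] at h3
    intro v hv
    simpa [h3] using h1 v hv
  have hlm : ∀ z ∈ Z.support, l (m z) = z := by
    have h1 : ∀ z ∈ Z.support, l (m z) + (l (ψ 0) + φ 0) = z := by
      intro z hz
      have h2 : φ (ψ z) = z := hinv.2 hz
      rw [hlφ _ (hψmaps z hz), hmψ z hz, map_add, add_assoc] at h2
      exact h2
    have h3 := h1 0 hZ0
    rw [map_zero, map_zero, zero_add] at h3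
    intro z hz
    simpa [h3] using h1 z hz
  have hmD : ∀ z ∈ Z.support, m z ∈ D := by
    intro z hz
    refine hDclosed.mem_of_ray (w := ψ 0) fun ε hε => ?_
    have h1 := hDsmul _ (hψmaps _ (hZsmul z hz ε⁻¹ (inv_nonneg.2 hε.le))) ε hε.le
    rwa [hmψ _ (hZsmul z hz ε⁻¹ (inv_nonneg.2 hε.le)), map_smul, smul_add, smul_smul,
      mul_inv_cancel₀ hε.ne', one_smul] at h1
  have hlD : ∀ v ∈ D, l v ∈ Z.support := by
    intro v hv
    obtain ⟨x, hx⟩ := L.mkQ_surjective (l v)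
    obtain ⟨w, hw⟩ := L.mkQ_surjective (φ 0)
    rw [← hx]
    refine hTclosed.mem_of_ray (w := w) fun ε hε => ?_
    have h1 := hZsmul _ (hφmaps _ (hDsmul v hv ε⁻¹ (inv_nonneg.2 hε.le))) ε hε.le
    rw [hlφ _ (hDsmul v hv ε⁻¹ (inv_nonneg.2 hε.le)), map_smul, smul_add, smul_smul,
      mul_inv_cancel₀ hε.ne', one_smul] at h1
    rw [Set.mem_preimage, map_add, map_smul, hx, hw]
    exact h1
  let Θ : (Fin n → ℝ) →L[ℝ] V := (m ∘ₗ L.mkQ).toContinuousLinearMap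
  have hΘ : ∀ x, Θ x = m (L.mkQ x) := fun _ => rfl
  let A : Submodule ℝ (Fin n → ℝ) := (l ∘ₗ m ∘ₗ L.mkQ - L.mkQ).ker
  have hA : ∀ x, x ∈ A ↔ l (Θ x) = L.mkQ x := fun x => by
    change (l ∘ₗ m ∘ₗ L.mkQ - L.mkQ) x = 0 ↔ _
    rw [LinearMap.sub_apply, sub_eq_zero]
    rfl
  have hTiff : ∀ x, x ∈ (tropMatroid M).support ↔ x ∈ A ∧ Θ x ∈ D := by
    intro x
    rw [hT, hA]
    exact ⟨fun h => ⟨hlm _ h, hmD _ h⟩, fun h => by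
      rw [Set.mem_preimage, ← h.1]; exact hlD _ h.2⟩
  have hlift : ∀ v ∈ D, ∃ x ∈ (tropMatroid M).support, Θ x = v := by
    intro v hv
    obtain ⟨x, hx⟩ := L.mkQ_surjective (l v)
    refine ⟨x, ?_, by rw [hΘ, hx, hml v hv]⟩
    rw [hT, Set.mem_preimage, hx]
    exact hlD v hv
  obtain ⟨k, hk, hkint⟩ := exists_linear_on_tropMatroid (ι := Set V) (g := fun x => df (Θ x))
    (ℰ := (𝒳.cells.filter fun τ => cellDim τ + 2 ≤ 𝒳.dim).image
      fun τ => (vectorSpan ℝ τ).comap Θ.toLinearMap) hE hM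
    ((h𝒳r.continuousOn_derivative hdf).comp Θ.continuous.continuousOn
      fun x hx => ((hTiff x).1 hx).2)
    (by
      intro E hE x hx y hev
      obtain ⟨τ, hτ, rfl⟩ := Finset.mem_image.1 hE
      refine WeightedComplex.not_localSupport_subset h𝒳r ((hTiff x).1 hx).2
        (Finset.mem_filter.1 hτ).2 (Θ y) fun w hw => ?_
      obtain ⟨t, ht, rfl⟩ := hlift w hw
      filter_upwards [eventually_ray hev t] with ε h1 h2
      rw [← map_smul, ← map_add] at h2 ⊢
      have h3 := h1 ((hTiff _).2 ⟨A.add_mem ((hTiff x).1 hx).1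
        (A.smul_mem ε ((hTiff t).1 ht).1), h2⟩)
      obtain ⟨a, ha, b, hb, hab⟩ := Submodule.mem_sup.1 h3
      obtain ⟨c, rfl⟩ := Submodule.mem_span_singleton.1 hb
      rw [← hab, map_add, map_smul]
      exact Submodule.add_mem_sup ha
        (Submodule.smul_mem _ _ (Submodule.mem_span_singleton_self _)))
    (by
      intro x hx hxE
      refine (h𝒳.isHarmonicAt hpos hl hbal hdf ((hTiff x).1 hx).2 fun τ hτ hd h => ?_).comap
        ((hTiff x).1 hx).1 (Eventually.of_forall hTiff) (Eventually.of_forall fun _ _ => rfl)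
        (Eventually.of_forall fun v hv => ?_)
      · exact hxE _ (Finset.mem_image_of_mem _ (Finset.mem_filter.2 ⟨hτ, hd⟩)) h
      · obtain ⟨x, hx, hxv⟩ := hlift v hv
        exact ⟨x, ((hTiff x).1 hx).1, hxv⟩)
    Λ' (by
      intro F hF
      obtain ⟨σ, hσ, h0, hpσ, hv⟩ := ((hTiff _).1 (flatVector_mem_support hF)).2
      rw [hdf σ hσ.mem (hσ.subset_support h0) hpσ _ hv]
      exact (hlin σ hσ.mem (hσ.subset_support h0)).1 _
        (hmΛ _ ⟨_, flatVector_mem_standardLattice F, rfl⟩))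
  have hdf0 : df 0 = 0 := by
    rw [hdf σp hσp.mem (hσp.subset_support hσp0) hpσp 0
      (by simpa using sub_mem_localCone (p := p) hpσp), map_zero]
  have hkL : L ≤ k.ker := by
    intro z hz
    have hz0 : L.mkQ z = 0 := by simpa using hz
    have hzT : z ∈ (tropMatroid M).support := by
      rw [hT, Set.mem_preimage, hz0]; exact hZ0
    change k z = 0
    rw [← hk z hzT]
    change df (m (L.mkQ z)) = 0
    rw [hz0, map_zero, hdf0]
  refine ⟨{x | ∀ σ ∈ 𝒳.cells, x ∈ σ → p ∈ σ}, h𝒳r.eventually_mem_of_mem p, L.liftQ k hkL ∘ₗ l,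
    fun v hv => ?_, f p - (L.liftQ k hkL ∘ₗ l) p, ?_⟩
  · obtain ⟨z, hz, hzv⟩ := hlΛ v hv
    have hzv : L.mkQ z = l v := hzv
    rw [LinearMap.comp_apply, ← hzv, Submodule.mkQ_apply, Submodule.liftQ_apply]
    exact hkint z hz
  · rintro x ⟨hx, hxU⟩
    rw [← hsupp] at hx
    obtain ⟨σ, hσ, h0, hxσ⟩ := hx
    have hpσ := hxU σ hσ.mem hxσ
    obtain ⟨c, hc⟩ := hl σ hσ.mem (hσ.subset_support h0)
    have hcone : x - p ∈ localCone p σ := sub_mem_localCone hxσ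
    have hD : x - p ∈ D := ⟨σ, hσ, h0, hpσ, hcone⟩
    have h1 : (L.liftQ k hkL ∘ₗ l) (x - p) = lin σ (x - p) := by
      obtain ⟨y, hy⟩ := L.mkQ_surjective (l (x - p))
      have hyT : y ∈ (tropMatroid M).support := by
        rw [hT, Set.mem_preimage, hy]; exact hlD _ hD
      rw [LinearMap.comp_apply, ← hy, Submodule.mkQ_apply, Submodule.liftQ_apply, ← hk y hyT]
      change df (m (L.mkQ y)) = _
      rw [hy, hml _ hD, hdf σ hσ.mem (hσ.subset_support h0) hpσ _ hcone]
    rw [hc x hxσ, hc p hpσ]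
    rw [map_sub, map_sub, sub_eq_sub_iff_add_eq_add] at h1
    have h2 : (L.liftQ k hkL ∘ₗ l) x = lin σ x + (L.liftQ k hkL ∘ₗ l) p - lin σ p :=
      eq_sub_of_add_eq h1
    rw [h2]
    abel
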